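/- **Setting.** Let $\Bbbk$ be an algebraically closed field of characteristic $0$, $q\in\Bbbk^\times$, $m,n\ge 0$, $I_0=\{1,\dots,m\}$, $I_1=\{m+1,\dots,m+n\}$, $I=I_0\cup I_1$, $J=\{1,\dots,m+n-1\}$. Put $[r]=q^{r-1}+q^{r-3}+\cdots+q^{1-r}$, let ${r\brack s}$ be the $q$-binomial coefficient (the value at $v=q$ of the element ${r\brack s}_v$ of $\mathbb Z[v,v^{-1}]$), and let $\mathbf{char}(q)$ be the least $\ell>0$ with $[\ell]=0$, or $0$ if there is none. For tuples of integers put $\alpha*\beta=\sum_{j<i}\alpha_i\beta_j$ and $|\alpha|=\sum_i\alpha_i$. **Algebras.** $\mathcal A_q(m)$ has basis $x^{(\alpha)}$, $\alpha\in\mathbb Z_{\ge0}^m$, and product $x^{(\alpha)}x^{(\beta)}=q^{\alpha*\beta}\prod_i{\alpha_i+\beta_i\brack\alpha_i}\,x^{(\alpha+\beta)}$. $\Lambda_{q^{-1}}(n)$ is generated by $x_i$, $i\in I_1$, with $x_i^2=0$ and $x_jx_i=-q\,x_ix_j$ for $i<j$; it has the basis $x^\mu=x_{m+1}^{\mu_1}\cdots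 x_{m+n}^{\mu_n}$, $\mu\in\{0,1\}^n$. The quantum Grassmann superalgebra is $\Omega_q(m|n)=\mathcal A_q(m)\otimes\Lambda_{q^{-1}}(n)$ with product $(x^{(\alpha)}\otimes x^\mu)(x^{(\beta)}\otimes x^\nu)=q^{|\mu||\beta|}x^{(\alpha)}x^{(\beta)}\otimes x^\mu x^\nu$. If $\mathbf{char}(q)=\ell>2$, then $\Omega_q(m|n,\mathbf 1)$ is its subalgebra spanned by the $x^{(\alpha)}\otimes x^\mu$ with all $\alpha_i\le\ell-1$. **Operators on $\Omega_q(m|n)$.** $x_i$ also denotes left multiplication by $x_i$ (that is, by $x^{(\epsilon_i)}\otimes1$ if $i\in I_0$ and by $1\otimes x_i$ if $i\in I_1$). Write $\mu_{(i)}=\mu_{i-m}$ for $i\in I_1$; in $\epsilon_i*\mu$ with $i\in I_1$, $\epsilon_i$ stands for the $(i-m)$-th unit vector of $\mathbb Z^n$. Set $$\sigma_i(x^{(\alpha)}\otimes x^\mu)=q^{\alpha_i}\,x^{(\alpha)}\otimes x^\mu\ (i\in I_0),\qquad \sigma_i(x^{(\alpha)}\otimes x^\mu)=(-q)^{\mu_{(i)}}\,x^{(\alpha)}\otimes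 x^\mu\ (i\in I_1),$$ $$\tau_i(x^{(\alpha)}\otimes x^\mu)=(-1)^{\mu_{(i)}}x^{(\alpha)}\otimes x^\mu\ (i\in I_1),\qquad \tau(x^{(\alpha)}\otimes x^\mu)=(-1)^{|\mu|}x^{(\alpha)}\otimes x^\mu,$$ $$\partial_i(x^{(\alpha)}\otimes x^\mu)=q^{-\epsilon_i*\alpha}x^{(\alpha-\epsilon_i)}\otimes x^\mu\ (i\in I_0),\qquad \partial_i(x^{(\alpha)}\otimes x^\mu)=q^{-|\alpha|}(-q)^{-\epsilon_i*\mu}x^{(\alpha)}\otimes x^{\mu-\epsilon_i}\ (i\in I_1),$$ where a term with a negative exponent is $0$. **Quantum algebras.** Suppose $q^2\ne1$. Let $(\epsilon_i,\epsilon_j)=\pm\delta_{ij}$, with $+$ for $i\in I_0$ and $-$ for $i\in I_1$; $\alpha_j=\epsilon_j-\epsilon_{j+1}$; $q_i=q^{(\epsilon_i,\epsilon_i)}$; $p(j)=\delta_{jm}$. $\mathcal U_q(\mathfrak{gl}(m|n))$ is the algebra with generators $E_j,F_j$ $(j\in J)$, $K_i^{\pm1}$ $(i\in I)$, $\sigma$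 and relations, where $\mathcal K_j=K_jK_{j+1}^{-1}$: * the $K_i$ commute, $K_iK_i^{-1}=1=K_i^{-1}K_i$, $K_iE_j=q^{(\epsilon_i,\alpha_j)}E_jK_i$, $K_iF_j=q^{-(\epsilon_i,\alpha_j)}F_jK_i$; * $E_iF_j-(-1)^{p(i)p(j)}F_jE_i=\delta_{ij}(\mathcal K_i-\mathcal K_i^{-1})/(q_i-q_i^{-1})$; * $E_iE_j=E_jE_i$ for $|i-j|>1$; $E_i^2E_j-(q+q^{-1})E_iE_jE_i+E_jE_i^2=0$ for $|i-j|=1$, $i\ne m$; $E_m^2=0$; and, if $m-1,m,m+1\in J$, $E_{m-1}E_mE_{m+1}E_m+E_mE_{m-1}E_mE_{m+1}+E_{m+1}E_mE_{m-1}E_m+E_mE_{m+1}E_mE_{m-1}-(q+q^{-1})E_mE_{m-1}E_{m+1}E_m=0$; and the same with $F$ in place of $E$; * $\sigma^2=1$, $\sigma E_j\sigma=(-1)^{p(j)}E_j$, $\sigma F_j\sigma=(-1)^{p(j)}F_j$, $\sigma K_i\sigma=K_i$. $\mathcal U_q(\mathfrak{sl}(m|n))$ is defined in the same way with generators $\mathcal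 K_j^{\pm1}$ $(j\in J)$ instead of the $K_i^{\pm1}$: the $\mathcal K_j$ are invertible, commute with each other and with $\sigma$, $\mathcal K_iE_j=q^{(\alpha_i,\alpha_j)}E_j\mathcal K_i$, $\mathcal K_iF_j=q^{-(\alpha_i,\alpha_j)}F_j\mathcal K_i$, and the other relations are the same. Both are bialgebras (in fact Hopf algebras) with $$\Delta(E_j)=E_j\otimes\mathcal K_j+\sigma^{p(j)}\otimes E_j,\qquad \Delta(F_j)=F_j\otimes1+\sigma^{p(j)}\mathcal K_j^{-1}\otimes F_j,$$ $\sigma$ and the $K_i$ (resp. $\mathcal K_j$) group-like, and $\epsilon(E_j)=\epsilon(F_j)=0$. If $\mathbf{char}(q)=\ell>2$, then $u_q(\mathfrak{gl}(m|n))$ and $u_q(\mathfrak{sl}(m|n))$ are their quotient bialgebras by the relations $E_j^\ell=F_j^\ell=0$ $(j\ne m)$, $E_m^2=F_m^2=0$, and $K_i^{2\ell}=1$ $(i\in I)$, resp. $\mathcal K_j^{2\ell}=1$ $(j\in J)$. **Theorem.** Consider the formulas $$E_j\mapsto x_j\partial_{j+1}\sigma_j,\quad F_j\mapsto\sigma_j^{-1}x_{j+1}\partial_j\quad(j\in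 J),\qquad K_i\mapsto\sigma_i\ (i\in I_0),\quad K_i\mapsto(\sigma_i\tau_i)^{-1}\ (i\in I_1),\qquad \sigma\mapsto\tau,$$ $$\mathcal K_j\mapsto\sigma_j\sigma_{j+1}^{-1}\ (j<m),\qquad \mathcal K_m\mapsto\sigma_m\sigma_{m+1}\tau_{m+1},\qquad \mathcal K_j\mapsto\sigma_j^{-1}\sigma_{j+1}\tau_j\tau_{j+1}\ (j>m)$$ (those for the $K_i$ being omitted in the case of $\mathfrak{sl}$). 1. If $q^2\ne1$, they define a unique action of $\mathcal U_q(\mathfrak{gl}(m|n))$ and a unique action of $\mathcal U_q(\mathfrak{sl}(m|n))$ on $\Omega_q(m|n)$, and each makes $\Omega_q(m|n)$ a module algebra: $h.(ab)=\sum(h_{(1)}.a)(h_{(2)}.b)$ and $h.1=\epsilon(h)1$. 2. If $\mathbf{char}(q)=\ell>2$, the same operators preserve $\Omega_q(m|n,\mathbf 1)$, and the formulas define a unique action of $u_q(\mathfrak{gl}(m|n))$ and a unique action of $u_q(\mathfrak{sl}(m|n))$ on $\Omega_q(m|n,\mathbf 1)$, each of which makes it a module algebra. -/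

import Mathlib

open scoped TensorProduct
namespace QGrassmann

section QNumbers
variable {R : Type*} [CommRing R]

/-- The `v`-integer `[n]_v = v^(n-1) + v^(n-3) + ... + v^(1-n)`, for a unit `v`. -/
def qNum (v : Rˣ) (n : ℕ) : R :=
  ∑ i ∈ Finset.range n, ((v ^ ((n : ℤ) - 1 - 2 * (i : ℤ)) : Rˣ) : R)

/-- The `v`-factorial `[n]_v! = [1]_v [2]_v ... [n]_v`. -/
def qFact (v : Rˣ) (n : ℕ) : R := ∏ i ∈ Finset.range n, qNum v (i + 1)

/-- The `v`-binomial coefficient, by the `v`-Pascal rule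
`[n, r] = v^(r-n) [n-1, r-1] + v^r [n-1, r]`. It is defined at every unit `v`, in particular at
roots of unity. -/
def qBinom (v : Rˣ) : ℕ → ℕ → R
  | _, 0 => 1
  | 0, _ + 1 => 0
  | n + 1, r + 1 =>
      ((v ^ ((r : ℤ) - (n : ℤ)) : Rˣ) : R) * qBinom v n r
        + ((v ^ ((r : ℤ) + 1) : Rˣ) : R) * qBinom v n (r + 1)

theorem qNum_mul (v : Rˣ) (n : ℕ) :
    qNum v n * ((v : R) - ((v⁻¹ : Rˣ) : R))
      = ((v ^ (n : ℤ) : Rˣ) : R) - ((v ^ (-(n : ℤ)) : Rˣ) : R) := by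
  have key : ∀ j : ℕ, ∑ i ∈ Finset.range j,
      ((v ^ ((n : ℤ) - 1 - 2 * (i : ℤ)) : Rˣ) : R) * ((v : R) - ((v⁻¹ : Rˣ) : R))
        = ((v ^ (n : ℤ) : Rˣ) : R) - ((v ^ ((n : ℤ) - 2 * j) : Rˣ) : R) := by
    intro j
    induction j with
    | zero => simp
    | succ j ih =>
      rw [Finset.sum_range_succ, ih, mul_sub, ← Units.val_mul, ← Units.val_mul,
        ← zpow_add_one, ← zpow_sub_one]
      push_cast
      rw [show (n : ℤ) - 1 - 2 * j + 1 = n - 2 * j by ring,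
        show (n : ℤ) - 1 - 2 * j - 1 = n - 2 * (j + 1) by ring]
      ring
  rw [qNum, Finset.sum_mul, key, show (n : ℤ) - 2 * n = -n by ring]

theorem qNum_add (v : Rˣ) (a b : ℕ) :
    qNum v (a + b) = ((v ^ (-(b : ℤ)) : Rˣ) : R) * qNum v a
      + ((v ^ (a : ℤ) : Rˣ) : R) * qNum v b := by
  rw [qNum, add_comm a b, Finset.sum_range_add, qNum, qNum, Finset.mul_sum, Finset.mul_sum,
    add_comm]
  congr 1 <;> refine Finset.sum_congr rfl fun i _ => ?_ <;>
    rw [← Units.val_mul, ← zpow_add] <;> congr 2 <;> push_cast <;> ring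

theorem qFact_succ (v : Rˣ) (n : ℕ) : qFact v (n + 1) = qFact v n * qNum v (n + 1) :=
  Finset.prod_range_succ _ _

theorem qBinom_eq_zero (v : Rˣ) : ∀ (n r : ℕ), n < r → qBinom v n r = 0
  | _, 0, h => absurd h (by omega)
  | 0, _ + 1, _ => by simp [qBinom]
  | n + 1, r + 1, h => by
      simp [qBinom, qBinom_eq_zero v n r (by omega), qBinom_eq_zero v n (r + 1) (by omega)]

theorem qBinom_zero_right (v : Rˣ) (n : ℕ) : qBinom v n 0 = 1 := by
  cases n <;> rfl

theorem qBinom_self (v : Rˣ) (n : ℕ) : qBinom v n n = 1 := by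
  induction n with
  | zero => rfl
  | succ n ih => simp [qBinom, ih, qBinom_eq_zero v n (n + 1) (by omega)]

/-- `[a+b, a] [a]! [b]! = [a+b]!`: over `ℤ[v, v⁻¹]` this determines the binomial coefficient. -/
theorem qBinom_mul_qFact (v : Rˣ) (a b : ℕ) :
    qBinom v (a + b) a * (qFact v a * qFact v b) = qFact v (a + b) := by
  suffices h : ∀ N a b : ℕ, a + b = N →
      qBinom v (a + b) a * (qFact v a * qFact v b) = qFact v (a + b) from h _ a b rfl
  intro N
  induction N with
  | zero =>
    intro a b h
    obtain ⟨rfl, rfl⟩ : a = 0 ∧ b = 0 := by omega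
    simp [qBinom, qFact]
  | succ N ih =>
    intro a b h
    rcases a with _ | a
    · simp [qBinom_zero_right, qFact]
    rcases b with _ | b
    · simp [qBinom_self, qFact]
    have h1 := ih a (b + 1) (by omega)
    have h2 := ih (a + 1) b (by omega)
    rw [show a + 1 + (b + 1) = (a + b + 1) + 1 by ring, qFact_succ v (a + b + 1), qBinom]
    rw [show a + (b + 1) = a + b + 1 by ring] at h1
    rw [show a + 1 + b = a + b + 1 by ring] at h2
    rw [show a + b + 1 + 1 = (a + 1) + (b + 1) by ring, qNum_add v (a + 1) (b + 1)]
    rw [qFact_succ v b] at h1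
    rw [qFact_succ v a] at h2
    rw [qFact_succ v a, qFact_succ v b]
    rw [show (a : ℤ) - ((a + b + 1 : ℕ) : ℤ) = -((b + 1 : ℕ) : ℤ) by push_cast; ring,
      show (a : ℤ) + 1 = ((a + 1 : ℕ) : ℤ) by push_cast; ring]
    linear_combination
      ((v ^ (-((b + 1 : ℕ) : ℤ)) : Rˣ) : R) * qNum v (a + 1) * h1
        + ((v ^ ((a + 1 : ℕ) : ℤ) : Rˣ) : R) * qNum v (b + 1) * h2

theorem map_qNum {S : Type*} [CommRing S] (f : R →+* S) (v : Rˣ) (n : ℕ) :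
    f (qNum v n) = qNum (Units.map (f : R →* S) v) n := by
  simp only [qNum, map_sum, ← map_zpow, Units.coe_map]
  rfl

theorem map_qBinom {S : Type*} [CommRing S] (f : R →+* S) (v : Rˣ) (n r : ℕ) :
    f (qBinom v n r) = qBinom (Units.map (f : R →* S) v) n r := by
  induction n generalizing r with
  | zero => cases r <;> simp [qBinom]
  | succ n ih =>
    cases r with
    | zero => simp [qBinom]
    | succ r =>
      simp only [qBinom, map_add, map_mul, ih, ← map_zpow, Units.coe_map]
      rfl

/-- The variable `v` of `ℤ[v, v⁻¹]`, as a unit. -/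
noncomputable def laurentVar : (LaurentPolynomial ℤ)ˣ where
  val := LaurentPolynomial.T 1
  inv := LaurentPolynomial.T (-1)
  val_inv := by rw [← LaurentPolynomial.T_add]; simp
  inv_val := by rw [← LaurentPolynomial.T_add]; simp

/-- Specialisation `v ↦ q`. -/
noncomputable def laurentEval (q : Rˣ) : LaurentPolynomial ℤ →+* R :=
  LaurentPolynomial.eval₂ (Int.castRingHom R) q

theorem laurentEval_var (q : Rˣ) :
    Units.map (laurentEval q : LaurentPolynomial ℤ →* R) laurentVar = q := by
  ext
  simp [laurentVar, laurentEval]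

theorem qNum_laurentVar_ne_zero (n : ℕ) (hn : n ≠ 0) : qNum laurentVar n ≠ 0 := by
  intro h
  have := congrArg (laurentEval (1 : ℤˣ)) h
  rw [map_qNum, laurentEval_var] at this
  simp [qNum] at this
  exact hn this

/-- The `q`-binomial coefficient is the value at `v = q` of the one over `ℤ[v, v⁻¹]`. -/
theorem qBinom_eq_laurentEval (q : Rˣ) (n r : ℕ) :
    qBinom q n r = laurentEval q (qBinom laurentVar n r) := by
  rw [map_qBinom, laurentEval_var]

theorem qBinom_assoc (q : Rˣ) (a b c : ℕ) :
    qBinom q (a + b) a * qBinom q (a + b + c) (a + b)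
      = qBinom q (b + c) b * qBinom q (a + (b + c)) a := by
  simp only [qBinom_eq_laurentEval q, ← map_mul]
  congr 1
  have hne : ∀ j, qFact laurentVar j ≠ 0 := fun j =>
    Finset.prod_ne_zero_iff.2 fun i _ => qNum_laurentVar_ne_zero _ (by omega)
  refine mul_right_cancel₀ (mul_ne_zero (mul_ne_zero (hne a) (hne b)) (hne c)) ?_
  have h1 := qBinom_mul_qFact laurentVar a b
  have h2 := qBinom_mul_qFact laurentVar (a + b) c
  have h3 := qBinom_mul_qFact laurentVar b c
  have h4 := qBinom_mul_qFact laurentVar a (b + c)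
  rw [← add_assoc] at h4 ⊢
  linear_combination qBinom laurentVar (a + b + c) (a + b) * qFact laurentVar c * h1 + h2
    - qBinom laurentVar (a + b + c) a * qFact laurentVar a * h3 - h4

/-- The characteristic of `q`: the least `ℓ > 0` with `[ℓ]_q = 0`, and `0` if there is none. -/
noncomputable def qChar (q : Rˣ) : ℕ := sInf {l : ℕ | 0 < l ∧ qNum q l = 0}

end QNumbers

theorem qNum_qChar {k : Type*} [Field k] (q : kˣ) (h : 0 < qChar q) : qNum q (qChar q) = 0 :=
  (Nat.sInf_mem (Nat.nonempty_of_pos_sInf h)).2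

theorem qNum_ne_zero {k : Type*} [Field k] (q : kˣ) {j : ℕ} (h0 : 0 < j) (h : j < qChar q) :
    qNum q j ≠ 0 := fun hj => Nat.notMem_of_lt_sInf h ⟨h0, hj⟩

/-- `[a+b, a]` vanishes at `q` if `a, b < ℓ ≤ a + b`, where `ℓ` is the characteristic of `q`. -/
theorem qBinom_restricted {k : Type*} [Field k] (q : kˣ) (a b : ℕ) (ha : a < qChar q)
    (hb : b < qChar q) (hab : qChar q ≤ a + b) : qBinom q (a + b) a = 0 := by
  have hne : ∀ j, j < qChar q → qFact q j ≠ 0 := fun j hj =>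
    Finset.prod_ne_zero_iff.2 fun i hi =>
      qNum_ne_zero q (by omega) (by have := Finset.mem_range.1 hi; omega)
  have h0 : qFact q (a + b) = 0 := by
    refine Finset.prod_eq_zero (i := qChar q - 1) (Finset.mem_range.2 (by omega)) ?_
    rw [Nat.sub_add_cancel (by omega)]
    exact qNum_qChar q (by omega)
  have := qBinom_mul_qFact q a b
  rw [h0] at this
  exact (mul_eq_zero.1 this).resolve_right (mul_ne_zero (hne a ha) (hne b hb))


section MonomialAlgebras
variable {k : Type*} [CommRing k] {G : Type*}

/-- Multiplication table `x^g x^h = c(g,h) x^(g·h)` on basis elements `x^g`, `g ∈ G`, of a unital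
associative algebra. The scalars `c(g,h)` may vanish. -/
structure MonomialTable (k : Type*) [CommRing k] (G : Type*) where
  op : G → G → G
  e : G
  c : G → G → k
  op_e : ∀ g, op g e = g
  e_op : ∀ g, op e g = g
  op_assoc : ∀ g h l, op (op g h) l = op g (op h l)
  c_e : ∀ g, c g e = 1
  e_c : ∀ g, c e g = 1
  c_assoc : ∀ g h l, c g h * c (op g h) l = c h l * c g (op h l)

/-- The free `k`-module with basis `x^g`, `g ∈ G`, with the multiplication given by `t`. -/
def MonomialAlgebra (_t : MonomialTable k G) : Type _ := G →₀ k

namespace MonomialAlgebra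
variable (t : MonomialTable k G)

noncomputable instance : AddCommGroup (MonomialAlgebra t) := inferInstanceAs (AddCommGroup (G →₀ k))
noncomputable instance : Module k (MonomialAlgebra t) := inferInstanceAs (Module k (G →₀ k))

/-- The monomial basis. -/
noncomputable def basis : Module.Basis G k (MonomialAlgebra t) := Finsupp.basisSingleOne

/-- The basis element `x^g`. -/
noncomputable def mon (g : G) : MonomialAlgebra t := basis t g

/-- Multiplication as a bilinear map. -/
noncomputable def mulMap :
    MonomialAlgebra t →ₗ[k] MonomialAlgebra t →ₗ[k] MonomialAlgebra t :=
  (basis t).constr k fun g => (basis t).constr k fun h => t.c g h • mon t (t.op g h)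

theorem mulMap_mon (g h : G) : mulMap t (mon t g) (mon t h) = t.c g h • mon t (t.op g h) := by
  simp [mulMap, mon]

theorem mulMap_assoc (x y z : MonomialAlgebra t) :
    mulMap t (mulMap t x y) z = mulMap t x (mulMap t y z) := by
  have h3 : ∀ g h, mulMap t (mulMap t (mon t g) (mon t h))
      = (mulMap t (mon t g)).comp (mulMap t (mon t h)) := fun g h => (basis t).ext fun l => by
    change mulMap t (mulMap t (mon t g) (mon t h)) (mon t l)
      = mulMap t (mon t g) (mulMap t (mon t h) (mon t l))
    simp only [mulMap_mon, map_smul, LinearMap.smul_apply, smul_smul, t.op_assoc, t.c_assoc]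
  have h2 : ∀ g, ((mulMap t).flip z).comp (mulMap t (mon t g))
      = (mulMap t (mon t g)).comp ((mulMap t).flip z) := fun g => (basis t).ext fun h =>
    congrArg (fun f => f z) (h3 g h)
  have h1 : ((mulMap t).flip z).comp ((mulMap t).flip y) = (mulMap t).flip (mulMap t y z) :=
    (basis t).ext fun g => congrArg (fun f => f y) (h2 g)
  exact congrArg (fun f => f x) h1

theorem mulMap_e (x : MonomialAlgebra t) : mulMap t x (mon t t.e) = x := by
  have h : (mulMap t).flip (mon t t.e) = LinearMap.id :=
    (basis t).ext fun g => by
      change mulMap t (mon t g) (mon t t.e) = mon t g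
      simp [mulMap_mon, t.c_e, t.op_e]
  exact congrArg (fun f => f x) h

theorem e_mulMap (x : MonomialAlgebra t) : mulMap t (mon t t.e) x = x := by
  have h : mulMap t (mon t t.e) = LinearMap.id :=
    (basis t).ext fun g => by
      change mulMap t (mon t t.e) (mon t g) = mon t g
      simp [mulMap_mon, t.e_c, t.e_op]
  exact congrArg (fun f => f x) h

noncomputable instance : Ring (MonomialAlgebra t) :=
  { (inferInstance : AddCommGroup (MonomialAlgebra t)) with
    mul := fun x y => mulMap t x y
    one := mon t t.e
    left_distrib := fun x y z => map_add (mulMap t x) y z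
    right_distrib := fun x y z => by
      change mulMap t (x + y) z = _
      rw [map_add]; rfl
    zero_mul := fun x => by change mulMap t 0 x = 0; rw [map_zero]; rfl
    mul_zero := fun x => map_zero (mulMap t x)
    mul_assoc := mulMap_assoc t
    one_mul := e_mulMap t
    mul_one := mulMap_e t }

noncomputable instance : Algebra k (MonomialAlgebra t) :=
  Algebra.ofModule
    (fun r x y => by change mulMap t (r • x) y = r • mulMap t x y; simp)
    (fun r x y => by change mulMap t x (r • y) = r • mulMap t x y; simp)

theorem mon_mul_mon (g h : G) : mon t g * mon t h = t.c g h • mon t (t.op g h) := mulMap_mon t g h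

theorem one_eq_mon : (1 : MonomialAlgebra t) = mon t t.e := rfl

/-- The invertible diagonal operator `x^g ↦ f(g) x^g`. -/
noncomputable def diag (f : G → kˣ) : (Module.End k (MonomialAlgebra t))ˣ where
  val := (basis t).constr k fun g => (f g : k) • mon t g
  inv := (basis t).constr k fun g => (((f g)⁻¹ : kˣ) : k) • mon t g
  val_inv := (basis t).ext fun g => by simp [mon, smul_smul]
  inv_val := (basis t).ext fun g => by simp [mon, smul_smul]

theorem diag_mon (f : G → kˣ) (g : G) :
    (diag t f : Module.End k (MonomialAlgebra t)) (mon t g) = (f g : k) • mon t g := by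
  simp [diag, mon]

end MonomialAlgebra
end MonomialAlgebras

section Grassmann

/-- `β * γ = ∑_{j < i} β_i γ_j`. -/
def starProd {n : ℕ} (β γ : Fin n → ℕ) : ℕ := ∑ j, ∑ i ∈ Finset.Ioi j, β i * γ j

theorem starProd_add_left {n : ℕ} (β γ ζ : Fin n → ℕ) :
    starProd (β + γ) ζ = starProd β ζ + starProd γ ζ := by
  simp [starProd, add_mul, Finset.sum_add_distrib]

theorem starProd_add_right {n : ℕ} (β γ ζ : Fin n → ℕ) :
    starProd β (γ + ζ) = starProd β γ + starProd β ζ := by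
  simp [starProd, mul_add, Finset.sum_add_distrib]

/-- The `0/1`-vector of a set `μ = {i_1 < ... < i_s}`, i.e. `ε_{i_1} + ... + ε_{i_s}`. -/
def ind {n : ℕ} (μ : Finset (Fin n)) : Fin n → ℕ := fun i => if i ∈ μ then 1 else 0

theorem ind_union {n : ℕ} {μ ν : Finset (Fin n)} (h : Disjoint μ ν) :
    ind (μ ∪ ν) = ind μ + ind ν := by
  funext i
  have : i ∈ μ → i ∉ ν := fun hi => Finset.disjoint_left.1 h hi
  by_cases h1 : i ∈ μ <;> by_cases h2 : i ∈ ν <;> simp_all [ind]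

theorem ind_empty {n : ℕ} : ind (∅ : Finset (Fin n)) = 0 := by funext i; simp [ind]

variable {k : Type*} [Field k] (q : kˣ) (m n : ℕ)

/-- `x^(β) x^(γ) = q^(β*γ) [β+γ, β] x^(β+γ)`. -/
noncomputable def divPowTable : MonomialTable k (Fin m → ℕ) where
  op := fun β γ => β + γ
  e := 0
  c := fun β γ => (q : k) ^ starProd β γ * ∏ i, qBinom q (β i + γ i) (β i)
  op_e := add_zero
  e_op := zero_add
  op_assoc := add_assoc
  c_e := fun β => by simp [starProd, qBinom_self]
  e_c := fun β => by simp [starProd, qBinom_zero_right]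
  c_assoc := fun α β γ => by
    have h : (∏ i, qBinom q (α i + β i) (α i)) * ∏ i, qBinom q (α i + β i + γ i) (α i + β i)
        = (∏ i, qBinom q (β i + γ i) (β i)) * ∏ i, qBinom q (α i + (β i + γ i)) (α i) := by
      rw [← Finset.prod_mul_distrib, ← Finset.prod_mul_distrib]
      exact Finset.prod_congr rfl fun i _ => qBinom_assoc q _ _ _
    simp only [Pi.add_apply, starProd_add_left, starProd_add_right, pow_add]
    linear_combination (q : k) ^ starProd α β * (q : k) ^ starProd α γ
      * (q : k) ^ starProd β γ * h

/-- The quantum divided power algebra `A_q(m)`, with basis `x^(β)`, `β ∈ ℕ^m`. -/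
abbrev DivPow := MonomialAlgebra (divPowTable q m)

/-- `x^μ x^ν = (-q)^(μ*ν) x^(μ+ν)`, which is `0` if `μ` and `ν` are not disjoint. -/
noncomputable def extTable : MonomialTable k (Finset (Fin n)) where
  op := fun μ ν => μ ∪ ν
  e := ∅
  c := fun μ ν => if Disjoint μ ν then (-(q : k)) ^ starProd (ind μ) (ind ν) else 0
  op_e := Finset.union_empty
  e_op := Finset.empty_union
  op_assoc := Finset.union_assoc
  c_e := fun μ => by simp [ind_empty, starProd]
  e_c := fun μ => by simp [ind_empty, starProd]
  c_assoc := fun μ ν η => by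
    by_cases h1 : Disjoint μ ν <;> by_cases h2 : Disjoint μ η <;> by_cases h3 : Disjoint ν η <;>
      simp [h1, h2, h3, ind_union, starProd_add_left, starProd_add_right, pow_add]
    ring

/-- The quantum exterior algebra `Λ_{q⁻¹}(n)`, with basis `x^μ = x_{i_1} ⋯ x_{i_s}` for
`μ = {i_1 < ... < i_s}`. See `extPresentation` for generators and relations. -/
abbrev QExt := MonomialAlgebra (extTable q n)

/-- `(x^(α) ⊗ x^μ)(x^(β) ⊗ x^ν) = q^(μ*β) x^(α) x^(β) ⊗ x^μ x^ν`, where `μ * β = |μ||β|`. -/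
noncomputable def grassmannTable : MonomialTable k ((Fin m → ℕ) × Finset (Fin n)) where
  op := fun x y => ((divPowTable q m).op x.1 y.1, (extTable q n).op x.2 y.2)
  e := ((divPowTable q m).e, (extTable q n).e)
  c := fun x y => (q : k) ^ (x.2.card * ∑ i, y.1 i)
    * ((divPowTable q m).c x.1 y.1 * (extTable q n).c x.2 y.2)
  op_e := fun x => by rw [(divPowTable q m).op_e, (extTable q n).op_e]
  e_op := fun x => by rw [(divPowTable q m).e_op, (extTable q n).e_op]
  op_assoc := fun x y z => by rw [(divPowTable q m).op_assoc, (extTable q n).op_assoc]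
  c_e := fun x => by
    rw [(divPowTable q m).c_e, (extTable q n).c_e]; simp [divPowTable]
  e_c := fun x => by
    rw [(divPowTable q m).e_c, (extTable q n).e_c]; simp [extTable]
  c_assoc := fun x y z => by
    have h1 := (divPowTable q m).c_assoc x.1 y.1 z.1
    have h2 := (extTable q n).c_assoc x.2 y.2 z.2
    by_cases h : Disjoint x.2 y.2 ∧ Disjoint y.2 z.2
    · have e1 : ((extTable q n).op x.2 y.2).card = x.2.card + y.2.card :=
        Finset.card_union_of_disjoint h.1
      have e2 : ∑ i, ((divPowTable q m).op y.1 z.1) i = ∑ i, y.1 i + ∑ i, z.1 i :=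
        Finset.sum_add_distrib
      rw [e1, e2, add_mul, mul_add, pow_add, pow_add]
      linear_combination (q : k) ^ (x.2.card * ∑ i, y.1 i) * (q : k) ^ (x.2.card * ∑ i, z.1 i)
        * (q : k) ^ (y.2.card * ∑ i, z.1 i)
        * ((extTable q n).c x.2 y.2 * (extTable q n).c ((extTable q n).op x.2 y.2) z.2 * h1
          + (divPowTable q m).c y.1 z.1 * (divPowTable q m).c x.1 ((divPowTable q m).op y.1 z.1)
            * h2)
    · have z1 : (extTable q n).c x.2 y.2 * (extTable q n).c ((extTable q n).op x.2 y.2) z.2 = 0 := by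
        by_cases h1 : Disjoint x.2 y.2 <;> by_cases h2 : Disjoint y.2 z.2 <;>
          simp_all [extTable]
      have z2 := h2.symm.trans z1
      linear_combination (q : k) ^ (x.2.card * ∑ i, y.1 i)
          * (q : k) ^ (((extTable q n).op x.2 y.2).card * ∑ i, z.1 i)
          * ((divPowTable q m).c x.1 y.1
            * (divPowTable q m).c ((divPowTable q m).op x.1 y.1) z.1) * z1
        - (q : k) ^ (y.2.card * ∑ i, z.1 i)
          * (q : k) ^ (x.2.card * ∑ i, ((divPowTable q m).op y.1 z.1) i)
          * ((divPowTable q m).c y.1 z.1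
            * (divPowTable q m).c x.1 ((divPowTable q m).op y.1 z.1)) * z2

/-- The quantum Grassmann superalgebra `Ω_q(m|n) = A_q(m) ⊗ Λ_{q⁻¹}(n)`; the basis element indexed
by `(α, μ)` is `x^(α) ⊗ x^μ`. -/
abbrev Grassmann := MonomialAlgebra (grassmannTable q m n)

/-- The identification of vector spaces `A_q(m) ⊗ Λ_{q⁻¹}(n) = Ω_q(m|n)`. -/
noncomputable def tensorEquiv : DivPow q m ⊗[k] QExt q n ≃ₗ[k] Grassmann q m n :=
  ((MonomialAlgebra.basis (divPowTable q m)).tensorProduct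
    (MonomialAlgebra.basis (extTable q n))).equiv
    (MonomialAlgebra.basis (grassmannTable q m n)) (Equiv.refl _)

/-- The multiplication of `Ω_q(m|n)` in terms of those of the two tensor factors. -/
theorem tensorEquiv_mul (α β : Fin m → ℕ) (μ ν : Finset (Fin n)) :
    tensorEquiv q m n (MonomialAlgebra.mon _ α ⊗ₜ MonomialAlgebra.mon _ μ)
        * tensorEquiv q m n (MonomialAlgebra.mon _ β ⊗ₜ MonomialAlgebra.mon _ ν)
      = (q : k) ^ (μ.card * ∑ i, β i) • tensorEquiv q m n
        ((MonomialAlgebra.mon _ α * MonomialAlgebra.mon _ β)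
          ⊗ₜ (MonomialAlgebra.mon _ μ * MonomialAlgebra.mon _ ν)) := by
  have h : ∀ (α : Fin m → ℕ) (μ : Finset (Fin n)),
      tensorEquiv q m n (MonomialAlgebra.mon _ α ⊗ₜ MonomialAlgebra.mon _ μ)
        = MonomialAlgebra.mon _ (α, μ) := fun α μ => by
    rw [MonomialAlgebra.mon, MonomialAlgebra.mon, ← Module.Basis.tensorProduct_apply,
      tensorEquiv, Module.Basis.equiv_apply]
    rfl
  simp only [MonomialAlgebra.mon_mul_mon, TensorProduct.smul_tmul_smul, map_smul, h, smul_smul]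
  rfl

end Grassmann

section ExteriorPresentation
variable {k : Type*} [Field k] (q : kˣ) (n : ℕ)

/-- Defining relations of `Λ_{q⁻¹}(n)`: `x_i² = 0`, and `x_j x_i + q x_i x_j = 0` for `i < j`. -/
inductive ExtRel : FreeAlgebra k (Fin n) → FreeAlgebra k (Fin n) → Prop
  | sq (i : Fin n) : ExtRel (FreeAlgebra.ι k i * FreeAlgebra.ι k i) 0
  | anti (i j : Fin n) (h : i < j) :
      ExtRel (FreeAlgebra.ι k j * FreeAlgebra.ι k i
        + (q : k) • (FreeAlgebra.ι k i * FreeAlgebra.ι k j)) 0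

theorem starProd_ind_singleton (i : Fin n) (β : Fin n → ℕ) :
    starProd (ind {i}) β = ∑ j ∈ Finset.Iio i, β j := by
  have : ∀ j, ∑ l ∈ Finset.Ioi j, ind {i} l * β j = if j < i then β j else 0 := fun j => by
    simp [ind, Finset.sum_ite_eq']
  simp only [starProd, this, ← Finset.sum_filter]
  congr 1
  ext j
  simp

theorem starProd_ind_singletons (i a : Fin n) :
    starProd (ind {i}) (ind {a}) = if a < i then 1 else 0 := by
  rw [starProd_ind_singleton]
  simp [ind, Finset.sum_ite_eq']

theorem starProd_ind_of_lt (i : Fin n) (s : Finset (Fin n)) (h : ∀ b ∈ s, i ≤ b) :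
    starProd (ind {i}) (ind s) = 0 := by
  rw [starProd_ind_singleton]
  refine Finset.sum_eq_zero fun j hj => ?_
  have : j ∉ s := fun hs => absurd (h j hs) (not_le.2 (Finset.mem_Iio.1 hj))
  simp [ind, this]

theorem extTable_op (μ ν : Finset (Fin n)) : (extTable q n).op μ ν = μ ∪ ν := rfl

theorem extTable_e : (extTable q n).e = ∅ := rfl

theorem extTable_c (μ ν : Finset (Fin n)) : (extTable q n).c μ ν
    = if Disjoint μ ν then (-(q : k)) ^ starProd (ind μ) (ind ν) else 0 := rfl

/-- The algebra with generators `x_i` and relations `ExtRel`. -/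
def ExtPresented : Type _ := RingQuot (ExtRel q n)

noncomputable instance : Ring (ExtPresented q n) := inferInstanceAs (Ring (RingQuot (ExtRel q n)))
noncomputable instance : Algebra k (ExtPresented q n) :=
  inferInstanceAs (Algebra k (RingQuot (ExtRel q n)))

/-- The quotient map from the free algebra. -/
noncomputable def ExtPresented.mk : FreeAlgebra k (Fin n) →ₐ[k] ExtPresented q n :=
  RingQuot.mkAlgHom k (ExtRel q n)

/-- The algebra with the presentation of `Λ_{q⁻¹}(n)` maps to the algebra with its monomial
multiplication table, `x_i ↦ x_i`. -/
noncomputable def extHom : ExtPresented q n →ₐ[k] QExt q n :=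
  RingQuot.liftAlgHom k ⟨FreeAlgebra.lift k fun i => MonomialAlgebra.mon (extTable q n) {i}, by
    intro x y h
    cases h with
    | sq i =>
      rw [map_mul, FreeAlgebra.lift_ι_apply, MonomialAlgebra.mon_mul_mon, map_zero, extTable_c,
        if_neg (by simp), zero_smul]
    | anti i j h =>
      have e1 : starProd (ind {j}) (ind {i}) = 1 := by rw [starProd_ind_singletons, if_pos h]
      have e2 : starProd (ind {i}) (ind {j}) = 0 := by
        rw [starProd_ind_singletons, if_neg (not_lt.2 h.le)]
      simp only [map_add, map_mul, map_smul, FreeAlgebra.lift_ι_apply,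
        MonomialAlgebra.mon_mul_mon, map_zero]
      rw [extTable_c, extTable_c, if_pos (by simpa using h.ne'), if_pos (by simpa using h.ne),
        e1, e2, extTable_op, extTable_op, Finset.union_comm {j} {i}]
      module⟩

theorem bijective_of_ext_generators {B : Type*} [Ring B] [Algebra k B] (φ : B →ₐ[k] QExt q n)
    (X : Fin n → B) (hsq : ∀ i, X i * X i = 0)
    (hanti : ∀ i j, i < j → X j * X i = (-(q : k)) • (X i * X j))
    (hφ : ∀ i, φ (X i) = MonomialAlgebra.mon (extTable q n) {i})
    (hgen : ∀ b, b ∈ Algebra.adjoin k (Set.range X)) : Function.Bijective φ := by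
  let P : Finset (Fin n) → B := fun μ => ((μ.sort (· ≤ ·)).map X).prod
  have hP0 : P ∅ = 1 := by simp [P]
  have hPi : ∀ a s, (∀ b ∈ s, a < b) → P (insert a s) = X a * P s := fun a s h => by
    simp only [P]
    rw [Finset.sort_insert (· ≤ ·) (fun b hb => (h b hb).le) (fun ha => lt_irrefl _ (h a ha))]
    simp
  have key : ∀ i μ, X i * P μ = (extTable q n).c {i} μ • P ({i} ∪ μ) := by
    intro i μ
    induction μ using Finset.induction_on_min with
    | empty =>
      rw [extTable_c, if_pos (by simp), hP0, ind_empty, Finset.union_empty,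
        ← insert_empty_eq i, hPi i ∅ (by simp), hP0]
      simp [starProd]
    | insert a s ha ih =>
      rw [hPi a s ha]
      have has : a ∉ s := fun h => lt_irrefl _ (ha a h)
      rcases lt_trichotomy i a with h | h | h
      · have hi : ∀ b ∈ insert a s, i < b := by
          intro b hb
          rcases Finset.mem_insert.1 hb with rfl | hb
          · exact h
          · exact h.trans (ha b hb)
        have hd : i ∉ insert a s := fun hh => lt_irrefl _ (hi i hh)
        rw [← hPi a s ha, ← hPi i _ hi]
        rw [extTable_c, if_pos (by simpa using hd),
          starProd_ind_of_lt n i _ fun b hb => (hi b hb).le, pow_zero, one_smul]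
        rfl
      · subst h
        rw [← mul_assoc, hsq, zero_mul]
        simp [extTable]
      · rw [← mul_assoc, hanti a i h, smul_mul_assoc, mul_assoc, ih]
        by_cases his : i ∈ s
        · simp [extTable, his]
        · have h1 : i ∉ insert a s := by simp [his, h.ne']
          have h2 : P ({i} ∪ insert a s) = X a * P ({i} ∪ s) := by
            rw [← hPi a]
            · congr 1; ext; simp only [Finset.mem_union, Finset.mem_insert,
                Finset.mem_singleton]; tauto
            · intro b hb
              rcases Finset.mem_union.1 hb with hb | hb
              · rw [Finset.mem_singleton.1 hb]; exact h
              · exact ha b hb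
          have h3 : starProd (ind {i}) (ind (insert a s)) = 1 + starProd (ind {i}) (ind s) := by
            rw [Finset.insert_eq, ind_union (by simpa using has), starProd_add_right,
              starProd_ind_singletons, if_pos h]
          rw [h2]
          simp only [extTable, Finset.disjoint_singleton_left, his, h1, not_false_eq_true, if_true,
            h3, mul_smul_comm, smul_smul, pow_add, pow_one]
  have hφP : ∀ μ, φ (P μ) = MonomialAlgebra.mon (extTable q n) μ := by
    intro μ
    induction μ using Finset.induction_on_min with
    | empty => rw [hP0, map_one]; rfl
    | insert a s ha ih =>
      have has : a ∉ s := fun h => lt_irrefl _ (ha a h)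
      rw [hPi a s ha, map_mul, hφ, ih, MonomialAlgebra.mon_mul_mon]
      rw [extTable_c, if_pos (by simpa using has),
        starProd_ind_of_lt n a _ fun b hb => (ha b hb).le, pow_zero, one_smul]
      rfl
  let ψ : QExt q n →ₗ[k] B := (MonomialAlgebra.basis (extTable q n)).constr k P
  have hψ : ∀ μ, ψ (MonomialAlgebra.mon (extTable q n) μ) = P μ := fun μ =>
    (MonomialAlgebra.basis (extTable q n)).constr_basis k P μ
  have hψX : ∀ i a, ψ (MonomialAlgebra.mon (extTable q n) {i} * a) = X i * ψ a := by
    intro i a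
    have hb : ∀ μ, ψ (MonomialAlgebra.mon (extTable q n) {i} * MonomialAlgebra.mon (extTable q n) μ)
        = X i * ψ (MonomialAlgebra.mon (extTable q n) μ) := fun μ => by
      rw [MonomialAlgebra.mon_mul_mon, map_smul, hψ, hψ, key]
      rfl
    have : ψ.comp (LinearMap.mulLeft k (MonomialAlgebra.mon (extTable q n) {i}))
        = (LinearMap.mulLeft k (X i)).comp ψ :=
      (MonomialAlgebra.basis (extTable q n)).ext hb
    exact congrArg (fun f => f a) this
  have hψmul : ∀ y a, ψ (φ y * a) = y * ψ a := by
    intro y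
    induction hgen y using Algebra.adjoin_induction with
    | mem x hx => obtain ⟨i, rfl⟩ := hx; intro a; rw [hφ]; exact hψX i a
    | algebraMap r => intro a; rw [AlgHom.commutes, ← Algebra.smul_def, map_smul, Algebra.smul_def]
    | add x y _ _ hx hy => intro a; rw [map_add, add_mul, map_add, hx, hy, add_mul]
    | mul x y _ _ hx hy => intro a; rw [map_mul φ, mul_assoc, hx, hy, mul_assoc]
  constructor
  · refine Function.LeftInverse.injective (g := ψ) fun y => ?_
    have := hψmul y 1
    rwa [mul_one, MonomialAlgebra.one_eq_mon, hψ, show (extTable q n).e = ∅ from rfl, hP0,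
      mul_one] at this
  · have h : φ.toLinearMap.comp ψ = LinearMap.id :=
      (MonomialAlgebra.basis (extTable q n)).ext fun μ =>
        (congrArg φ (hψ μ)).trans (hφP μ)
    exact fun a => ⟨ψ a, congrArg (fun f => f a) h⟩

/-- `Λ_{q⁻¹}(n)` is presented by the generators `x_i` and the relations `ExtRel`. -/
theorem extPresentation : Function.Bijective (extHom q n) := by
  have hrel : ∀ {x y}, ExtRel q n x y → ExtPresented.mk q n x = ExtPresented.mk q n y :=
    fun h => RingQuot.mkAlgHom_rel k h
  refine bijective_of_ext_generators q n (extHom q n)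
    (fun i => ExtPresented.mk q n (FreeAlgebra.ι k i)) (fun i => ?_) (fun i j h => ?_)
    (fun i => ?_) (fun b => ?_)
  · rw [← map_mul, hrel (ExtRel.sq i), map_zero]
  · have := hrel (ExtRel.anti (q := q) i j h)
    simp only [map_add, map_mul, map_smul, map_zero] at this
    rw [neg_smul]
    exact eq_neg_of_add_eq_zero_left this
  · exact (RingQuot.liftAlgHom_mkAlgHom_apply _ _ _ _).trans (FreeAlgebra.lift_ι_apply _ _)
  · obtain ⟨y, rfl⟩ : ∃ y, ExtPresented.mk q n y = b := RingQuot.mkAlgHom_surjective k _ b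
    have hy : y ∈ Algebra.adjoin k (Set.range (FreeAlgebra.ι k : Fin n → _)) := by
      rw [FreeAlgebra.adjoin_range_ι]; trivial
    have := (Subalgebra.mem_map (f := ExtPresented.mk q n)).2 ⟨y, hy, rfl⟩
    rwa [AlgHom.map_adjoin, ← Set.range_comp] at this

end ExteriorPresentation

section Operators
variable {k : Type*} [Field k] (q : kˣ) (m n : ℕ)
open MonomialAlgebra

/-- The restricted quantum Grassmann superalgebra `Ω_q(m|n, 1)`: the subalgebra spanned by the
`x^(α) ⊗ x^μ` with `α_i ≤ ℓ - 1` for all `i`, where `ℓ` is the characteristic of `q`. -/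
noncomputable def ResGrassmann [hl : Fact (2 < qChar q)] : Subalgebra k (Grassmann q m n) :=
  Submodule.toSubalgebra
    (Submodule.span k {f | ∃ x : (Fin m → ℕ) × Finset (Fin n),
      (∀ i, x.1 i < qChar q) ∧ f = mon (grassmannTable q m n) x})
    (Submodule.subset_span ⟨(0, ∅), fun _ => by have := hl.out; simp; omega, rfl⟩)
    (by
      intro f g hf hg
      refine Submodule.span_induction₂ (p := fun a b _ _ => a * b ∈ Submodule.span k
          {f | ∃ x : (Fin m → ℕ) × Finset (Fin n),
            (∀ i, x.1 i < qChar q) ∧ f = mon (grassmannTable q m n) x})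
        ?_ ?_ ?_ ?_ ?_ ?_ ?_ hf hg
      · rintro _ _ ⟨x, hx, rfl⟩ ⟨y, hy, rfl⟩
        rw [mon_mul_mon]
        by_cases h : ∀ i, x.1 i + y.1 i < qChar q
        · exact Submodule.smul_mem _ _ (Submodule.subset_span ⟨_, h, rfl⟩)
        · obtain ⟨i, hi⟩ := not_forall.1 h
          have h0 : (grassmannTable q m n).c x y = 0 := by
            have : ∏ i, qBinom q (x.1 i + y.1 i) (x.1 i) = 0 :=
              Finset.prod_eq_zero (Finset.mem_univ i)
                (qBinom_restricted q _ _ (hx i) (hy i) (not_lt.1 hi))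
            simp [grassmannTable, divPowTable, this]
          rw [h0, zero_smul]
          exact Submodule.zero_mem _
      · intro b _; rw [zero_mul]; exact Submodule.zero_mem _
      · intro a _; rw [mul_zero]; exact Submodule.zero_mem _
      · intro a b c _ _ _ h1 h2; rw [add_mul]; exact Submodule.add_mem _ h1 h2
      · intro a b c _ _ _ h1 h2; rw [mul_add]; exact Submodule.add_mem _ h1 h2
      · intro r a b _ _ h; rw [smul_mul_assoc]; exact Submodule.smul_mem _ _ h
      · intro r a b _ _ h; rw [mul_smul_comm]; exact Submodule.smul_mem _ _ h)

/-- The elements `x_i`, `i ∈ I`. The index set `I = {1, …, m+n}` is `Fin (m + n)`, numbered from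
`0`: `I_0` is its first `m` elements and `I_1` its last `n` elements. -/
noncomputable def genX : Fin (m + n) → Grassmann q m n :=
  Fin.append (fun a => mon _ (Pi.single a 1, ∅)) (fun b => mon _ (0, {b}))

/-- Left multiplication by `x_i`. -/
noncomputable def mulX (i : Fin (m + n)) : Module.End k (Grassmann q m n) :=
  LinearMap.mulLeft k (genX q m n i)

/-- `σ_i`: it scales `x^(α) ⊗ x^μ` by `q^(α_i)` if `i ∈ I_0` and by `(-q)^(μ_i)` if `i ∈ I_1`. -/
noncomputable def sigmaOp (i : Fin (m + n)) : (Module.End k (Grassmann q m n))ˣ :=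
  diag _ fun x => Fin.append (fun a => q ^ x.1 a) (fun b => (-q) ^ ind x.2 b) i

/-- `τ_i`: it scales `x^(α) ⊗ x^μ` by `(-1)^(μ_i)` if `i ∈ I_1`; it is used only for `i ∈ I_1`. -/
noncomputable def tauOp (i : Fin (m + n)) : (Module.End k (Grassmann q m n))ˣ :=
  diag _ fun x => Fin.append (fun _ => 1) (fun b => (-1) ^ ind x.2 b) i

/-- The parity automorphism `τ`: it scales `x^(α) ⊗ x^μ` by `(-1)^|μ|`. -/
noncomputable def parityOp : (Module.End k (Grassmann q m n))ˣ :=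
  diag _ fun x => (-1) ^ x.2.card

/-- The `q`-derivatives. For `i ∈ I_0`, `∂_i (x^(α) ⊗ x^μ) = q^(-ε_i*α) x^(α-ε_i) ⊗ x^μ`; for
`i ∈ I_1`, `∂_i (x^(α) ⊗ x^μ) = q^(-|α|) (-q)^(-ε_i*μ) x^(α) ⊗ x^(μ-ε_i)`. Terms with a negative
exponent are `0`. -/
noncomputable def partialOp : Fin (m + n) → Module.End k (Grassmann q m n) :=
  Fin.append
    (fun a => (basis (grassmannTable q m n)).constr k fun x =>
      if x.1 a = 0 then 0
      else ((q ^ (-(starProd (Pi.single a 1) x.1 : ℤ)) : kˣ) : k)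
        • mon (grassmannTable q m n) (x.1 - Pi.single a 1, x.2))
    (fun b => (basis (grassmannTable q m n)).constr k fun x =>
      if b ∈ x.2 then
        ((q ^ (-(∑ i, x.1 i : ℕ) : ℤ) * (-q) ^ (-(starProd (ind {b}) (ind x.2) : ℤ)) : kˣ) : k)
          • mon (grassmannTable q m n) (x.1, x.2.erase b)
      else 0)

end Operators

section Indices
variable {m n : ℕ}

/-- For `j ∈ J = {1, …, m+n-1}` (numbered from `0`), the index `j` as an element of `I`. -/
def lft (j : Fin (m + n - 1)) : Fin (m + n) := ⟨j.1, by omega⟩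

/-- For `j ∈ J`, the index `j + 1 ∈ I`. -/
def rgt (j : Fin (m + n - 1)) : Fin (m + n) := ⟨j.1 + 1, by omega⟩

end Indices

section Operators
variable {k : Type*} [Field k] (q : kˣ) (m n : ℕ)

/-- `x_j ∂_{j+1} σ_j`. -/
noncomputable def opE (j : Fin (m + n - 1)) : Module.End k (Grassmann q m n) :=
  mulX q m n (lft j) * partialOp q m n (rgt j)
    * (sigmaOp q m n (lft j) : Module.End k (Grassmann q m n))

/-- `σ_j⁻¹ x_{j+1} ∂_j`. -/
noncomputable def opF (j : Fin (m + n - 1)) : Module.End k (Grassmann q m n) :=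
  (((sigmaOp q m n (lft j))⁻¹ : (Module.End k (Grassmann q m n))ˣ) : Module.End k (Grassmann q m n))
    * mulX q m n (rgt j) * partialOp q m n (lft j)

end Operators

section QuantumSuperalgebra

/-- The two series of Lie superalgebras, `gl(m|n)` and `sl(m|n)`. -/
inductive Series
  | gl
  | sl

variable (m n : ℕ)

/-- Index set of the Cartan generators: `K_i`, `i ∈ I`, for `gl`, and `𝒦_j`, `j ∈ J`, for `sl`. -/
abbrev CartanIdx : Series → Type
  | .gl => Fin (m + n)
  | .sl => Fin (m + n - 1)

/-- Generators of `𝒰_q(gl(m|n))` and `𝒰_q(sl(m|n))`: `E_j`, `F_j`, the Cartan generators and their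
inverses, and the parity element `σ`. -/
inductive Gen (s : Series) : Type
  | E (j : Fin (m + n - 1))
  | F (j : Fin (m + n - 1))
  | K (t : CartanIdx m n s)
  | Kinv (t : CartanIdx m n s)
  | sig

variable {m n}

/-- `(ε_i, ε_i) = 1` for `i ∈ I_0` and `-1` for `i ∈ I_1`. -/
def sgn (i : Fin (m + n)) : ℤ := if i.1 < m then 1 else -1

/-- `(ε_i, α_j)` with `α_j = ε_j - ε_{j+1}`. -/
def pairEps (i : Fin (m + n)) (j : Fin (m + n - 1)) : ℤ :=
  sgn i * ((if i = lft j then 1 else 0) - (if i = rgt j then 1 else 0))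

/-- `(α_i, α_j)`. -/
def pairRoot (i j : Fin (m + n - 1)) : ℤ := pairEps (lft i) j - pairEps (rgt i) j

/-- The exponent of `q` in the commutation of a Cartan generator with `E_j`. -/
def cartanWeight : (s : Series) → CartanIdx m n s → Fin (m + n - 1) → ℤ
  | .gl, t, j => pairEps t j
  | .sl, t, j => pairRoot t j

/-- `j = m` (in the numbering from `1`): `E_j` and `F_j` are odd. -/
def IsOdd (j : Fin (m + n - 1)) : Prop := j.1 + 1 = m

instance (j : Fin (m + n - 1)) : Decidable (IsOdd j) := inferInstanceAs (Decidable (_ = _))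

/-- `p(E_j) = p(F_j)`. -/
def par (j : Fin (m + n - 1)) : ℕ := if IsOdd j then 1 else 0

/-- `|i - j| = 1`. -/
def Adjacent (i j : Fin (m + n - 1)) : Prop := i.1 + 1 = j.1 ∨ j.1 + 1 = i.1

/-- `|i - j| > 1`. -/
def Distant (i j : Fin (m + n - 1)) : Prop := i.1 + 1 < j.1 ∨ j.1 + 1 < i.1

section Words
variable {A : Type*} [Ring A] {s : Series} (e : Gen m n s → A)

/-- `𝒦_j` as a word in the generators: `K_j K_{j+1}⁻¹` for `gl`. -/
def wordK : (s : Series) → (Gen m n s → A) → Fin (m + n - 1) → A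
  | .gl, e, j => e (.K (lft j)) * e (.Kinv (rgt j))
  | .sl, e, j => e (.K j)

/-- `𝒦_j⁻¹` as a word in the generators: `K_j⁻¹ K_{j+1}` for `gl`. -/
def wordKinv : (s : Series) → (Gen m n s → A) → Fin (m + n - 1) → A
  | .gl, e, j => e (.Kinv (lft j)) * e (.K (rgt j))
  | .sl, e, j => e (.Kinv j)

end Words

variable {k : Type*} [Field k] (q : kˣ)

/-- `a² b - (q + q⁻¹) a b a + b a²`. -/
def serre {A : Type*} [Ring A] [Algebra k A] (a b : A) : A :=
  a * a * b - ((q : k) + ((q⁻¹ : kˣ) : k)) • (a * b * a) + b * a * a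

/-- `a b c b + b a b c + c b a b + b c b a - (q + q⁻¹) b a c b`. -/
def superSerre {A : Type*} [Ring A] [Algebra k A] (a b c : A) : A :=
  a * b * c * b + b * a * b * c + c * b * a * b + b * c * b * a
    - ((q : k) + ((q⁻¹ : kˣ) : k)) • (b * a * c * b)

/-- The defining relations, as a relation on the free algebra. Here `q_j = q ^ sgn j`,
`𝒦_j = K_j K_{j+1}⁻¹` and `σ x σ = (-1)^(p(x)) x`. -/
inductive Rel (s : Series) : FreeAlgebra k (Gen m n s) → FreeAlgebra k (Gen m n s) → Prop
  | K_comm (t u) : Rel s (FreeAlgebra.ι k (.K t) * FreeAlgebra.ι k (.K u))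
      (FreeAlgebra.ι k (.K u) * FreeAlgebra.ι k (.K t))
  | K_Kinv (t) : Rel s (FreeAlgebra.ι k (.K t) * FreeAlgebra.ι k (.Kinv t)) 1
  | Kinv_K (t) : Rel s (FreeAlgebra.ι k (.Kinv t) * FreeAlgebra.ι k (.K t)) 1
  | K_E (t j) : Rel s (FreeAlgebra.ι k (.K t) * FreeAlgebra.ι k (.E j))
      (((q ^ cartanWeight s t j : kˣ) : k) • (FreeAlgebra.ι k (.E j) * FreeAlgebra.ι k (.K t)))
  | K_F (t j) : Rel s (FreeAlgebra.ι k (.K t) * FreeAlgebra.ι k (.F j))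
      (((q ^ (-cartanWeight s t j) : kˣ) : k) • (FreeAlgebra.ι k (.F j) * FreeAlgebra.ι k (.K t)))
  | E_F (i j) : Rel s
      (FreeAlgebra.ι k (.E i) * FreeAlgebra.ι k (.F j)
        - (-1 : k) ^ (par i * par j) • (FreeAlgebra.ι k (.F j) * FreeAlgebra.ι k (.E i)))
      (if i = j then
        (((q ^ sgn (lft i) : kˣ) : k) - ((q ^ (-sgn (lft i)) : kˣ) : k))⁻¹
          • (wordK s (FreeAlgebra.ι k) i - wordKinv s (FreeAlgebra.ι k) i)
      else 0)
  | E_E (i j) (h : Distant i j) : Rel s (FreeAlgebra.ι k (.E i) * FreeAlgebra.ι k (.E j))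
      (FreeAlgebra.ι k (.E j) * FreeAlgebra.ι k (.E i))
  | F_F (i j) (h : Distant i j) : Rel s (FreeAlgebra.ι k (.F i) * FreeAlgebra.ι k (.F j))
      (FreeAlgebra.ι k (.F j) * FreeAlgebra.ι k (.F i))
  | serre_E (i j) (h : Adjacent i j) (hi : ¬ IsOdd i) :
      Rel s (serre q (FreeAlgebra.ι k (.E i)) (FreeAlgebra.ι k (.E j))) 0
  | serre_F (i j) (h : Adjacent i j) (hi : ¬ IsOdd i) :
      Rel s (serre q (FreeAlgebra.ι k (.F i)) (FreeAlgebra.ι k (.F j))) 0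
  | odd_E (i) (h : IsOdd i) : Rel s (FreeAlgebra.ι k (.E i) * FreeAlgebra.ι k (.E i)) 0
  | odd_F (i) (h : IsOdd i) : Rel s (FreeAlgebra.ι k (.F i) * FreeAlgebra.ι k (.F i)) 0
  | super_E (i j l) (hij : i.1 + 1 = j.1) (hjl : j.1 + 1 = l.1) (h : IsOdd j) :
      Rel s (superSerre q (FreeAlgebra.ι k (.E i)) (FreeAlgebra.ι k (.E j))
        (FreeAlgebra.ι k (.E l))) 0
  | super_F (i j l) (hij : i.1 + 1 = j.1) (hjl : j.1 + 1 = l.1) (h : IsOdd j) :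
      Rel s (superSerre q (FreeAlgebra.ι k (.F i)) (FreeAlgebra.ι k (.F j))
        (FreeAlgebra.ι k (.F l))) 0
  | sig_sig : Rel s (FreeAlgebra.ι k .sig * FreeAlgebra.ι k .sig) 1
  | sig_E (j) : Rel s (FreeAlgebra.ι k .sig * FreeAlgebra.ι k (.E j) * FreeAlgebra.ι k .sig)
      ((-1 : k) ^ par j • FreeAlgebra.ι k (.E j))
  | sig_F (j) : Rel s (FreeAlgebra.ι k .sig * FreeAlgebra.ι k (.F j) * FreeAlgebra.ι k .sig)
      ((-1 : k) ^ par j • FreeAlgebra.ι k (.F j))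
  | sig_K (t) : Rel s (FreeAlgebra.ι k .sig * FreeAlgebra.ι k (.K t) * FreeAlgebra.ι k .sig)
      (FreeAlgebra.ι k (.K t))

variable (m n)

/-- The bosonizations `𝒰_q(gl(m|n))` and `𝒰_q(sl(m|n))`. -/
def Uq (s : Series) : Type _ := RingQuot (Rel (m := m) (n := n) q s)

noncomputable instance (s : Series) : Ring (Uq m n q s) :=
  inferInstanceAs (Ring (RingQuot (Rel (m := m) (n := n) q s)))
noncomputable instance (s : Series) : Algebra k (Uq m n q s) :=
  inferInstanceAs (Algebra k (RingQuot (Rel (m := m) (n := n) q s)))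

/-- The quotient map from the free algebra. -/
noncomputable def Uq.mk (s : Series) : FreeAlgebra k (Gen m n s) →ₐ[k] Uq m n q s :=
  RingQuot.mkAlgHom k (Rel (m := m) (n := n) q s)

/-- The generators of `𝒰_q`. -/
noncomputable def Uq.gen (s : Series) (g : Gen m n s) : Uq m n q s :=
  Uq.mk m n q s (FreeAlgebra.ι k g)

/-- The relations imposed, besides those of `𝒰_q`, on the restricted algebra `u_q`, where `ℓ` is the
characteristic of `q`: `E_j^ℓ = F_j^ℓ = 0` for `j ≠ m`, `E_m² = F_m² = 0`, `K^(2ℓ) = 1`. -/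
inductive ResRel (s : Series) : Uq m n q s → Uq m n q s → Prop
  | E (j) (h : ¬ IsOdd j) : ResRel s (Uq.gen m n q s (.E j) ^ qChar q) 0
  | F (j) (h : ¬ IsOdd j) : ResRel s (Uq.gen m n q s (.F j) ^ qChar q) 0
  | odd_E (j) (h : IsOdd j) : ResRel s (Uq.gen m n q s (.E j) ^ 2) 0
  | odd_F (j) (h : IsOdd j) : ResRel s (Uq.gen m n q s (.F j) ^ 2) 0
  | K (t) : ResRel s (Uq.gen m n q s (.K t) ^ (2 * qChar q)) 1

/-- The restricted algebras `u_q(gl(m|n))` and `u_q(sl(m|n))`. -/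
def ResUq (s : Series) : Type _ := RingQuot (ResRel m n q s)

noncomputable instance (s : Series) : Ring (ResUq m n q s) :=
  inferInstanceAs (Ring (RingQuot (ResRel m n q s)))
noncomputable instance (s : Series) : Algebra k (ResUq m n q s) :=
  inferInstanceAs (Algebra k (RingQuot (ResRel m n q s)))

/-- The quotient map `𝒰_q → u_q`. -/
noncomputable def ResUq.mk (s : Series) : Uq m n q s →ₐ[k] ResUq m n q s :=
  RingQuot.mkAlgHom k (ResRel m n q s)

/-- The generators of `u_q`. -/
noncomputable def ResUq.gen (s : Series) (g : Gen m n s) : ResUq m n q s :=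
  ResUq.mk m n q s (Uq.gen m n q s g)

end QuantumSuperalgebra

section Bialgebra
variable {m n : ℕ} {k : Type*} [Field k] (q : kˣ)

/-- The relations among the `E_j` alone, or among the `F_j` alone. -/
structure NilRelations {A : Type*} [Ring A] [Algebra k A] (X : Fin (m + n - 1) → A) : Prop where
  comm : ∀ i j, Distant i j → X i * X j = X j * X i
  ser : ∀ i j, Adjacent i j → ¬ IsOdd i → serre q (X i) (X j) = 0
  odd : ∀ i, IsOdd i → X i * X i = 0
  sup : ∀ i j l, i.1 + 1 = j.1 → j.1 + 1 = l.1 → IsOdd j → superSerre q (X i) (X j) (X l) = 0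

/-- The family `e` of elements of an algebra satisfies the defining relations of `𝒰_q`. -/
structure Relations {A : Type*} [Ring A] [Algebra k A] (s : Series) (e : Gen m n s → A) :
    Prop where
  K_comm : ∀ t u, e (.K t) * e (.K u) = e (.K u) * e (.K t)
  K_Kinv : ∀ t, e (.K t) * e (.Kinv t) = 1
  Kinv_K : ∀ t, e (.Kinv t) * e (.K t) = 1
  K_E : ∀ t j, e (.K t) * e (.E j)
    = ((q ^ cartanWeight s t j : kˣ) : k) • (e (.E j) * e (.K t))
  K_F : ∀ t j, e (.K t) * e (.F j)
    = ((q ^ (-cartanWeight s t j) : kˣ) : k) • (e (.F j) * e (.K t))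
  E_F : ∀ i j, e (.E i) * e (.F j) - (-1 : k) ^ (par i * par j) • (e (.F j) * e (.E i))
    = if i = j then
        (((q ^ sgn (lft i) : kˣ) : k) - ((q ^ (-sgn (lft i)) : kˣ) : k))⁻¹
          • (wordK s e i - wordKinv s e i)
      else 0
  nil_E : NilRelations q fun j => e (.E j)
  nil_F : NilRelations q fun j => e (.F j)
  sig_sig : e .sig * e .sig = 1
  sig_E : ∀ j, e .sig * e (.E j) * e .sig = (-1 : k) ^ par j • e (.E j)
  sig_F : ∀ j, e .sig * e (.F j) * e .sig = (-1 : k) ^ par j • e (.F j)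
  sig_K : ∀ t, e .sig * e (.K t) * e .sig = e (.K t)

theorem map_wordK {A B F : Type*} [Ring A] [Ring B] [FunLike F A B] [RingHomClass F A B]
    (f : F) (s : Series) (e : Gen m n s → A) (j : Fin (m + n - 1)) :
    f (wordK s e j) = wordK s (fun g => f (e g)) j := by
  cases s <;> simp [wordK]

theorem map_wordKinv {A B F : Type*} [Ring A] [Ring B] [FunLike F A B] [RingHomClass F A B]
    (f : F) (s : Series) (e : Gen m n s → A) (j : Fin (m + n - 1)) :
    f (wordKinv s e j) = wordKinv s (fun g => f (e g)) j := by
  cases s <;> simp [wordKinv]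

theorem map_serre {A B : Type*} [Ring A] [Ring B] [Algebra k A] [Algebra k B]
    (f : A →ₐ[k] B) (a b : A) : f (serre q a b) = serre q (f a) (f b) := by
  simp [serre]

theorem map_superSerre {A B : Type*} [Ring A] [Ring B] [Algebra k A] [Algebra k B]
    (f : A →ₐ[k] B) (a b c : A) :
    f (superSerre q a b c) = superSerre q (f a) (f b) (f c) := by
  simp [superSerre]

variable {q}

theorem Relations.lift_rel {A : Type*} [Ring A] [Algebra k A] {s : Series} {e : Gen m n s → A}
    (R : Relations q s e) ⦃x y : FreeAlgebra k (Gen m n s)⦄ (h : Rel q s x y) :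
    FreeAlgebra.lift k e x = FreeAlgebra.lift k e y := by
  have hw : ∀ j, FreeAlgebra.lift k e (wordK s (FreeAlgebra.ι k) j) = wordK s e j := fun j => by
    rw [map_wordK]; simp
  have hw' : ∀ j, FreeAlgebra.lift k e (wordKinv s (FreeAlgebra.ι k) j) = wordKinv s e j :=
    fun j => by rw [map_wordKinv]; simp
  cases h with
  | K_comm t u => simpa using R.K_comm t u
  | K_Kinv t => simpa using R.K_Kinv t
  | Kinv_K t => simpa using R.Kinv_K t
  | K_E t j => simpa using R.K_E t j
  | K_F t j => simpa using R.K_F t j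
  | E_F i j =>
    have h := R.E_F i j
    simp only [map_sub, map_mul, map_smul, FreeAlgebra.lift_ι_apply]
    rw [h]
    split_ifs <;> simp only [map_sub, map_smul, hw, hw', map_zero]
  | E_E i j h => simpa using R.nil_E.comm i j h
  | F_F i j h => simpa using R.nil_F.comm i j h
  | serre_E i j h hi => simpa [map_serre] using R.nil_E.ser i j h hi
  | serre_F i j h hi => simpa [map_serre] using R.nil_F.ser i j h hi
  | odd_E i h => simpa using R.nil_E.odd i h
  | odd_F i h => simpa using R.nil_F.odd i h
  | super_E i j l h1 h2 h => simpa [map_superSerre] using R.nil_E.sup i j l h1 h2 h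
  | super_F i j l h1 h2 h => simpa [map_superSerre] using R.nil_F.sup i j l h1 h2 h
  | sig_sig => simpa using R.sig_sig
  | sig_E j => simpa using R.sig_E j
  | sig_F j => simpa using R.sig_F j
  | sig_K t => simpa using R.sig_K t

/-- A family satisfying the relations defines a homomorphism out of `𝒰_q`. -/
noncomputable def Uq.lift {A : Type*} [Ring A] [Algebra k A] {s : Series} {e : Gen m n s → A}
    (R : Relations q s e) : Uq m n q s →ₐ[k] A :=
  RingQuot.liftAlgHom k ⟨FreeAlgebra.lift k e, R.lift_rel⟩

theorem Uq.lift_gen {A : Type*} [Ring A] [Algebra k A] {s : Series} {e : Gen m n s → A}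
    (R : Relations q s e) (g : Gen m n s) : Uq.lift R (Uq.gen m n q s g) = e g :=
  (RingQuot.liftAlgHom_mkAlgHom_apply _ _ _ _).trans (FreeAlgebra.lift_ι_apply _ _)

theorem Uq.relations_gen (s : Series) : Relations q s (Uq.gen m n q s) := by
  have hr : ∀ {x y}, Rel q s x y → Uq.mk m n q s x = Uq.mk m n q s y :=
    fun h => RingQuot.mkAlgHom_rel k h
  have hw : ∀ j, Uq.mk m n q s (wordK s (FreeAlgebra.ι k) j) = wordK s (Uq.gen m n q s) j :=
    fun j => map_wordK _ _ _ _
  have hw' : ∀ j, Uq.mk m n q s (wordKinv s (FreeAlgebra.ι k) j)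
      = wordKinv s (Uq.gen m n q s) j := fun j => map_wordKinv _ _ _ _
  constructor
  · intro t u; simpa [Uq.gen] using hr (.K_comm t u)
  · intro t; simpa [Uq.gen] using hr (.K_Kinv t)
  · intro t; simpa [Uq.gen] using hr (.Kinv_K t)
  · intro t j; simpa [Uq.gen] using hr (.K_E t j)
  · intro t j; simpa [Uq.gen] using hr (.K_F t j)
  · intro i j
    have h := hr (.E_F i j)
    simp only [map_sub, map_mul, map_smul] at h
    rw [Uq.gen, Uq.gen, h]
    split_ifs <;> simp only [map_sub, map_smul, hw, hw', map_zero]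
  · constructor
    · intro i j h; simpa [Uq.gen] using hr (.E_E i j h)
    · intro i j h hi; simpa [Uq.gen, map_serre] using hr (.serre_E i j h hi)
    · intro i h; simpa [Uq.gen] using hr (.odd_E i h)
    · intro i j l h1 h2 h; simpa [Uq.gen, map_superSerre] using hr (.super_E i j l h1 h2 h)
  · constructor
    · intro i j h; simpa [Uq.gen] using hr (.F_F i j h)
    · intro i j h hi; simpa [Uq.gen, map_serre] using hr (.serre_F i j h hi)
    · intro i h; simpa [Uq.gen] using hr (.odd_F i h)
    · intro i j l h1 h2 h; simpa [Uq.gen, map_superSerre] using hr (.super_F i j l h1 h2 h)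
  · simpa [Uq.gen] using hr .sig_sig
  · intro j; simpa [Uq.gen] using hr (.sig_E j)
  · intro j; simpa [Uq.gen] using hr (.sig_F j)
  · intro t; simpa [Uq.gen] using hr (.sig_K t)

end Bialgebra

section Skew
variable {m n : ℕ} {k : Type*} [Field k] {A : Type*} [Ring A] [Algebra k A] {q : kˣ}

theorem serre_add (t : k) (t0 : t ≠ 0) (ht : (q : k) + ((q⁻¹ : kˣ) : k) = t + t⁻¹) (a b c d : A)
    (h1 : b * a = (t⁻¹ * t⁻¹) • (a * b)) (h2 : d * a = t • (a * d)) (h3 : b * c = t • (c * b))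
    (hac : serre q a c = 0) (hbd : serre q b d = 0) : serre q (a + b) (c + d) = 0 := by
  have h1' : ∀ x, b * (a * x) = (t⁻¹ * t⁻¹) • (a * (b * x)) := fun x => by
    rw [← mul_assoc, h1, smul_mul_assoc, mul_assoc]
  have h2' : ∀ x, d * (a * x) = t • (a * (d * x)) := fun x => by
    rw [← mul_assoc, h2, smul_mul_assoc, mul_assoc]
  have h3' : ∀ x, b * (c * x) = t • (c * (b * x)) := fun x => by
    rw [← mul_assoc, h3, smul_mul_assoc, mul_assoc]
  have key : serre q (a + b) (c + d) = serre q a c + serre q b d := by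
    simp only [serre, ht, mul_add, add_mul, mul_assoc, h1, h2, h3, h1', h2', h3', mul_smul_comm, smul_mul_assoc,
      smul_add]
    match_scalars <;> field_simp <;> ring
  rw [key, hac, hbd, add_zero]

theorem superSerre_add (t : k) (t0 : t ≠ 0) (ht : (q : k) + ((q⁻¹ : kˣ) : k) = t + t⁻¹)
    (a b c a' b' c' : A)
    (h12 : a' * b = t • (b * a')) (h13 : a' * c = c * a') 
    (h21 : b' * a = t • (a * b')) (h22 : b' * b = -(b * b')) (h23 : b' * c = t⁻¹ • (c * b'))
    (h31 : c' * a = a * c') (h32 : c' * b = t⁻¹ • (b * c')) 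
    (ac : c * a = a * c) (ac' : c' * a' = a' * c') (bb : b * b = 0) (bb' : b' * b' = 0)
    (h : superSerre q a b c = 0) (h' : superSerre q a' b' c' = 0) :
    superSerre q (a + a') (b + b') (c + c') = 0 := by
  have as : ∀ {x y z : A} {r : k}, x * y = r • z → ∀ w, x * (y * w) = r • (z * w) := 
    fun h w => by rw [← mul_assoc, h, smul_mul_assoc]
  have as' : ∀ {x y z : A}, x * y = z → ∀ w, x * (y * w) = z * w := 
    fun h w => by rw [← mul_assoc, h]
  have key : superSerre q (a + a') (b + b') (c + c') = superSerre q a b c + superSerre q a' b' c' := by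
    simp only [superSerre, ht, mul_add, add_mul, mul_assoc, h12, as h12, h13, as' h13, h21, as h21,
      h22, as' h22, h23, as h23, h31, as' h31, h32, as h32, as' ac, ac', as' bb, bb', mul_smul_comm, smul_mul_assoc,
      smul_add, neg_mul, mul_neg, mul_zero, zero_mul, smul_zero]
    match_scalars <;> field_simp <;> ring
  rw [key, h, h', add_zero]

theorem pairRoot_comm (i j : Fin (m + n - 1)) : pairRoot i j = pairRoot j i := by
  have h1 := i.2; have h2 := j.2
  simp only [pairRoot, pairEps, sgn, lft, rgt, Fin.ext_iff]
  grind

theorem pairRoot_distant {i j : Fin (m + n - 1)} (h : Distant i j) : pairRoot i j = 0 := by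
  have h1 := i.2; have h2 := j.2
  simp only [Distant] at h
  simp only [pairRoot, pairEps, sgn, lft, rgt, Fin.ext_iff]
  grind

theorem pairRoot_adjacent {i j : Fin (m + n - 1)} (h : Adjacent i j) (hi : ¬ IsOdd i) :
    pairRoot i j = -sgn (lft i) := by
  have h1 := i.2; have h2 := j.2
  simp only [Adjacent, IsOdd] at h hi
  simp only [pairRoot, pairEps, sgn, lft, rgt, Fin.ext_iff]
  grind

theorem pairRoot_self {i : Fin (m + n - 1)} (hi : ¬ IsOdd i) :
    pairRoot i i = 2 * sgn (lft i) := by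
  have h1 := i.2
  simp only [IsOdd] at hi
  simp only [pairRoot, pairEps, sgn, lft, rgt, Fin.ext_iff]
  grind

theorem pairRoot_odd {i : Fin (m + n - 1)} (hi : IsOdd i) : pairRoot i i = 0 := by
  have h1 := i.2
  simp only [IsOdd] at hi
  simp only [pairRoot, pairEps, sgn, lft, rgt, Fin.ext_iff]
  grind

theorem pairRoot_left {i j : Fin (m + n - 1)} (h : i.1 + 1 = j.1) (hj : IsOdd j) :
    pairRoot i j = -1 := by
  have h1 := i.2; have h2 := j.2
  simp only [IsOdd] at hj
  simp only [pairRoot, pairEps, sgn, lft, rgt, Fin.ext_iff]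
  grind

theorem pairRoot_right {j l : Fin (m + n - 1)} (h : j.1 + 1 = l.1) (hj : IsOdd j) :
    pairRoot j l = 1 := by
  have h1 := l.2; have h2 := j.2
  simp only [IsOdd] at hj
  simp only [pairRoot, pairEps, sgn, lft, rgt, Fin.ext_iff]
  grind

theorem sgn_cases (i : Fin (m + n)) : sgn i = 1 ∨ sgn i = -1 := by
  unfold sgn; split_ifs <;> simp

/-- The relations pass to the sum of two families that commute up to the bicharacter. -/
theorem NilRelations.add {a b : Fin (m + n - 1) → A} (z : kˣ) (hz : z = q ∨ z = q⁻¹)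
    (ha : NilRelations q a) (hb : NilRelations q b)
    (h : ∀ i j, b i * a j
      = ((-1 : k) ^ (par i * par j) * ((z ^ pairRoot i j : kˣ) : k)) • (a j * b i)) :
    NilRelations q fun j => a j + b j := by
  have hzq : ∀ e : ℤ, (e = 1 ∨ e = -1) → (q : k) + ((q⁻¹ : kˣ) : k)
      = ((z ^ e : kˣ) : k) + ((z ^ e : kˣ) : k)⁻¹ := by
    intro e he
    rcases hz with rfl | rfl <;> rcases he with rfl | rfl <;> simp [add_comm]
  constructor
  · intro i j hd
    have hp : par i * par j = 0 := by
      simp only [Distant] at hd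
      simp only [par, IsOdd]; grind
    have h1 := h i j
    have h2 := h j i
    rw [pairRoot_distant hd, hp] at h1
    rw [pairRoot_comm, pairRoot_distant hd, mul_comm (par j), hp] at h2
    simp only [pow_zero, zpow_zero, Units.val_one, one_mul, one_smul] at h1 h2
    simp only [mul_add, add_mul, ha.comm i j hd, hb.comm i j hd, h1, h2]
    abel
  · intro i j hd hi
    have p0 : par i = 0 := by simp [par, hi]
    have h1 := h i i
    have h2 := h j i
    have h3 := h i j
    rw [pairRoot_comm j i] at h2
    rw [pairRoot_adjacent hd hi, p0] at h2 h3
    rw [pairRoot_self hi, p0] at h1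
    simp only [mul_zero, zero_mul, pow_zero, one_mul] at h1 h2 h3
    refine serre_add (((z ^ (-sgn (lft i)) : kˣ) : k)) (Units.ne_zero _) (hzq _ ?_) _ _ _ _ ?_ h2 h3
      (ha.ser i j hd hi) (hb.ser i j hd hi)
    · rcases sgn_cases (lft i) with h | h <;> simp [h]
    · rw [h1, two_mul, zpow_add, zpow_neg]
      simp
  · intro i hi
    have h1 := h i i
    have p1 : par i = 1 := by simp [par, hi]
    rw [pairRoot_odd hi, p1] at h1
    simp only [mul_one, pow_one, zpow_zero, Units.val_one, neg_smul, one_smul] at h1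
    simp only [mul_add, add_mul, ha.odd i hi, hb.odd i hi, h1]
    abel
  · intro i j l hij hjl hj
    have p0 : par i = 0 := by simp only [IsOdd] at hj; simp only [par, IsOdd]; grind
    have p1 : par j = 1 := by simp [par, hj]
    have p2 : par l = 0 := by simp only [IsOdd] at hj; simp only [par, IsOdd]; grind
    have hd : Distant i l := Or.inl (by omega)
    have hd' : Distant l i := Or.inr (by omega)
    refine superSerre_add (((z ^ (-1 : ℤ) : kˣ) : k)) (Units.ne_zero _) (hzq _ (by simp))
      _ _ _ _ _ _ ?_ ?_ ?_ ?_ ?_ ?_ ?_ (ha.comm _ _ hd') (hb.comm _ _ hd')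
      (ha.odd j hj) (hb.odd j hj) (ha.sup i j l hij hjl hj) (hb.sup i j l hij hjl hj)
    · rw [h i j, pairRoot_left hij hj, p0]; simp
    · rw [h i l, pairRoot_distant hd, p0]; simp
    · rw [h j i, pairRoot_comm, pairRoot_left hij hj, p0]; simp
    · rw [h j j, pairRoot_odd hj, p1]; simp
    · rw [h j l, pairRoot_right hjl hj, p2]; simp
    · rw [h l i, pairRoot_distant hd', p0]; simp
    · rw [h l j, pairRoot_comm, pairRoot_right hjl hj, p2]; simp

theorem NilRelations.tmul {B : Type*} [Ring B] [Algebra k B] {a : Fin (m + n - 1) → A}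
    (ha : NilRelations q a) (u : Fin (m + n - 1) → B) (hu : ∀ i j, u i * u j = u j * u i) :
    NilRelations q fun j => a j ⊗ₜ[k] u j := by
  have hu' : ∀ i j x, u i * (u j * x) = u j * (u i * x) := fun i j x => by
    rw [← mul_assoc, hu, mul_assoc]
  constructor
  · intro i j h
    simp only [Algebra.TensorProduct.tmul_mul_tmul, ha.comm i j h, hu i j]
  · intro i j h hi
    have : serre q (a i ⊗ₜ[k] u i) (a j ⊗ₜ[k] u j) = serre q (a i) (a j) ⊗ₜ (u i * u i * u j) := by
      simp only [serre, Algebra.TensorProduct.tmul_mul_tmul, TensorProduct.add_tmul,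
        TensorProduct.sub_tmul, TensorProduct.smul_tmul', hu j i, mul_assoc]
    rw [this, ha.ser i j h hi, TensorProduct.zero_tmul]
  · intro i h
    simp only [Algebra.TensorProduct.tmul_mul_tmul, ha.odd i h, TensorProduct.zero_tmul]
  · intro i j l h1 h2 h
    have : superSerre q (a i ⊗ₜ[k] u i) (a j ⊗ₜ[k] u j) (a l ⊗ₜ[k] u l)
        = superSerre q (a i) (a j) (a l) ⊗ₜ (u i * (u j * (u j * u l))) := by
      simp only [superSerre, Algebra.TensorProduct.tmul_mul_tmul, TensorProduct.add_tmul,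
        TensorProduct.sub_tmul, TensorProduct.smul_tmul', mul_assoc, hu j i, hu l i, hu l j,
        hu' j i]
    rw [this, ha.sup i j l h1 h2 h, TensorProduct.zero_tmul]

theorem NilRelations.map {B : Type*} [Ring B] [Algebra k B] {a : Fin (m + n - 1) → A}
    (ha : NilRelations q a) (f : A →ₐ[k] B) : NilRelations q fun j => f (a j) := by
  constructor
  · intro i j h; rw [← map_mul, ha.comm i j h, map_mul]
  · intro i j h hi; rw [← map_serre, ha.ser i j h hi, map_zero]
  · intro i h; rw [← map_mul, ha.odd i h, map_zero]
  · intro i j l h1 h2 h; rw [← map_superSerre, ha.sup i j l h1 h2 h, map_zero]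

theorem NilRelations.tmul' {B : Type*} [Ring B] [Algebra k B] {a : Fin (m + n - 1) → A}
    (ha : NilRelations q a) (u : Fin (m + n - 1) → B) (hu : ∀ i j, u i * u j = u j * u i) :
    NilRelations q fun j => u j ⊗ₜ[k] a j :=
  (ha.tmul u hu).map (Algebra.TensorProduct.comm k A B).toAlgHom

end Skew

section Coproduct
variable {m n : ℕ} {k : Type*} [Field k] {A : Type*} [Ring A] [Algebra k A] {q : kˣ}
  {s : Series} {e : Gen m n s → A}

theorem inv_skew {x y z : A} {c : kˣ} (h1 : x * y = 1) (h2 : y * x = 1)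
    (h : x * z = (c : k) • (z * x)) : y * z = ((c⁻¹ : kˣ) : k) • (z * y) := by
  have : z * y = (c : k) • (y * z) := by
    calc z * y = y * (x * z) * y := by rw [← mul_assoc y, h2, one_mul]
      _ = (c : k) • (y * z * (x * y)) := by
        rw [h]; simp only [mul_smul_comm, smul_mul_assoc, mul_assoc]
      _ = _ := by rw [h1, mul_one]
  rw [this, smul_smul, ← Units.val_mul, inv_mul_cancel, Units.val_one, one_smul]

theorem inv_comm {x y z : A} (h1 : x * y = 1) (h2 : y * x = 1) (h : x * z = z * x) :
    y * z = z * y := by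
  calc y * z = y * (z * x) * y := by rw [mul_assoc, mul_assoc, h1, mul_one]
    _ = z * y := by rw [← h, ← mul_assoc y, h2, one_mul]

namespace Relations
theorem Kinv_E (R : Relations q s e) (t j) : e (.Kinv t) * e (.E j)
    = ((q ^ (-cartanWeight s t j) : kˣ) : k) • (e (.E j) * e (.Kinv t)) := by
  rw [zpow_neg]
  exact inv_skew (R.K_Kinv t) (R.Kinv_K t) (R.K_E t j)

theorem Kinv_F (R : Relations q s e) (t j) : e (.Kinv t) * e (.F j)
    = ((q ^ cartanWeight s t j : kˣ) : k) • (e (.F j) * e (.Kinv t)) := by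
  have := inv_skew (R.K_Kinv t) (R.Kinv_K t) (R.K_F t j)
  rwa [zpow_neg, inv_inv] at this

theorem Kinv_K' (R : Relations q s e) (t u) : e (.Kinv t) * e (.K u) = e (.K u) * e (.Kinv t) :=
  inv_comm (R.K_Kinv t) (R.Kinv_K t) (R.K_comm t u)

theorem Kinv_Kinv (R : Relations q s e) (t u) : e (.Kinv t) * e (.Kinv u) = e (.Kinv u) * e (.Kinv t) :=
  inv_comm (R.K_Kinv t) (R.Kinv_K t) (R.Kinv_K' u t).symm

theorem wordK_E (R : Relations q s e) (i j) : wordK s e i * e (.E j)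
    = ((q ^ pairRoot i j : kˣ) : k) • (e (.E j) * wordK s e i) := by
  cases s with
  | gl =>
    simp only [wordK]
    rw [mul_assoc, R.Kinv_E, mul_smul_comm, ← mul_assoc, R.K_E, smul_mul_assoc, smul_smul,
      mul_assoc, ← Units.val_mul, ← zpow_add]
    simp only [cartanWeight, pairRoot, neg_add_eq_sub]
  | sl => exact R.K_E i j

theorem wordK_F (R : Relations q s e) (i j) : wordK s e i * e (.F j)
    = ((q ^ (-pairRoot i j) : kˣ) : k) • (e (.F j) * wordK s e i) := by
  cases s with
  | gl =>
    simp only [wordK]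
    rw [mul_assoc, R.Kinv_F, mul_smul_comm, ← mul_assoc, R.K_F, smul_mul_assoc, smul_smul,
      mul_assoc, ← Units.val_mul, ← zpow_add]
    rw [pairRoot, neg_sub, sub_eq_add_neg]
    rfl
  | sl => exact R.K_F i j

theorem wordK_wordKinv (R : Relations q s e) (j) : wordK s e j * wordKinv s e j = 1 := by
  cases s with
  | gl =>
    simp only [wordK, wordKinv]
    rw [mul_assoc, ← mul_assoc (e (.Kinv (rgt j))), R.Kinv_Kinv, mul_assoc, R.Kinv_K, mul_one,
      R.K_Kinv]
  | sl => exact R.K_Kinv j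

theorem wordKinv_wordK (R : Relations q s e) (j) : wordKinv s e j * wordK s e j = 1 := by
  cases s with
  | gl =>
    simp only [wordK, wordKinv]
    rw [mul_assoc, ← mul_assoc (e (.K (rgt j))), R.K_comm, mul_assoc, R.K_Kinv, mul_one, R.Kinv_K]
  | sl => exact R.Kinv_K j

theorem wordKinv_E (R : Relations q s e) (i j) : wordKinv s e i * e (.E j)
    = ((q ^ (-pairRoot i j) : kˣ) : k) • (e (.E j) * wordKinv s e i) := by
  rw [zpow_neg]
  exact inv_skew (R.wordK_wordKinv i) (R.wordKinv_wordK i) (R.wordK_E i j)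

theorem wordKinv_F (R : Relations q s e) (i j) : wordKinv s e i * e (.F j)
    = ((q ^ pairRoot i j : kˣ) : k) • (e (.F j) * wordKinv s e i) := by
  have := inv_skew (R.wordK_wordKinv i) (R.wordKinv_wordK i) (R.wordK_F i j)
  rwa [zpow_neg, inv_inv] at this

theorem sig_wordK (R : Relations q s e) (j) : e .sig * wordK s e j = wordK s e j * e .sig := by
  have hs : ∀ x, e .sig * x * e .sig = x → e .sig * x = x * e .sig := fun x h => by
    conv_rhs => rw [← h]
    rw [mul_assoc, R.sig_sig, mul_one]
  have hK := fun t => hs _ (R.sig_K t)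
  have hK' : ∀ t, e (.Kinv t) * e .sig = e .sig * e (.Kinv t) :=
    fun t => inv_comm (R.K_Kinv t) (R.Kinv_K t) (hK t).symm
  cases s with
  | gl => simp only [wordK]; rw [← mul_assoc, hK, mul_assoc, ← hK', mul_assoc]
  | sl => exact hK j

theorem wordK_comm (R : Relations q s e) (i j) : wordK s e i * wordK s e j = wordK s e j * wordK s e i := by
  cases s with
  | gl =>
    have c1 := R.K_comm
    have c2 := R.Kinv_K'
    have c3 := R.Kinv_Kinv
    have : ∀ x y : A, Commute x y ↔ x * y = y * x := fun x y => Iff.rfl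
    simp only [wordK, ← this] at *
    exact ((c1 _ _).mul_right (c2 _ _).symm).mul_left ((c2 _ _).mul_right (c3 _ _))
  | sl => exact R.K_comm i j

theorem sig_pow_E (R : Relations q s e) (i j : Fin (m + n - 1)) : e .sig ^ par i * e (.E j)
    = (-1 : k) ^ (par i * par j) • (e (.E j) * e .sig ^ par i) := by
  have h : e .sig * e (.E j) = (-1 : k) ^ par j • (e (.E j) * e .sig) := by
    rw [← smul_mul_assoc, ← R.sig_E, mul_assoc, R.sig_sig, mul_one]
  by_cases hi : IsOdd i <;> simp [par, hi]; simpa [par] using h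

theorem sig_pow_F (R : Relations q s e) (i j : Fin (m + n - 1)) : e .sig ^ par i * e (.F j)
    = (-1 : k) ^ (par i * par j) • (e (.F j) * e .sig ^ par i) := by
  have h : e .sig * e (.F j) = (-1 : k) ^ par j • (e (.F j) * e .sig) := by
    rw [← smul_mul_assoc, ← R.sig_F, mul_assoc, R.sig_sig, mul_one]
  by_cases hi : IsOdd i <;> simp [par, hi]; simpa [par] using h

theorem sig_pow_wordK (R : Relations q s e) (i j : Fin (m + n - 1)) : Commute (e .sig ^ par i) (wordK s e j) :=
  Commute.pow_left (R.sig_wordK j) _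

theorem sig_pow_wordKinv (R : Relations q s e) (i j : Fin (m + n - 1)) : Commute (e .sig ^ par i) (wordKinv s e j) :=
  (inv_comm (R.wordK_wordKinv j) (R.wordKinv_wordK j) (R.sig_pow_wordK i j).symm).symm

theorem wordKinv_comm (R : Relations q s e) (i j) : Commute (wordKinv s e i) (wordKinv s e j) :=
  inv_comm (R.wordK_wordKinv i) (R.wordKinv_wordK i)
    (inv_comm (R.wordK_wordKinv j) (R.wordKinv_wordK j) (R.wordK_comm j i)).symm

theorem sig_pow_sq (R : Relations q s e) (i : Fin (m + n - 1)) : e .sig ^ par i * e .sig ^ par i = 1 := by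
  by_cases hi : IsOdd i <;> simp [par, hi, R.sig_sig]

end Relations

/-- The values of the comultiplication on the generators. -/
def deltaFam (e : Gen m n s → A) : Gen m n s → A ⊗[k] A
  | .E j => e (.E j) ⊗ₜ wordK s e j + (e .sig ^ par j) ⊗ₜ e (.E j)
  | .F j => e (.F j) ⊗ₜ 1 + (e .sig ^ par j * wordKinv s e j) ⊗ₜ e (.F j)
  | .K t => e (.K t) ⊗ₜ e (.K t)
  | .Kinv t => e (.Kinv t) ⊗ₜ e (.Kinv t)
  | .sig => e .sig ⊗ₜ e .sig

theorem wordK_deltaFam (j) : wordK s (deltaFam (k := k) e) j = wordK s e j ⊗ₜ wordK s e j := by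
  cases s <;> simp [wordK, deltaFam]

theorem wordKinv_deltaFam (j) :
    wordKinv s (deltaFam (k := k) e) j = wordKinv s e j ⊗ₜ wordKinv s e j := by
  cases s <;> simp [wordKinv, deltaFam]

theorem skew_E (R : Relations q s e) (i j : Fin (m + n - 1)) :
    ((e .sig ^ par i) ⊗ₜ[k] e (.E i)) * (e (.E j) ⊗ₜ wordK s e j)
      = ((-1 : k) ^ (par i * par j) * ((q⁻¹ ^ pairRoot i j : kˣ) : k))
        • ((e (.E j) ⊗ₜ wordK s e j) * ((e .sig ^ par i) ⊗ₜ[k] e (.E i))) := by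
  rw [Algebra.TensorProduct.tmul_mul_tmul, Algebra.TensorProduct.tmul_mul_tmul, R.sig_pow_E,
    R.wordK_E, pairRoot_comm j i]
  simp only [TensorProduct.tmul_smul, ← TensorProduct.smul_tmul', smul_smul, mul_assoc,
    ← Units.val_mul, ← mul_zpow]
  simp

theorem skew_F (R : Relations q s e) (i j : Fin (m + n - 1)) :
    ((e .sig ^ par i * wordKinv s e i) ⊗ₜ[k] e (.F i)) * (e (.F j) ⊗ₜ 1)
      = ((-1 : k) ^ (par i * par j) * ((q ^ pairRoot i j : kˣ) : k))
        • ((e (.F j) ⊗ₜ 1) * ((e .sig ^ par i * wordKinv s e i) ⊗ₜ[k] e (.F i))) := by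
  rw [Algebra.TensorProduct.tmul_mul_tmul, Algebra.TensorProduct.tmul_mul_tmul, mul_assoc,
    R.wordKinv_F, mul_smul_comm, ← mul_assoc, R.sig_pow_F, smul_mul_assoc, smul_smul, mul_comm
    (((q ^ pairRoot i j : kˣ) : k)), TensorProduct.smul_tmul', mul_one, one_mul, mul_assoc]

theorem Relations.delta (R : Relations q s e) : Relations q s (deltaFam (k := k) e) where
  K_comm t u := by simp [deltaFam, R.K_comm t u]
  K_Kinv t := by simp [deltaFam, R.K_Kinv t, Algebra.TensorProduct.one_def]
  Kinv_K t := by simp [deltaFam, R.Kinv_K t, Algebra.TensorProduct.one_def]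
  K_E t j := by
    have h : e (.K t) * wordK s e j = wordK s e j * e (.K t) := by
      cases s with
      | gl => simp only [wordK]; rw [← mul_assoc, R.K_comm, mul_assoc, ← R.Kinv_K', mul_assoc]
      | sl => exact R.K_comm _ _
    have hs : e (.K t) * e .sig ^ par j = e .sig ^ par j * e (.K t) := by
      refine (Commute.pow_left ?_ _ : Commute (e .sig ^ par j) (e (.K t))).symm
      show e .sig * e (.K t) = e (.K t) * e .sig
      conv_rhs => rw [← R.sig_K]
      rw [mul_assoc, R.sig_sig, mul_one]
    simp only [deltaFam, mul_add, add_mul, Algebra.TensorProduct.tmul_mul_tmul, R.K_E, h, hs,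
      smul_add, TensorProduct.smul_tmul', TensorProduct.tmul_smul]
  K_F t j := by
    have h : e (.K t) * wordKinv s e j = wordKinv s e j * e (.K t) := by
      cases s with
      | gl => simp only [wordKinv]; rw [← mul_assoc, ← R.Kinv_K', mul_assoc, R.K_comm, mul_assoc]
      | sl => exact (R.Kinv_K' _ _).symm
    have hs : e (.K t) * e .sig ^ par j = e .sig ^ par j * e (.K t) := by
      refine (Commute.pow_left ?_ _ : Commute (e .sig ^ par j) (e (.K t))).symm
      show e .sig * e (.K t) = e (.K t) * e .sig
      conv_rhs => rw [← R.sig_K]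
      rw [mul_assoc, R.sig_sig, mul_one]
    have h' : e (.K t) * (e .sig ^ par j * wordKinv s e j)
        = e .sig ^ par j * wordKinv s e j * e (.K t) := by
      rw [← mul_assoc, hs, mul_assoc, h, mul_assoc]
    simp only [deltaFam, mul_add, add_mul, Algebra.TensorProduct.tmul_mul_tmul, R.K_F, h', mul_one,
      one_mul, smul_add, TensorProduct.smul_tmul', TensorProduct.tmul_smul]
  E_F i j := by
    have hEF : ∀ i j, e (.E i) * e (.F j) = (-1 : k) ^ (par i * par j) • (e (.F j) * e (.E i))
        + (if i = j then (((q ^ sgn (lft i) : kˣ) : k) - ((q ^ (-sgn (lft i)) : kˣ) : k))⁻¹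
          • (wordK s e i - wordKinv s e i) else 0) := fun i j => by
      rw [← R.E_F]; abel
    have hs : (-1 : k) ^ (par i * par j) * (-1 : k) ^ (par i * par j) = 1 := by
      rw [← mul_pow]; simp
    rw [wordK_deltaFam, wordKinv_deltaFam]
    have t2 : (e (.E i) ⊗ₜ[k] wordK s e i) * ((e .sig ^ par j * wordKinv s e j) ⊗ₜ e (.F j))
        = (-1 : k) ^ (par i * par j) •
          (((e .sig ^ par j * wordKinv s e j) ⊗ₜ e (.F j)) * (e (.E i) ⊗ₜ[k] wordK s e i)) := by
      simp only [Algebra.TensorProduct.tmul_mul_tmul, R.wordK_F, mul_assoc, R.wordKinv_E,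
        mul_smul_comm, TensorProduct.tmul_smul]
      rw [← mul_assoc (e .sig ^ par j), R.sig_pow_E, pairRoot_comm j i]
      simp only [smul_mul_assoc, TensorProduct.smul_tmul', smul_smul, mul_assoc]
      rw [mul_left_comm, mul_comm (par j), hs, mul_one]
    have t3 : ((e .sig ^ par i) ⊗ₜ[k] e (.E i)) * (e (.F j) ⊗ₜ 1)
        = (-1 : k) ^ (par i * par j) •
          ((e (.F j) ⊗ₜ 1) * ((e .sig ^ par i) ⊗ₜ[k] e (.E i))) := by
      simp only [Algebra.TensorProduct.tmul_mul_tmul, R.sig_pow_F, TensorProduct.smul_tmul',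
        mul_one, one_mul]
    have t1 : (e (.E i) ⊗ₜ[k] wordK s e i) * (e (.F j) ⊗ₜ 1)
        - (-1 : k) ^ (par i * par j) • ((e (.F j) ⊗ₜ 1) * (e (.E i) ⊗ₜ[k] wordK s e i))
        = (e (.E i) * e (.F j) - (-1 : k) ^ (par i * par j) • (e (.F j) * e (.E i)))
          ⊗ₜ wordK s e i := by
      simp only [Algebra.TensorProduct.tmul_mul_tmul, TensorProduct.smul_tmul',
        TensorProduct.sub_tmul, mul_one, one_mul]
    have t4 : ((e .sig ^ par i) ⊗ₜ[k] e (.E i)) * ((e .sig ^ par j * wordKinv s e j) ⊗ₜ e (.F j))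
        - (-1 : k) ^ (par i * par j) • (((e .sig ^ par j * wordKinv s e j) ⊗ₜ e (.F j))
          * ((e .sig ^ par i) ⊗ₜ[k] e (.E i)))
        = (e .sig ^ par i * (e .sig ^ par j * wordKinv s e j)) ⊗ₜ
          (e (.E i) * e (.F j) - (-1 : k) ^ (par i * par j) • (e (.F j) * e (.E i))) := by
      have : e .sig ^ par j * wordKinv s e j * e .sig ^ par i
          = e .sig ^ par i * (e .sig ^ par j * wordKinv s e j) := by
        rw [mul_assoc, ← (R.sig_pow_wordKinv i j).eq, ← mul_assoc, ← mul_assoc, ← pow_add,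
          add_comm, pow_add]
      simp only [Algebra.TensorProduct.tmul_mul_tmul, TensorProduct.tmul_smul,
        TensorProduct.tmul_sub, this]
    rw [R.E_F] at t1 t4
    simp only [deltaFam, mul_add, add_mul, t2, t3, smul_add]
    rw [sub_eq_iff_eq_add] at t1 t4
    rw [t1, t4]
    split_ifs with hij
    · subst hij
      rw [← mul_assoc, R.sig_pow_sq, one_mul]
      simp only [TensorProduct.tmul_smul, TensorProduct.smul_tmul', TensorProduct.sub_tmul,
        TensorProduct.tmul_sub, smul_sub]
      abel
    · simp only [TensorProduct.zero_tmul, TensorProduct.tmul_zero]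
      abel
  nil_E := (R.nil_E.tmul _ R.wordK_comm).add q⁻¹ (Or.inr rfl)
    (R.nil_E.tmul' (fun j => e .sig ^ par j) fun i j => by rw [← pow_add, add_comm, pow_add])
    (skew_E R)
  nil_F := (R.nil_F.tmul (fun _ => 1) fun _ _ => rfl).add q (Or.inl rfl)
    (R.nil_F.tmul' (fun j => e .sig ^ par j * wordKinv s e j) fun i j =>
      ((((Commute.refl (e .sig)).pow_pow _ _).mul_right (R.sig_pow_wordKinv _ _)).mul_left
        ((R.sig_pow_wordKinv _ _).symm.mul_right (R.wordKinv_comm _ _))).eq)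
    (skew_F R)
  sig_sig := by simp [deltaFam, R.sig_sig, Algebra.TensorProduct.one_def]
  sig_E j := by
    have h : e .sig * wordK s e j * e .sig = wordK s e j := by
      rw [R.sig_wordK, mul_assoc, R.sig_sig, mul_one]
    have h' : e .sig * e .sig ^ par j * e .sig = e .sig ^ par j := by
      rw [← pow_succ', pow_succ, mul_assoc, R.sig_sig, mul_one]
    simp only [deltaFam, mul_add, add_mul, Algebra.TensorProduct.tmul_mul_tmul, R.sig_E, h, h',
      smul_add, TensorProduct.smul_tmul', TensorProduct.tmul_smul]
  sig_F j := by
    have h' : e .sig * (e .sig ^ par j * wordKinv s e j) * e .sig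
        = e .sig ^ par j * wordKinv s e j := by
      have h1 := inv_comm (R.wordK_wordKinv j) (R.wordKinv_wordK j) (R.sig_wordK j).symm
      rw [mul_assoc, mul_assoc, h1, ← mul_assoc (e .sig ^ par j), ← mul_assoc, ← mul_assoc,
        ← pow_succ', pow_succ, mul_assoc (e .sig ^ par j), R.sig_sig, mul_one]
    simp only [deltaFam, mul_add, add_mul, Algebra.TensorProduct.tmul_mul_tmul, R.sig_F, h',
      mul_one, R.sig_sig, smul_add, TensorProduct.smul_tmul', TensorProduct.tmul_smul]
  sig_K t := by simp [deltaFam, R.sig_K t]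

end Coproduct

section BialgebraStructure
variable {m n : ℕ} {k : Type*} [Field k] {q : kˣ} {s : Series}

/-- The values of the counit on the generators. -/
def epsFam : Gen m n s → k
  | .E _ => 0
  | .F _ => 0
  | .K _ => 1
  | .Kinv _ => 1
  | .sig => 1

theorem wordK_epsFam (j) : wordK s (epsFam (k := k) (m := m) (n := n)) j = 1 := by
  cases s <;> simp [wordK, epsFam]

theorem wordKinv_epsFam (j) : wordKinv s (epsFam (k := k) (m := m) (n := n)) j = 1 := by
  cases s <;> simp [wordKinv, epsFam]

theorem nilRelations_zero : NilRelations (m := m) (n := n) q fun _ => (0 : k) := by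
  constructor <;> intros <;> simp [serre, superSerre]

theorem relations_epsFam : Relations q s (epsFam (k := k) (m := m) (n := n)) where
  K_comm t u := by simp [epsFam]
  K_Kinv t := by simp [epsFam]
  Kinv_K t := by simp [epsFam]
  K_E t j := by simp [epsFam]
  K_F t j := by simp [epsFam]
  E_F i j := by simp [wordK_epsFam, wordKinv_epsFam, epsFam]
  nil_E := nilRelations_zero
  nil_F := nilRelations_zero
  sig_sig := by simp [epsFam]
  sig_E j := by simp [epsFam]
  sig_F j := by simp [epsFam]
  sig_K t := by simp [epsFam]

/-- The bialgebra structure with the given values of `Δ` and `ε` on the generators. -/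
noncomputable abbrev bialgebraOfGen {H : Type*} [Ring H] [Algebra k H] (e : Gen m n s → H)
    (he : Algebra.adjoin k (Set.range e) = ⊤) (Δ : H →ₐ[k] H ⊗[k] H) (ε : H →ₐ[k] k)
    (hΔ : ∀ g, Δ (e g) = deltaFam e g) (hε : ∀ g, ε (e g) = epsFam g) : Bialgebra k H := by
  have hwΔ : ∀ j, Δ (wordK s e j) = wordK s e j ⊗ₜ wordK s e j := fun j => by
    rw [map_wordK]; simp only [hΔ]; exact wordK_deltaFam j
  have hwΔ' : ∀ j, Δ (wordKinv s e j) = wordKinv s e j ⊗ₜ wordKinv s e j := fun j => by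
    rw [map_wordKinv]; simp only [hΔ]; exact wordKinv_deltaFam j
  have hwε : ∀ j, ε (wordK s e j) = 1 := fun j => by
    rw [map_wordK]; simp only [hε]; exact wordK_epsFam j
  have hwε' : ∀ j, ε (wordKinv s e j) = 1 := fun j => by
    rw [map_wordKinv]; simp only [hε]; exact wordKinv_epsFam j
  have hp : ∀ i : ℕ, (e .sig ⊗ₜ[k] e .sig) ^ i = (e .sig ^ i) ⊗ₜ[k] (e .sig ^ i) :=
    fun i => by rw [Algebra.TensorProduct.tmul_pow]
  refine Bialgebra.ofAlgHom Δ ε (AlgHom.ext_of_adjoin_eq_top he ?_)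
    (AlgHom.ext_of_adjoin_eq_top he ?_) (AlgHom.ext_of_adjoin_eq_top he ?_)
  · rintro _ ⟨x, rfl⟩
    cases x <;> simp [hΔ, deltaFam, hwΔ, hwΔ', hp, TensorProduct.add_tmul, TensorProduct.tmul_add,
      add_assoc, Algebra.TensorProduct.one_def]
  · rintro _ ⟨x, rfl⟩
    cases x <;> simp [hΔ, deltaFam, hwε', hε, epsFam]
  · rintro _ ⟨x, rfl⟩
    cases x <;> simp [hΔ, deltaFam, hwε, hε, epsFam]

theorem Uq.mk_surjective : Function.Surjective (Uq.mk m n q s) :=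
  RingQuot.mkAlgHom_surjective k _

theorem adjoin_range_comp {A B : Type*} [Ring A] [Ring B] [Algebra k A] [Algebra k B]
    (f : A →ₐ[k] B) (hf : Function.Surjective f) {ι : Type*} (e : ι → A)
    (he : Algebra.adjoin k (Set.range e) = ⊤) :
    Algebra.adjoin k (Set.range fun i => f (e i)) = ⊤ := by
  have : (Set.range fun i => f (e i)) = f '' Set.range e := Set.range_comp f e
  rw [this, ← AlgHom.map_adjoin, he, Algebra.map_top, AlgHom.range_eq_top]
  exact hf

theorem Uq.adjoin_gen : Algebra.adjoin k (Set.range (Uq.gen m n q s)) = ⊤ :=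
  adjoin_range_comp _ Uq.mk_surjective _ (FreeAlgebra.adjoin_range_ι k (Gen m n s))

/-- The bialgebra structure of `𝒰_q`: `Δ(E_j) = E_j ⊗ 𝒦_j + σ^(p(j)) ⊗ E_j`,
`Δ(F_j) = F_j ⊗ 1 + σ^(p(j)) 𝒦_j⁻¹ ⊗ F_j`, the Cartan generators and `σ` are group-like, and
`ε(E_j) = ε(F_j) = 0`. -/
noncomputable instance : Bialgebra k (Uq m n q s) :=
  bialgebraOfGen (Uq.gen m n q s) Uq.adjoin_gen (Uq.lift (Uq.relations_gen s).delta)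
    (Uq.lift relations_epsFam) (Uq.lift_gen _) (Uq.lift_gen _)

end BialgebraStructure

section Restricted
variable {m n : ℕ} {k : Type*} [Field k] {q : kˣ} {s : Series}

theorem qNum_inv (v : kˣ) (a : ℕ) : qNum v⁻¹ a = qNum v a := by
  rw [qNum, qNum, ← Finset.sum_range_reflect]
  refine Finset.sum_congr rfl fun i hi => ?_
  have := Finset.mem_range.1 hi
  rw [inv_zpow']
  congr 2
  omega

theorem qChar_inv (v : kˣ) : qChar v⁻¹ = qChar v := by simp only [qChar, qNum_inv]

/-- The `v`-binomial theorem. -/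
theorem add_pow_qBinom {A : Type*} [Ring A] [Algebra k A] (v : kˣ) {a b : A}
    (h : b * a = ((v ^ (2 : ℤ) : kˣ) : k) • (a * b)) (N : ℕ) :
    (a + b) ^ N = ∑ r ∈ Finset.range (N + 1),
      (((v ^ ((r : ℤ) * ((N : ℤ) - r)) : kˣ) : k) * qBinom v N r) • (a ^ r * b ^ (N - r)) := by
  have hb : ∀ r : ℕ, b * a ^ r = ((v ^ (2 * (r : ℤ)) : kˣ) : k) • (a ^ r * b) := by
    intro r
    induction r with
    | zero => simp
    | succ r ih =>
      rw [pow_succ, ← mul_assoc, ih, smul_mul_assoc, mul_assoc, h, mul_smul_comm, smul_smul,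
        mul_assoc, ← Units.val_mul, ← zpow_add]
      congr 4
  induction N with
  | zero => simp [qBinom]
  | succ N ih =>
    rw [pow_succ', add_mul, ih, Finset.mul_sum, Finset.mul_sum, Finset.sum_range_succ' _ (N + 1)]
    rw [Finset.sum_range_succ' (fun r => b * _) N]
    have e1 : ∀ r ∈ Finset.range (N + 1),
        (((v ^ (((r + 1 : ℕ) : ℤ) * (((N + 1 : ℕ) : ℤ) - (r + 1 : ℕ))) : kˣ) : k)
            * qBinom v (N + 1) (r + 1)) • (a ^ (r + 1) * b ^ (N + 1 - (r + 1)))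
          = a * ((((v ^ ((r : ℤ) * ((N : ℤ) - r)) : kˣ) : k) * qBinom v N r)
              • (a ^ r * b ^ (N - r)))
            + (((v ^ (((r + 1 : ℕ) : ℤ) * ((N : ℤ) - r + 1)) : kˣ) : k) * qBinom v N (r + 1))
              • (a ^ (r + 1) * b ^ (N - r)) := by
      intro r _
      rw [mul_smul_comm, ← mul_assoc, ← pow_succ', Nat.add_sub_add_right, ← add_smul, qBinom,
        mul_add, ← mul_assoc, ← mul_assoc, ← Units.val_mul, ← Units.val_mul, ← zpow_add, ← zpow_add]
      congr 6 <;> push_cast <;> ring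
    rw [Finset.sum_congr rfl e1, Finset.sum_add_distrib, Finset.sum_range_succ
      (fun r => (((v ^ (((r + 1 : ℕ) : ℤ) * ((N : ℤ) - r + 1)) : kˣ) : k) * qBinom v N (r + 1))
              • (a ^ (r + 1) * b ^ (N - r))), qBinom_eq_zero v N (N + 1) (by omega)]
    have e2 : ∀ r ∈ Finset.range N,
        b * ((((v ^ (((r + 1 : ℕ) : ℤ) * ((N : ℤ) - (r + 1 : ℕ))) : kˣ) : k) * qBinom v N (r + 1))
            • (a ^ (r + 1) * b ^ (N - (r + 1))))
          = (((v ^ (((r + 1 : ℕ) : ℤ) * ((N : ℤ) - r + 1)) : kˣ) : k) * qBinom v N (r + 1))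
              • (a ^ (r + 1) * b ^ (N - r)) := by
      intro r hr
      have hr := Finset.mem_range.1 hr
      rw [mul_smul_comm, ← mul_assoc, hb, smul_mul_assoc, smul_smul, mul_assoc (a ^ (r + 1)),
        ← pow_succ', show N - (r + 1) + 1 = N - r by omega, mul_right_comm, ← Units.val_mul,
        ← zpow_add]
      congr 4
      push_cast
      ring
    rw [Finset.sum_congr rfl e2]
    simp [qBinom_zero_right, pow_succ']
    abel

theorem add_pow_qChar {A : Type*} [Ring A] [Algebra k A] (v : kˣ) (h0 : 0 < qChar v) {a b : A}
    (h : b * a = ((v ^ (2 : ℤ) : kˣ) : k) • (a * b)) :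
    (a + b) ^ qChar v = a ^ qChar v + b ^ qChar v := by
  rw [add_pow_qBinom v h, Finset.sum_range_succ, ← Nat.sub_add_cancel h0,
    Finset.sum_range_succ', Finset.sum_eq_zero]
  · rw [Nat.sub_add_cancel h0]
    simp [qBinom_zero_right, qBinom_self, add_comm]
  · intro r hr
    have hr := Finset.mem_range.1 hr
    have := qBinom_restricted v (r + 1) (qChar v - (r + 1)) (by omega) (by omega) (by omega)
    rw [Nat.add_sub_cancel' (by omega)] at this
    rw [Nat.sub_add_cancel h0, this]
    simp


theorem Relations.map {A B : Type*} [Ring A] [Ring B] [Algebra k A] [Algebra k B]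
    {e : Gen m n s → A} (R : Relations q s e) (f : A →ₐ[k] B) :
    Relations q s fun g => f (e g) where
  K_comm t u := by rw [← map_mul, R.K_comm, map_mul]
  K_Kinv t := by rw [← map_mul, R.K_Kinv, map_one]
  Kinv_K t := by rw [← map_mul, R.Kinv_K, map_one]
  K_E t j := by rw [← map_mul, R.K_E, map_smul, map_mul]
  K_F t j := by rw [← map_mul, R.K_F, map_smul, map_mul]
  E_F i j := by
    rw [← map_mul, ← map_mul, ← map_smul, ← map_sub, R.E_F, ← map_wordK, ← map_wordKinv]
    split_ifs <;> simp only [map_smul, map_sub, map_zero]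
  nil_E := R.nil_E.map f
  nil_F := R.nil_F.map f
  sig_sig := by rw [← map_mul, R.sig_sig, map_one]
  sig_E j := by rw [← map_mul, ← map_mul, R.sig_E, map_smul]
  sig_F j := by rw [← map_mul, ← map_mul, R.sig_F, map_smul]
  sig_K t := by rw [← map_mul, ← map_mul, R.sig_K]

variable (q) in
/-- The family `e` satisfies the additional relations of the restricted algebra. -/
structure ResRelations {A : Type*} [Ring A] (e : Gen m n s → A) : Prop where
  E : ∀ j, ¬ IsOdd j → e (.E j) ^ qChar q = 0
  F : ∀ j, ¬ IsOdd j → e (.F j) ^ qChar q = 0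
  odd_E : ∀ j, IsOdd j → e (.E j) ^ 2 = 0
  odd_F : ∀ j, IsOdd j → e (.F j) ^ 2 = 0
  K : ∀ t, e (.K t) ^ (2 * qChar q) = 1

/-- A family satisfying all the relations defines a homomorphism out of `u_q`. -/
noncomputable def ResUq.lift {A : Type*} [Ring A] [Algebra k A] {e : Gen m n s → A}
    (R : Relations q s e) (R' : ResRelations q e) : ResUq m n q s →ₐ[k] A :=
  RingQuot.liftAlgHom k ⟨Uq.lift R, fun x y h => by
    cases h with
    | E j h => simpa [Uq.lift_gen] using R'.E j h
    | F j h => simpa [Uq.lift_gen] using R'.F j h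
    | odd_E j h => simpa [Uq.lift_gen] using R'.odd_E j h
    | odd_F j h => simpa [Uq.lift_gen] using R'.odd_F j h
    | K t => simpa [Uq.lift_gen] using R'.K t⟩

theorem ResUq.lift_gen {A : Type*} [Ring A] [Algebra k A] {e : Gen m n s → A}
    (R : Relations q s e) (R' : ResRelations q e) (g : Gen m n s) :
    ResUq.lift R R' (ResUq.gen m n q s g) = e g :=
  (RingQuot.liftAlgHom_mkAlgHom_apply _ _ _ _).trans (Uq.lift_gen R g)

theorem ResUq.relations_gen (s : Series) : Relations q s (ResUq.gen m n q s) :=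
  (Uq.relations_gen s).map (ResUq.mk m n q s)

theorem ResUq.resRelations_gen (s : Series) : ResRelations q (ResUq.gen m n q s) := by
  have hr : ∀ {x y}, ResRel m n q s x y → ResUq.mk m n q s x = ResUq.mk m n q s y :=
    fun h => RingQuot.mkAlgHom_rel k h
  constructor
  · intro j h; simpa [ResUq.gen] using hr (.E j h)
  · intro j h; simpa [ResUq.gen] using hr (.F j h)
  · intro j h; simpa [ResUq.gen] using hr (.odd_E j h)
  · intro j h; simpa [ResUq.gen] using hr (.odd_F j h)
  · intro t; simpa [ResUq.gen] using hr (.K t)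

theorem ResUq.mk_surjective : Function.Surjective (ResUq.mk m n q s) :=
  RingQuot.mkAlgHom_surjective k _

theorem ResUq.adjoin_gen : Algebra.adjoin k (Set.range (ResUq.gen m n q s)) = ⊤ :=
  adjoin_range_comp _ ResUq.mk_surjective _ Uq.adjoin_gen

theorem resRelations_epsFam [hl : Fact (2 < qChar q)] :
    ResRelations q (epsFam (k := k) (m := m) (n := n) (s := s)) := by
  have := hl.out
  constructor
  · intro j _; exact zero_pow (by omega)
  · intro j _; exact zero_pow (by omega)
  · intro j _; exact zero_pow (by omega)
  · intro j _; exact zero_pow (by omega)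
  · intro j; exact one_pow _

theorem ResRelations.delta [hl : Fact (2 < qChar q)] {A : Type*} [Ring A] [Algebra k A]
    {e : Gen m n s → A} (R : Relations q s e) (R' : ResRelations q e) :
    ResRelations q (deltaFam (k := k) e) := by
  have h2 := hl.out
  have key : ∀ j : Fin (m + n - 1), ¬ IsOdd j → ∀ z : kˣ, (z = q ∨ z = q⁻¹) → ∀ a b : A ⊗[k] A,
      b * a = ((-1 : k) ^ (par j * par j) * ((z ^ pairRoot j j : kˣ) : k)) • (a * b) →
      (a + b) ^ qChar q = a ^ qChar q + b ^ qChar q := by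
    intro j hj z hz a b h
    have hz' : qChar z = qChar q := by rcases hz with rfl | rfl <;> simp [qChar_inv]
    have hv : qChar (z ^ sgn (lft j)) = qChar q := by
      rcases sgn_cases (lft j) with h | h <;> simp [h, qChar_inv, hz']
    rw [← hv]
    refine add_pow_qChar _ (by omega) ?_
    rw [h, pairRoot_self hj, ← zpow_mul, mul_comm 2]
    simp [par, hj]
  have hodd := fun (j : Fin (m + n - 1)) => R.delta.nil_E.odd j
  have hodd' := fun (j : Fin (m + n - 1)) => R.delta.nil_F.odd j
  constructor
  · intro j hj
    rw [deltaFam, key j hj _ (Or.inr rfl) _ _ (skew_E R j j), Algebra.TensorProduct.tmul_pow,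
      Algebra.TensorProduct.tmul_pow, R'.E j hj, TensorProduct.zero_tmul, TensorProduct.tmul_zero,
      add_zero]
  · intro j hj
    rw [deltaFam, key j hj _ (Or.inl rfl) _ _ (skew_F R j j), Algebra.TensorProduct.tmul_pow,
      Algebra.TensorProduct.tmul_pow, R'.F j hj, TensorProduct.zero_tmul, TensorProduct.tmul_zero,
      add_zero]
  · intro j hj; rw [pow_two]; exact hodd j hj
  · intro j hj; rw [pow_two]; exact hodd' j hj
  · intro t
    rw [deltaFam, Algebra.TensorProduct.tmul_pow, R'.K t, Algebra.TensorProduct.one_def]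

/-- The bialgebra structure of `u_q`, given by the same formulas. -/
noncomputable instance [Fact (2 < qChar q)] : Bialgebra k (ResUq m n q s) :=
  bialgebraOfGen (ResUq.gen m n q s) ResUq.adjoin_gen
    (ResUq.lift (ResUq.relations_gen s).delta
      (ResRelations.delta (ResUq.relations_gen s) (ResUq.resRelations_gen s)))
    (ResUq.lift relations_epsFam resRelations_epsFam) (ResUq.lift_gen _ _) (ResUq.lift_gen _ _)

end Restricted

section Action

/-- The action `ρ` of the bialgebra `H` makes the algebra `A` an `H`-module algebra:
`h.(ab) = ∑ (h_(1).a) (h_(2).b)` and `h.1 = ε(h) 1`. -/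
structure IsModuleAlgebra {k H A : Type*} [CommRing k] [Ring H] [Bialgebra k H] [Ring A]
    [Algebra k A] (ρ : H →ₐ[k] Module.End k A) : Prop where
  map_mul : ∀ h a b, ρ h (a * b) = LinearMap.mul' k A
    (TensorProduct.homTensorHomMap (RingHom.id k) A A A A
      (TensorProduct.map ρ.toLinearMap ρ.toLinearMap (Coalgebra.comul (R := k) h)) (a ⊗ₜ b))
  map_one : ∀ h, ρ h 1 = Coalgebra.counit (R := k) h • 1

variable {k : Type*} [Field k] (q : kˣ) (m n : ℕ)

/-- The operator by which `𝒦_j` acts: `σ_j σ_{j+1}⁻¹` for `j < m`, `σ_m σ_{m+1} τ_{m+1}` for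
`j = m`, and `σ_j⁻¹ σ_{j+1} τ_j τ_{j+1}` for `j > m` (in the numbering from `1`). -/
noncomputable def opCalK (j : Fin (m + n - 1)) : (Module.End k (Grassmann q m n))ˣ :=
  if j.1 + 1 < m then sigmaOp q m n (lft j) * (sigmaOp q m n (rgt j))⁻¹
  else if j.1 + 1 = m then
    sigmaOp q m n (lft j) * sigmaOp q m n (rgt j) * tauOp q m n (rgt j)
  else (sigmaOp q m n (lft j))⁻¹ * sigmaOp q m n (rgt j) * tauOp q m n (lft j)
    * tauOp q m n (rgt j)

/-- The operator by which a Cartan generator acts: for `gl`, `σ_i` if `i ∈ I_0` and `(σ_i τ_i)⁻¹` if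
`i ∈ I_1`. -/
noncomputable def opCartan : (s : Series) → CartanIdx m n s → (Module.End k (Grassmann q m n))ˣ
  | .gl, i => if i.1 < m then sigmaOp q m n i else (sigmaOp q m n i * tauOp q m n i)⁻¹
  | .sl, j => opCalK q m n j

variable {m n}

/-- The generators `e` of `H` act on the algebra `W`, which maps to `Ω_q(m|n)` by `ι`, through the
quantum differential operators. -/
structure ActsByQDO {s : Series} {H W : Type*} [Ring H] [Algebra k H] [Ring W] [Algebra k W]
    (e : Gen m n s → H) (ι : W →ₐ[k] Grassmann q m n) (ρ : H →ₐ[k] Module.End k W) : Prop where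
  E : ∀ j w, ι (ρ (e (.E j)) w) = opE q m n j (ι w)
  F : ∀ j w, ι (ρ (e (.F j)) w) = opF q m n j (ι w)
  K : ∀ t w, ι (ρ (e (.K t)) w) = (opCartan q m n s t : Module.End k (Grassmann q m n)) (ι w)
  calK : ∀ j w, ι (ρ (wordK s e j) w) = (opCalK q m n j : Module.End k (Grassmann q m n)) (ι w)
  sig : ∀ w, ι (ρ (e .sig) w) = (parityOp q m n : Module.End k (Grassmann q m n)) (ι w)

end Action
end QGrassmann

/-!
A basis element `x^(α) ⊗ x^μ` of `Ω_q(m|n)` is determined by its exponent vector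
`β : Fin (m + n) → ℕ`, the concatenation of `α` and `μ`. With `s_l = q` for even and `s_l = -q` for
odd `l`, the product is `x^β x^γ = b(β, γ) ∏_i [β_i + γ_i, β_i] x^(β + γ)`, where
`b(β, γ) = ∏_{l < i} s_l^(β_i γ_l)` is a bicharacter and the `q`-binomials run over the even indices
(`xmon_mul`). It treats even and odd indices alike if `x^β` is read as `0` when an odd exponent
exceeds `1`.

Multiplication by `x_i` and `∂_i` are the raising and lowering operators `X_i`, `D_i` of the index
`i`, up to the factor `∏_{l < i} s_l^(±β_l)` from moving `x_i` to its place. In `E_j` and `F_j`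
these factors cancel against `σ_j`, so that `E_j` acts by `X_j D_{j+1}` and `F_j` by `X_{j+1} D_j`
(`opE_eq`, `opF_eq`). Operators of different indices commute, and each index satisfies short
relations of its own (`oscillators`). The quantum Serre relations and their super version are formal
consequences (`Oscillators.nilRelations`); as the relations are symmetric in `X` and `D`, those for
the `F_j` follow from those for the `E_j`. The commutator of `E_j` and `F_j` is an identity of
`q`-integers on each monomial (`opE_opF`), and the remaining relations say that the Cartan
generators and `σ` act diagonally, by characters `β ↦ ∏_i c_i^(β_i)`.

Each diagonal operator of this kind is an algebra automorphism. The operators `X_i` and `D_i` are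
skew derivations with respect to such automorphisms, by the `q`-Pascal rule (`raising_mul_left`,
`raising_mul_right`, `lowering_mul`), and composing the rules gives those of `E_j` and `F_j`, which
match the coproduct (`opE_mul`, `opF_mul`). The module algebra axioms are multiplicative in `h`, so
the generators suffice (`isModuleAlgebra_of_gen`).

On `Ω_q(m|n, 1)` the operators restrict because the coefficient of `X_i` on the exponent `ℓ - 1` is
`[ℓ] = 0`. There `D_i^ℓ = 0`, hence `E_j^ℓ = F_j^ℓ = 0`, and the Cartan generators have order
dividing `2ℓ` because `q^ℓ = q^(-ℓ)`.
-/

namespace QGrassmann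

/-! ### Monomials with a single exponent vector -/

section Exponents
variable {m n : ℕ}
open MonomialAlgebra

/-- The exponent vector of the basis element `x^(α) ⊗ x^μ`: the concatenation of `α` and `μ`. -/
def expo (x : (Fin m → ℕ) × Finset (Fin n)) : Fin (m + n) → ℕ := Fin.append x.1 (ind x.2)

/-- The odd entries of `β` are at most `1`: `β` is the exponent vector of a basis element. -/
def IsExpo (β : Fin (m + n) → ℕ) : Prop := ∀ i, m ≤ i.1 → β i ≤ 1

/-- The index of the basis element with exponent vector `β`. -/
def ofExpo (β : Fin (m + n) → ℕ) : (Fin m → ℕ) × Finset (Fin n) :=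
  (fun a => β (Fin.castAdd n a), Finset.univ.filter fun b => β (Fin.natAdd m b) = 1)

theorem isExpo_expo (x : (Fin m → ℕ) × Finset (Fin n)) : IsExpo (expo x) := by
  intro i
  induction i using Fin.addCases with
  | left a => intro h; have := a.2; simp at h; omega
  | right b => intro _; simp only [expo, Fin.append_right, ind]; split_ifs <;> simp

theorem ofExpo_expo (x : (Fin m → ℕ) × Finset (Fin n)) : ofExpo (expo x) = x := by
  ext <;> simp [ofExpo, expo, ind]

theorem expo_ofExpo {β : Fin (m + n) → ℕ} (h : IsExpo β) : expo (ofExpo β) = β := by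
  funext i
  induction i using Fin.addCases with
  | left a => simp [expo, ofExpo]
  | right b =>
    have := h (Fin.natAdd m b) (by simp)
    simp only [expo, ofExpo, Fin.append_right, ind, Finset.mem_filter, Finset.mem_univ, true_and]
    split_ifs <;> omega

theorem IsExpo.of_add_left {β γ : Fin (m + n) → ℕ} (h : IsExpo (β + γ)) : IsExpo β :=
  fun i hi => (Nat.le_add_right _ _).trans (h i hi)

theorem IsExpo.of_add_right {β γ : Fin (m + n) → ℕ} (h : IsExpo (β + γ)) : IsExpo γ :=
  fun i hi => (Nat.le_add_left _ _).trans (h i hi)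

variable {k : Type*} [Field k] (q : kˣ)

open Classical in
/-- The monomial `x^β` in `Ω_q(m|n)`, for an arbitrary vector `β` of exponents; it is `0` if an odd
generator has exponent greater than `1`. -/
noncomputable def xmon (β : Fin (m + n) → ℕ) : Grassmann q m n :=
  if IsExpo β then mon _ (ofExpo β) else 0

theorem xmon_expo (x : (Fin m → ℕ) × Finset (Fin n)) : xmon q (expo x) = mon _ x := by
  rw [xmon, if_pos (isExpo_expo x), ofExpo_expo]

theorem xmon_eq_zero {β : Fin (m + n) → ℕ} (h : ¬ IsExpo β) : xmon q β = 0 := if_neg h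

theorem xmon_eq_zero' {β : Fin (m + n) → ℕ} (i : Fin (m + n)) (h : ¬ i.1 < m) (hi : 1 < β i) :
    xmon q β = 0 := xmon_eq_zero q fun hβ => absurd (hβ i (not_lt.1 h)) (not_le.2 hi)

/-- Linear maps on `Ω_q(m|n)` are determined by their values on monomials. -/
theorem xmon_ext {V : Type*} [AddCommGroup V] [Module k V] {S T : Grassmann q m n →ₗ[k] V}
    (h : ∀ β, IsExpo β → S (xmon q β) = T (xmon q β)) : S = T :=
  (basis (grassmannTable q m n)).ext fun x => by
    have := h (expo x) (isExpo_expo x)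
    rwa [xmon_expo] at this

theorem xmon_zero : xmon q (0 : Fin (m + n) → ℕ) = 1 := by
  have : expo (0, ∅) = (0 : Fin (m + n) → ℕ) := by
    funext i
    induction i using Fin.addCases <;> simp [expo, ind]
  rw [← this, xmon_expo]
  rfl

/-- The scalar `q` for an even index and `-q` for an odd one. -/
def twist (i : Fin (m + n)) : kˣ := if i.1 < m then q else -q

/-- The bicharacter `∏_{l < i} s_l^(β_i γ_l)`, where `s_l` is `twist q l`. -/
def bichar (β γ : Fin (m + n) → ℕ) : kˣ := ∏ i, ∏ l ∈ Finset.Iio i, twist q l ^ (β i * γ l)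

theorem bichar_add_left (β β' γ : Fin (m + n) → ℕ) :
    bichar q (β + β') γ = bichar q β γ * bichar q β' γ := by
  simp [bichar, add_mul, pow_add, Finset.prod_mul_distrib]

theorem bichar_add_right (β γ γ' : Fin (m + n) → ℕ) :
    bichar q β (γ + γ') = bichar q β γ * bichar q β γ' := by
  simp [bichar, mul_add, pow_add, Finset.prod_mul_distrib]

theorem bichar_single_left (i : Fin (m + n)) (γ : Fin (m + n) → ℕ) :
    bichar q (Pi.single i 1) γ = ∏ l ∈ Finset.Iio i, twist q l ^ γ l := by
  rw [bichar, Finset.prod_eq_single i]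
  · simp
  · intro j _ h; simp [h]
  · simp

theorem bichar_single_right (i : Fin (m + n)) (β : Fin (m + n) → ℕ) :
    bichar q β (Pi.single i 1) = ∏ l ∈ Finset.Ioi i, twist q i ^ β l := by
  have : ∀ l, ∏ l' ∈ Finset.Iio l, twist q l' ^ (β l * (Pi.single i 1 : Fin (m + n) → ℕ) l')
      = if i < l then twist q i ^ β l else 1 := fun l => by
    split_ifs with h
    · rw [Finset.prod_eq_single i]
      · simp
      · intro j _ h; simp [h]
      · simp [h]
    · refine Finset.prod_eq_one fun j hj => ?_
      have : j ≠ i := by rintro rfl; exact h (Finset.mem_Iio.1 hj)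
      simp [this]
  simp only [bichar, this, ← Finset.prod_filter]
  congr 1
  ext; simp

/-- The factor of the structure constant of `x^β x^γ` contributed by one index `i`, with
`b = β_i` and `c = γ_i`. -/
def siteBinom (i : Fin (m + n)) (b c : ℕ) : k := if i.1 < m then qBinom q (b + c) b else 1

theorem bichar_expo (x y : (Fin m → ℕ) × Finset (Fin n)) :
    (bichar q (expo x) (expo y) : k) = (q : k) ^ (x.2.card * ∑ i, y.1 i)
      * ((q : k) ^ starProd x.1 y.1 * (-(q : k)) ^ starProd (ind x.2) (ind y.2)) := by
  have hs : ∀ {r : ℕ} (β γ : Fin r → ℕ) (c : k), c ^ starProd β γ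
      = ∏ i, ∏ l, if l < i then c ^ (β i * γ l) else 1 := fun β γ c => by
    rw [Finset.prod_comm, starProd, Finset.prod_pow_eq_pow_sum .. |>.symm]
    refine Finset.prod_congr rfl fun j _ => ?_
    rw [Finset.prod_pow_eq_pow_sum .. |>.symm, ← Finset.prod_filter]
    congr 1
    ext; simp
  have hc : x.2.card = ∑ b, ind x.2 b := by simp [ind]
  have h1 : ∀ i, (∏ l ∈ Finset.Iio i, twist q l ^ (expo x i * expo y l))
      = ∏ l, if l < i then twist q l ^ (expo x i * expo y l) else 1 := fun i => by
    rw [← Finset.prod_filter]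
    congr 1
    ext; simp
  have h0 : bichar q (expo x) (expo y)
      = ∏ i, ∏ l, if l < i then twist q l ^ (expo x i * expo y l) else 1 :=
    Finset.prod_congr rfl fun i _ => h1 i
  have hlt : ∀ (a : Fin m) (b : Fin n), ¬ Fin.natAdd m b < Fin.castAdd n a := fun a b => by
    rw [Fin.lt_def]; simp; omega
  have hlt' : ∀ (a : Fin m) (b : Fin n), Fin.castAdd n a < Fin.natAdd m b := fun a b => by
    rw [Fin.lt_def]; simp; omega
  rw [h0, hs, hs, hc, Finset.sum_mul, ← Finset.prod_pow_eq_pow_sum]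
  simp only [Fin.prod_univ_add, expo, Fin.append_left, Fin.append_right, hlt, hlt', twist,
    if_true, if_false, Fin.val_castAdd, Fin.val_natAdd, Fin.is_lt, Finset.mul_sum,
    ← Finset.prod_pow_eq_pow_sum]
  push_cast
  simp only [Finset.prod_mul_distrib, Finset.prod_const_one, mul_one]
  simp [-Fin.val_fin_lt, Fin.lt_def, apply_ite (Units.val (α := k))]
  ring

/-- The multiplication of `Ω_q(m|n)`, without distinction between even and odd generators. -/
theorem xmon_mul (β γ : Fin (m + n) → ℕ) : xmon q β * xmon q γ
    = ((bichar q β γ : k) * ∏ i, siteBinom q i (β i) (γ i)) • xmon q (β + γ) := by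
  by_cases hβ : IsExpo β
  swap
  · rw [xmon_eq_zero q hβ, xmon_eq_zero q fun h => hβ h.of_add_left, zero_mul, smul_zero]
  by_cases hγ : IsExpo γ
  swap
  · rw [xmon_eq_zero q hγ, xmon_eq_zero q fun h => hγ h.of_add_right, mul_zero, smul_zero]
  obtain ⟨x, rfl⟩ : ∃ x, expo x = β := ⟨_, expo_ofExpo hβ⟩
  obtain ⟨y, rfl⟩ : ∃ y, expo y = γ := ⟨_, expo_ofExpo hγ⟩
  rw [xmon_expo, xmon_expo, mon_mul_mon]
  by_cases hd : Disjoint x.2 y.2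
  · have e : expo x + expo y = expo ((grassmannTable q m n).op x y) := by
      funext i
      induction i using Fin.addCases with
      | left a => simp [expo, grassmannTable, divPowTable]
      | right b => simp [expo, grassmannTable, extTable, ind_union hd]
    rw [e, xmon_expo, bichar_expo]
    congr 1
    simp [grassmannTable, divPowTable, extTable, hd, Fin.prod_univ_add, siteBinom, expo]
    ring
  · obtain ⟨b, hb, hb'⟩ := Finset.not_disjoint_iff.1 hd
    rw [xmon_eq_zero' q (Fin.natAdd m b) (by simp) (by simp [expo, ind, hb, hb']), smul_zero,
      show (grassmannTable q m n).c x y = 0 by simp [grassmannTable, extTable, hd], zero_smul]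

end Exponents

/-! ### Raising, lowering and diagonal operators -/

section SiteOperators
variable {m n : ℕ} {k : Type*} [Field k] (q : kˣ)
open MonomialAlgebra

/-- The coefficient with which the raising operator at the index `i` acts on the exponent `b`. -/
def upCoeff (i : Fin (m + n)) (b : ℕ) : k :=
  if i.1 < m then qNum q (b + 1) else if b = 0 then 1 else 0

/-- The coefficient with which the lowering operator at the index `i` acts on the exponent `b`. -/
def downCoeff (k : Type*) [Field k] (i : Fin (m + n)) (b : ℕ) : k :=
  if i.1 < m then if b = 0 then 0 else 1 else if b = 1 then 1 else 0

/-- The raising operator at the index `i`: left multiplication by `x_i`, rid of the factor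
`∏_{l < i} s_l^(β_l)` that comes from moving `x_i` to its place in `x^β`. -/
noncomputable def raising (i : Fin (m + n)) : Module.End k (Grassmann q m n) :=
  (basis (grassmannTable q m n)).constr k fun x =>
    upCoeff q i (expo x i) • xmon q (expo x + Pi.single i 1)

/-- The lowering operator at the index `i`: `∂_i`, rid of the factor `∏_{l < i} s_l^(-β_l)`. -/
noncomputable def lowering (i : Fin (m + n)) : Module.End k (Grassmann q m n) :=
  (basis (grassmannTable q m n)).constr k fun x =>
    downCoeff k i (expo x i) • xmon q (expo x - Pi.single i 1)

theorem diag_one {G : Type*} (t : MonomialTable k G) : diag t 1 = 1 :=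
  Units.ext <| (basis t).ext fun g => (diag_mon t _ g).trans (by simp [mon])

theorem diag_mul {G : Type*} (t : MonomialTable k G) (f g : G → kˣ) :
    diag t (f * g) = diag t f * diag t g :=
  Units.ext <| (basis t).ext fun x => by
    change (diag t (f * g)).1 (mon t x) = (diag t f).1 ((diag t g).1 (mon t x))
    rw [diag_mon, diag_mon, map_smul, diag_mon, smul_smul, Pi.mul_apply, Units.val_mul, mul_comm]

/-- The diagonal operator that scales `x^β` by `∏_i c_i^(β_i)`. -/
noncomputable def charOp : (Fin (m + n) → kˣ) →* (Module.End k (Grassmann q m n))ˣ where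
  toFun c := diag _ fun x => ∏ i, c i ^ expo x i
  map_one' := by
    rw [← diag_one]
    congr 1
    funext x
    simp
  map_mul' c d := by
    rw [← diag_mul]
    congr 1
    funext x
    simp [mul_pow, Finset.prod_mul_distrib]

theorem charOp_xmon (c : Fin (m + n) → kˣ) (β : Fin (m + n) → ℕ) :
    (charOp q c : Module.End k (Grassmann q m n)) (xmon q β)
      = ((∏ i, c i ^ β i : kˣ) : k) • xmon q β := by
  by_cases hβ : IsExpo β
  · obtain ⟨x, rfl⟩ : ∃ x, expo x = β := ⟨_, expo_ofExpo hβ⟩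
    rw [xmon_expo]
    exact diag_mon _ _ x
  · rw [xmon_eq_zero q hβ, map_zero, smul_zero]

theorem raising_xmon (i : Fin (m + n)) (β : Fin (m + n) → ℕ) :
    raising q i (xmon q β) = upCoeff q i (β i) • xmon q (β + Pi.single i 1) := by
  by_cases hβ : IsExpo β
  · obtain ⟨x, rfl⟩ : ∃ x, expo x = β := ⟨_, expo_ofExpo hβ⟩
    rw [xmon_expo]
    exact Module.Basis.constr_basis _ _ _ _
  · rw [xmon_eq_zero q hβ, xmon_eq_zero q fun h => hβ h.of_add_left, map_zero, smul_zero]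

theorem lowering_xmon (i : Fin (m + n)) (β : Fin (m + n) → ℕ) :
    lowering q i (xmon q β) = downCoeff k i (β i) • xmon q (β - Pi.single i 1) := by
  by_cases hβ : IsExpo β
  · obtain ⟨x, rfl⟩ : ∃ x, expo x = β := ⟨_, expo_ofExpo hβ⟩
    rw [xmon_expo]
    exact Module.Basis.constr_basis _ _ _ _
  · rw [xmon_eq_zero q hβ, map_zero]
    -- an odd exponent greater than `1` is either left unchanged or gets the coefficient `0`
    simp only [IsExpo, not_forall] at hβ
    obtain ⟨l, hl, hl'⟩ := hβ
    by_cases h : l = i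
    · subst h
      rw [downCoeff, if_neg (by omega), if_neg (by omega), zero_smul]
    · rw [xmon_eq_zero' q l (by omega) (by simp [h]; omega), smul_zero]

theorem xmon_add_single_eq_zero {i : Fin (m + n)} (h : ¬ i.1 < m) {β : Fin (m + n) → ℕ}
    (hb : β i ≠ 0) : xmon q (β + Pi.single i 1) = 0 :=
  xmon_eq_zero' q i h (by simp; omega)

theorem genX_eq (i : Fin (m + n)) : genX q m n i = xmon q (Pi.single i 1) := by
  induction i using Fin.addCases with
  | left a =>
    have : expo (Pi.single a 1, ∅) = (Pi.single (Fin.castAdd n a) 1 : Fin (m + n) → ℕ) := by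
      funext i
      induction i using Fin.addCases <;> simp [expo, ind, Pi.single_apply, Fin.ext_iff]
      omega
    rw [← this, xmon_expo, genX, Fin.append_left]
  | right b =>
    have : expo (0, {b}) = (Pi.single (Fin.natAdd m b) 1 : Fin (m + n) → ℕ) := by
      funext i
      induction i using Fin.addCases <;> simp [expo, ind, Pi.single_apply, Fin.ext_iff]
      omega
    rw [← this, xmon_expo, genX, Fin.append_right]

/-- `[b+1, 1] = [b+1]`. -/
theorem qBinom_one_right (v : kˣ) (b : ℕ) : qBinom v (1 + b) 1 = qNum v (b + 1) := by
  rw [add_comm]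
  induction b with
  | zero => simp [qBinom, qNum]
  | succ b ih =>
    rw [qBinom, ih, qBinom_zero_right, add_comm (b + 1) 1, qNum_add v 1 (b + 1)]
    congr 1
    simp [qNum]

/-- `x_i x^β = ∏_{l < i} s_l^(β_l) X_i(x^β)`. -/
theorem mulX_xmon (i : Fin (m + n)) (β : Fin (m + n) → ℕ) : mulX q m n i (xmon q β)
    = ((∏ l ∈ Finset.Iio i, twist q l ^ β l : kˣ) : k) • raising q i (xmon q β) := by
  have hp : ∏ l, siteBinom q l ((Pi.single i 1 : Fin (m + n) → ℕ) l) (β l)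
      = siteBinom q i 1 (β i) := by
    rw [Finset.prod_eq_single i]
    · simp
    · intro l _ hl; simp [siteBinom, hl, qBinom_zero_right]
    · simp
  rw [mulX, LinearMap.mulLeft_apply, genX_eq, xmon_mul, raising_xmon, bichar_single_left, smul_smul,
    add_comm (Pi.single i 1), hp]
  by_cases h : i.1 < m
  · simp [siteBinom, upCoeff, h, qBinom_one_right]
  · by_cases hb : β i = 0
    · simp [siteBinom, upCoeff, h, hb]
    · rw [xmon_add_single_eq_zero q h hb, smul_zero, smul_zero]

theorem prod_Iio_castAdd (f : Fin (m + n) → k) (a : Fin m) :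
    ∏ l ∈ Finset.Iio (Fin.castAdd n a), f l = ∏ l ∈ Finset.Iio a, f (Fin.castAdd n l) := by
  symm
  refine Finset.prod_bij (fun l _ => Fin.castAdd n l) ?_ ?_ ?_ ?_
  · exact fun l hl => Finset.mem_Iio.2 ((Fin.strictMono_castAdd n) (Finset.mem_Iio.1 hl))
  · intro a _ b _ h; simpa using h
  · intro b hb
    have := Fin.lt_def.1 (Finset.mem_Iio.1 hb)
    simp at this
    exact ⟨⟨b, by omega⟩, by simp [Fin.lt_def]; omega, rfl⟩
  · simp

theorem prod_Iio_natAdd (f : Fin (m + n) → k) (b : Fin n) :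
    ∏ l ∈ Finset.Iio (Fin.natAdd m b), f l
      = (∏ a, f (Fin.castAdd n a)) * ∏ l ∈ Finset.Iio b, f (Fin.natAdd m l) := by
  have h : ∀ {r : ℕ} (g : Fin r → k) (i : Fin r), ∏ l ∈ Finset.Iio i, g l
      = ∏ l, if l < i then g l else 1 := fun g i => by
    rw [← Finset.prod_filter]; congr 1; ext; simp
  have hlt' : ∀ (a : Fin m) (b : Fin n), Fin.castAdd n a < Fin.natAdd m b := fun a b => by
    rw [Fin.lt_def]; simp; omega
  rw [h, h, Fin.prod_univ_add]
  simp [hlt']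

/-- `∂_i x^β = ∏_{l < i} s_l^(-β_l) D_i(x^β)`. -/
theorem partialOp_xmon (i : Fin (m + n)) (β : Fin (m + n) → ℕ) : partialOp q m n i (xmon q β)
    = ((∏ l ∈ Finset.Iio i, twist q l ^ β l : kˣ) : k)⁻¹ • lowering q i (xmon q β) := by
  by_cases hβ : IsExpo β
  swap
  · rw [xmon_eq_zero q hβ, map_zero, map_zero, smul_zero]
  obtain ⟨x, rfl⟩ : ∃ x, expo x = β := ⟨_, expo_ofExpo hβ⟩
  rw [lowering_xmon, xmon_expo]
  push_cast
  induction i using Fin.addCases with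
  | left a =>
    rw [partialOp, Fin.append_left, mon, Module.Basis.constr_basis, prod_Iio_castAdd]
    by_cases h : x.1 a = 0
    · simp [downCoeff, expo, h]
    · have e : expo (x.1 - Pi.single a 1, x.2) = expo x - Pi.single (Fin.castAdd n a) 1 := by
        funext i
        induction i using Fin.addCases with
        | left c => simp [expo, Pi.single_apply, Fin.ext_iff]
        | right c =>
          have : m + c.1 ≠ a.1 := by have := a.2; omega
          simp [expo, Fin.ext_iff, this]
      rw [if_neg h, ← xmon_expo, e]
      have e2 : starProd (Pi.single a 1) x.1 = ∑ j ∈ Finset.Iio a, x.1 j := by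
        rw [← starProd_ind_singleton]; congr 1; funext i; simp [ind, Pi.single_apply]
      rw [e2, zpow_neg, zpow_natCast]
      simp [downCoeff, expo, h, twist, Finset.prod_pow_eq_pow_sum]
  | right b =>
    rw [partialOp, Fin.append_right, mon, Module.Basis.constr_basis, prod_Iio_natAdd]
    by_cases h : b ∈ x.2
    · have e : expo (x.1, x.2.erase b) = expo x - Pi.single (Fin.natAdd m b) 1 := by
        funext i
        induction i using Fin.addCases with
        | left c =>
          have : c.1 ≠ m + b.1 := by have := c.2; omega
          simp [expo, Fin.ext_iff, this]
        | right c => by_cases hc : c = b <;> simp [expo, ind, hc, h]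
      rw [if_pos h, ← xmon_expo, e, starProd_ind_singleton, zpow_neg, zpow_neg, zpow_natCast,
        zpow_natCast]
      simp [downCoeff, expo, h, twist, Finset.prod_pow_eq_pow_sum, ind, mul_comm]
    · simp [downCoeff, expo, ind, h]

theorem sigmaOp_eq (i : Fin (m + n)) :
    sigmaOp q m n i = charOp q (Pi.mulSingle i (twist q i)) := by
  have h : ∀ x : (Fin m → ℕ) × Finset (Fin n),
      Fin.append (fun a => q ^ x.1 a) (fun b => (-q) ^ ind x.2 b) i
        = ∏ l, (Pi.mulSingle i (twist q i) : Fin (m + n) → kˣ) l ^ expo x l := fun x => by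
    rw [Finset.prod_eq_single i]
    · induction i using Fin.addCases <;> simp [expo, twist]
    · intro l _ hl; simp [hl]
    · simp
  simp only [sigmaOp, h]
  rfl

theorem tauOp_eq (i : Fin (m + n)) :
    tauOp q m n i = charOp q (Pi.mulSingle i (if i.1 < m then 1 else -1)) := by
  have h : ∀ x : (Fin m → ℕ) × Finset (Fin n),
      (Fin.append (fun _ => 1) (fun b => (-1) ^ ind x.2 b) i : kˣ)
        = ∏ l, (Pi.mulSingle i (if i.1 < m then 1 else -1) : Fin (m + n) → kˣ) l ^ expo x l := by
    intro x
    rw [Finset.prod_eq_single i]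
    · induction i using Fin.addCases <;> simp [expo]
    · intro l _ hl; simp [hl]
    · simp
  simp only [tauOp, h]
  rfl

theorem parityOp_eq :
    parityOp q m n = charOp q fun i => if i.1 < m then 1 else -1 := by
  have h : ∀ x : (Fin m → ℕ) × Finset (Fin n), ((-1) ^ x.2.card : kˣ)
      = ∏ l : Fin (m + n), (if l.1 < m then 1 else -1) ^ expo x l := by
    intro x
    simp [Fin.prod_univ_add, expo, ind]
  simp only [parityOp, h]
  rfl

/-- The scalar `q_i = q^((ε_i, ε_i))`. -/
def qSgn (i : Fin (m + n)) : kˣ := q ^ sgn i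

theorem twist_rgt (j : Fin (m + n - 1)) : twist q (rgt j) = (-1) ^ par j * twist q (lft j) := by
  rcases lt_trichotomy (j.1 + 1) m with h | h | h
  · have h1 : j.1 < m := by omega
    simp [twist, lft, rgt, par, IsOdd, h, h1, h.ne]
  · have h1 : j.1 < m := by omega
    simp [twist, lft, rgt, par, IsOdd, h, h1]
  · have h1 : ¬ j.1 < m := by omega
    have h2 : ¬ j.1 + 1 < m := by omega
    simp [twist, lft, rgt, par, IsOdd, h1, h2, h.ne']

/-- The characters by which the Cartan generators act. -/
def cartanChar : (s : Series) → CartanIdx m n s → Fin (m + n) → kˣ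
  | .gl, i => Pi.mulSingle i (qSgn q i)
  | .sl, j => Pi.mulSingle (lft j) (qSgn q (lft j)) * (Pi.mulSingle (rgt j) (qSgn q (rgt j)))⁻¹

theorem opCartan_gl (i : Fin (m + n)) :
    opCartan q m n .gl i = charOp q (Pi.mulSingle i (qSgn q i)) := by
  simp only [opCartan, sigmaOp_eq, tauOp_eq, ← map_mul, ← map_inv, ← Pi.mulSingle_mul,
    ← Pi.mulSingle_inv]
  by_cases h : i.1 < m <;> simp [h, twist, qSgn, sgn]

theorem opCalK_eq (j : Fin (m + n - 1)) : opCalK q m n j = charOp q (cartanChar q .sl j) := by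
  simp only [opCalK, sigmaOp_eq, tauOp_eq, ← map_mul, ← map_inv, cartanChar, ← apply_ite]
  refine congrArg (charOp q) (funext fun l => ?_)
  have hj : lft j ≠ rgt j := by simp [lft, rgt]
  have hl : (lft j).1 = j.1 := rfl
  have hr : (rgt j).1 = j.1 + 1 := rfl
  rcases lt_trichotomy (j.1 + 1) m with h | h | h
  · have h1 : j.1 < m := by omega
    simp [h, h1, twist, qSgn, sgn, hl, hr]
  · have h1 : j.1 < m := by omega
    by_cases hlr : l = rgt j
    · subst hlr; simp [h, hj.symm, twist, qSgn, sgn, hr]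
    · simp [h, h1, hlr, twist, qSgn, sgn, hl]
  · have h1 : ¬ j.1 < m := by omega
    have h2 : ¬ j.1 + 1 < m := by omega
    by_cases hlr : l = rgt j
    · subst hlr; simp [h2, h.ne', hj.symm, twist, qSgn, sgn, hr]
    · by_cases hll : l = lft j
      · subst hll; simp [h1, h2, h.ne', hj, twist, qSgn, sgn, hl]
      · simp [h2, h.ne', hlr, hll]

theorem opCartan_eq (s : Series) (t : CartanIdx m n s) :
    opCartan q m n s t = charOp q (cartanChar q s t) := by
  cases s
  · exact opCartan_gl q t
  · exact opCalK_eq q t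

end SiteOperators

/-! ### Quantum Serre relations from commuting oscillators -/

section Oscillators
variable {m n : ℕ} {k : Type*} [Field k] (q : kˣ)

/-- The relations satisfied by the families of raising and of lowering operators. They are symmetric
in the two families. -/
structure Oscillators {A : Type*} [Ring A] [Algebra k A] (X D : Fin (m + n) → A) : Prop where
  XX : ∀ i l, Commute (X i) (X l)
  DD : ∀ i l, Commute (D i) (D l)
  XD : ∀ i l, i ≠ l → Commute (X i) (D l)
  serre_XD : ∀ i, i.1 < m → serre q (X i) (D i) = 0
  serre_DX : ∀ i, i.1 < m → serre q (D i) (X i) = 0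
  sq_X : ∀ i, ¬ i.1 < m → X i * X i = 0
  sq_D : ∀ i, ¬ i.1 < m → D i * D i = 0
  XDX : ∀ i, ¬ i.1 < m → X i * D i * X i = X i
  DXD : ∀ i, ¬ i.1 < m → D i * X i * D i = D i

variable {q} {A : Type*} [Ring A] [Algebra k A]

theorem Oscillators.symm {X D : Fin (m + n) → A} (h : Oscillators q X D) : Oscillators q D X where
  XX := h.DD
  DD := h.XX
  XD i l hil := (h.XD l i hil.symm).symm
  serre_XD := h.serre_DX
  serre_DX := h.serre_XD
  sq_X := h.sq_D
  sq_D := h.sq_X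
  XDX := h.DXD
  DXD := h.XDX

/-- For operators `p`, `s`, `t`, `r`, where `s` and `t` share an index and `p`, `r` commute with
everything, a Serre expression is one in the shared index alone. -/
theorem serre_mul_mul {p t s r : A} (hps : Commute p s) (hpt : Commute p t) (hpr : Commute p r)
    (hrt : Commute r t) (hrs : Commute r s) :
    serre q (p * t) (s * r) = p * p * r * serre q t s := by
  have a1 : ∀ x, s * (p * x) = p * (s * x) := fun x => (hps.symm.left_comm x)
  have a2 : ∀ x, t * (p * x) = p * (t * x) := fun x => (hpt.symm.left_comm x)
  have a3 : ∀ x, r * (p * x) = p * (r * x) := fun x => (hpr.symm.left_comm x)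
  have a4 : ∀ x, t * (r * x) = r * (t * x) := fun x => (hrt.symm.left_comm x)
  have a5' : s * r = r * s := hrs.symm
  simp only [serre, mul_add, mul_sub, mul_assoc, mul_smul_comm, a1, a2, a3, a4, a5']

/-- The higher Serre relation for `E_{m-1} = p y`, `E_m = x z`, `E_{m+1} = w t`, where `x`, `y`
belong to the even index `m` and `z`, `w` to the odd index `m + 1`: it reduces to the Serre relation
of `x` and `y`. -/
theorem superSerre_mul_mul {p x y z w t : A} (hpx : Commute p x)
    (hpz : Commute p z) (hpw : Commute p w) (hxz : Commute x z) (hxw : Commute x w)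
    (hyz : Commute y z) (hyw : Commute y w) (htp : Commute t p) (htx : Commute t x)
    (hty : Commute t y) (htz : Commute t z)
    (hxy : serre q x y = 0) (hzz : z * z = 0) (hzwz : z * w * z = z) :
    superSerre q (p * y) (x * z) (w * t) = 0 := by
  have a1 : ∀ v, x * (p * v) = p * (x * v) := fun v => hpx.symm.left_comm v
  have a3 : ∀ v, z * (p * v) = p * (z * v) := fun v => hpz.symm.left_comm v
  have a4 : ∀ v, w * (p * v) = p * (w * v) := fun v => hpw.symm.left_comm v
  have a5 : ∀ v, t * (p * v) = p * (t * v) := fun v => htp.left_comm v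
  have b1 : ∀ v, z * (x * v) = x * (z * v) := fun v => hxz.symm.left_comm v
  have b2 : ∀ v, w * (x * v) = x * (w * v) := fun v => hxw.symm.left_comm v
  have b3 : ∀ v, z * (y * v) = y * (z * v) := fun v => hyz.symm.left_comm v
  have b4 : ∀ v, w * (y * v) = y * (w * v) := fun v => hyw.symm.left_comm v
  have b5 : ∀ v, t * (x * v) = x * (t * v) := fun v => htx.left_comm v
  have b8 : z * y = y * z := hyz.symm
  have c3 : t * z = z * t := htz
  have c4 : t * y = y * t := hty
  have d1 : ∀ v, z * (z * v) = 0 := fun v => by rw [← mul_assoc, hzz, zero_mul]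
  have d2 : ∀ v, z * (w * (z * v)) = z * v := fun v => by
    rw [← mul_assoc w, ← mul_assoc, ← mul_assoc, hzwz]
  have key : superSerre q (p * y) (x * z) (w * t) = p * (serre q x y * (z * t)) := by
    simp only [superSerre, serre, mul_add, add_mul, sub_mul, mul_sub, smul_mul_assoc, mul_assoc,
      mul_smul_comm, a1, a3, a4, a5, b1, b2, b3, b4, b5, b8, c3, c4, d1, d2, mul_zero, add_zero]
    abel
  rw [key, hxy, zero_mul, mul_zero]

/-- The products `X_j D_{j+1}` satisfy the relations among the `E_j`. -/
theorem Oscillators.nilRelations {X D : Fin (m + n) → A} (h : Oscillators q X D) :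
    NilRelations q fun j : Fin (m + n - 1) => X (lft j) * D (rgt j) := by
  have hlr : ∀ i j : Fin (m + n - 1), i.1 ≠ j.1 + 1 → lft i ≠ rgt j := fun i j h e =>
    h (congrArg Fin.val e)
  constructor
  · intro i j hd
    simp only [Distant] at hd
    exact (((h.XX _ _).mul_right (h.XD _ _ (hlr _ _ (by omega)))).mul_left
      ((h.XD _ _ (hlr _ _ (by omega))).symm.mul_right (h.DD _ _))).eq
  · intro i j hd hi
    simp only [IsOdd] at hi
    rcases hd with hd | hd
    · -- `E_i = X_i D_{i+1}` and `E_{i+1} = X_{i+1} D_{i+2}` share the index `i + 1`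
      have e : lft j = rgt i := Fin.ext hd.symm
      have hne : rgt i ≠ rgt j := fun e => by have := congrArg Fin.val e; simp [rgt] at this; omega
      rw [e, serre_mul_mul (h.XX _ _) (h.XD _ _ (hlr _ _ (by omega)))
        (h.XD _ _ (hlr _ _ (by omega))) (h.DD _ _) (h.XD _ _ hne).symm]
      by_cases hm : (rgt i).1 < m
      · rw [h.serre_DX _ hm, mul_zero]
      · have : ¬ (lft i).1 < m := by simp only [rgt, lft] at hm ⊢; omega
        rw [h.sq_X _ this, zero_mul, zero_mul]
    · -- the shared index is `i`, and the lowering operators take the part of the raising ones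
      have e : rgt j = lft i := Fin.ext hd
      have hne : lft j ≠ lft i := fun e => by have := congrArg Fin.val e; simp [lft] at this; omega
      rw [(h.XD (lft i) (rgt i) (hlr _ _ (by omega))).eq, (h.XD _ _ (hlr j j (by omega))).eq, e,
        serre_mul_mul (h.DD _ _) (h.XD _ _ (hlr _ _ (by omega))).symm
        (h.XD _ _ (hlr _ _ (by omega))).symm (h.XX _ _) (h.XD _ _ hne)]
      by_cases hm : (lft i).1 < m
      · rw [h.serre_XD _ hm, mul_zero]
      · have : ¬ (rgt i).1 < m := by simp only [rgt, lft] at hm ⊢; omega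
        rw [h.sq_D _ this, zero_mul, zero_mul]
  · intro i hi
    simp only [IsOdd] at hi
    have hm : ¬ (rgt i).1 < m := by simp only [rgt]; omega
    rw [mul_assoc, ← mul_assoc (D _), (h.XD (lft i) (rgt i) (hlr _ _ (by omega))).symm.eq,
      mul_assoc, h.sq_D _ hm, mul_zero, mul_zero]
  · intro i j l hij hjl hj
    simp only [IsOdd] at hj
    have e1 : rgt i = lft j := Fin.ext hij
    have e2 : rgt j = lft l := Fin.ext hjl
    have h13 : lft i ≠ lft l := fun e => by have := congrArg Fin.val e; simp [lft] at this; omega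
    have h23 : lft j ≠ lft l := fun e => by have := congrArg Fin.val e; simp [lft] at this; omega
    have h14 : lft i ≠ rgt l := hlr _ _ (by omega)
    have h24 : lft j ≠ rgt l := hlr _ _ (by omega)
    have m2 : (lft j).1 < m := by simp only [lft]; omega
    have m3 : ¬ (lft l).1 < m := by simp only [lft]; omega
    rw [e1, e2]
    exact superSerre_mul_mul (h.XX _ _) (h.XD _ _ h13) (h.XX _ _) (h.XD _ _ h23)
      (h.XX _ _) (h.DD _ _) (h.XD _ _ h23.symm).symm (h.XD _ _ h14).symm (h.XD _ _ h24).symm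
      (h.DD _ _) (h.DD _ _) (h.serre_XD _ m2) (h.sq_D _ m3) (h.DXD _ m3)

end Oscillators

/-! ### The raising and lowering operators are oscillators -/

section SiteRelations
variable {m n : ℕ} {k : Type*} [Field k] (q : kˣ)

theorem qNum_zero (v : kˣ) : qNum v 0 = 0 := by simp [qNum]

theorem qNum_one (v : kˣ) : qNum v 1 = 1 := by simp [qNum]

/-- `[b+2] + [b] = [2] [b+1]`. -/
theorem qNum_add_two (v : kˣ) (b : ℕ) : qNum v (b + 2) + qNum v b
    = ((v : k) + ((v⁻¹ : kˣ) : k)) * qNum v (b + 1) := by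
  have h1 := qNum_add v (b + 1) 1
  have h2 := qNum_add v b 1
  rw [show b + 1 + 1 = b + 2 by ring] at h1
  rw [qNum_one] at h1 h2
  have e : ((v ^ ((b + 1 : ℕ) : ℤ) : kˣ) : k) = (v : k) * ((v ^ (b : ℤ) : kˣ) : k) := by
    rw [zpow_natCast, zpow_natCast]; push_cast; ring
  rw [e] at h1
  have hv : (v : k) * ((v⁻¹ : kˣ) : k) = 1 := by simp
  simp only [Nat.cast_one, zpow_neg, zpow_one, mul_one] at h1 h2
  linear_combination h1 - (v : k) * h2 - hv * qNum v b

theorem exists_add_single {i : Fin (m + n)} {β : Fin (m + n) → ℕ} (h : β i ≠ 0) :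
    ∃ γ : Fin (m + n) → ℕ, β = γ + Pi.single i 1 := by
  refine ⟨β - Pi.single i 1, (tsub_add_cancel_of_le fun l => ?_).symm⟩
  by_cases hl : l = i
  · subst hl; simp; omega
  · simp [hl]

theorem IsExpo.eq_zero_or_one {i : Fin (m + n)} {β : Fin (m + n) → ℕ} (hβ : IsExpo β)
    (h : ¬ i.1 < m) :
    β i = 0 ∨ β i = 1 := by have := hβ i (not_lt.1 h); omega

theorem oscillators : Oscillators q (raising q (m := m) (n := n)) (lowering q) where
  XX i l := by
    by_cases hil : i = l
    · subst hil; exact Commute.refl _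
    refine xmon_ext q fun β _ => ?_
    simp [raising_xmon, smul_smul, hil, Ne.symm hil, add_right_comm _ (Pi.single l 1), mul_comm]
  DD i l := by
    by_cases hil : i = l
    · subst hil; exact Commute.refl _
    refine xmon_ext q fun β _ => ?_
    simp [lowering_xmon, smul_smul, hil, Ne.symm hil,
      tsub_right_comm (b := Pi.single l 1), mul_comm]
  XD i l hil := by
    refine xmon_ext q fun β _ => ?_
    have : β - Pi.single l 1 + Pi.single i 1 = β + Pi.single i 1 - Pi.single l 1 := by
      funext r
      by_cases hr : r = l
      · subst hr; simp [hil.symm]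
      · simp [hr]
    simp [lowering_xmon, raising_xmon, smul_smul, hil, hil.symm, this, mul_comm]
  serre_XD i hi := by
    refine xmon_ext q fun β _ => ?_
    by_cases hb : β i = 0
    · have h2 := qNum_add_two q 0
      rw [qNum_zero, zero_add, zero_add, qNum_one, add_zero, mul_one] at h2
      simp [serre, raising_xmon, lowering_xmon, upCoeff, downCoeff, hi, hb, qNum_one, h2]
    · obtain ⟨γ, rfl⟩ := exists_add_single hb
      have h2 := qNum_add_two q (γ i + 1)
      simp only [serre, LinearMap.add_apply, LinearMap.sub_apply, LinearMap.smul_apply,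
        Module.End.mul_apply, raising_xmon, lowering_xmon, map_smul, smul_smul,
        add_tsub_cancel_right, LinearMap.zero_apply, ← add_smul, ← sub_smul]
      refine (congrArg (· • _) ?_).trans (zero_smul k _)
      simp only [Units.val_inv_eq_inv_val] at h2
      simp [upCoeff, downCoeff, hi]
      linear_combination qNum q (γ i + 1 + 1) * h2
  serre_DX i hi := by
    refine xmon_ext q fun β _ => ?_
    by_cases hb : β i = 0
    · simp [serre, raising_xmon, lowering_xmon, upCoeff, downCoeff, hi, hb]
    · obtain ⟨γ, rfl⟩ := exists_add_single hb
      have h2 := qNum_add_two q (γ i)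
      by_cases hc : γ i = 0
      · rw [hc, qNum_zero, zero_add, qNum_one, add_zero, mul_one] at h2
        simp [serre, raising_xmon, lowering_xmon, upCoeff, downCoeff, hi, hc, qNum_one, h2]
      · obtain ⟨δ, rfl⟩ := exists_add_single hc
        simp only [serre, LinearMap.add_apply, LinearMap.sub_apply, LinearMap.smul_apply,
          Module.End.mul_apply, raising_xmon, lowering_xmon, map_smul, smul_smul,
          add_tsub_cancel_right, LinearMap.zero_apply, ← add_smul, ← sub_smul]
        refine (congrArg (· • _) ?_).trans (zero_smul k _)
        simp [upCoeff, downCoeff, hi] at h2 ⊢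
        linear_combination h2
  sq_X i hi := by
    refine xmon_ext q fun β hβ => ?_
    rcases IsExpo.eq_zero_or_one hβ hi with h | h <;> simp [raising_xmon, upCoeff, hi, h]
  sq_D i hi := by
    refine xmon_ext q fun β hβ => ?_
    rcases IsExpo.eq_zero_or_one hβ hi with h | h <;> simp [lowering_xmon, downCoeff, hi, h]
  XDX i hi := by
    refine xmon_ext q fun β hβ => ?_
    rcases IsExpo.eq_zero_or_one hβ hi with h | h <;>
      simp [raising_xmon, lowering_xmon, upCoeff, downCoeff, hi, h]
  DXD i hi := by
    refine xmon_ext q fun β hβ => ?_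
    rcases IsExpo.eq_zero_or_one hβ hi with h | h <;>
      simp [raising_xmon, lowering_xmon, upCoeff, downCoeff, hi, h]

/-- Splits off the last factor `s_j^(β_j)` of the one belonging to `j + 1`. -/
theorem prod_Iio_rgt (j : Fin (m + n - 1)) (β : Fin (m + n) → ℕ) :
    ∏ l ∈ Finset.Iio (rgt j), twist q l ^ β l
      = twist q (lft j) ^ β (lft j) * ∏ l ∈ Finset.Iio (lft j), twist q l ^ β l := by
  have : Finset.Iio (rgt j) = insert (lft j) (Finset.Iio (lft j)) := by
    ext l
    simp only [Finset.mem_Iio, Finset.mem_insert, Fin.lt_def, Fin.ext_iff, lft, rgt]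
    omega
  rw [this, Finset.prod_insert (by simp)]

/-- `x_j ∂_{j+1} σ_j`: the factors from moving `x_j` and `x_{j+1}` to their places and the one from
`σ_j` cancel. -/
theorem opE_eq (j : Fin (m + n - 1)) : opE q m n j = raising q (lft j) * lowering q (rgt j) := by
  refine xmon_ext q fun β _ => ?_
  have e : ∏ l ∈ Finset.Iio (lft j), twist q l ^ (β - Pi.single (rgt j) 1 : Fin (m + n) → ℕ) l
      = ∏ l ∈ Finset.Iio (lft j), twist q l ^ β l := Finset.prod_congr rfl fun l hl => by
    have : l ≠ rgt j := by
      rintro rfl; have := Fin.lt_def.1 (Finset.mem_Iio.1 hl); simp [lft, rgt] at this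
    simp [this]
  have e' : ∏ i, (Pi.mulSingle (lft j) (twist q (lft j)) : Fin (m + n) → kˣ) i ^ β i
      = twist q (lft j) ^ β (lft j) := by
    rw [Finset.prod_eq_single (lft j)] <;> simp +contextual
  rw [opE, sigmaOp_eq, Module.End.mul_apply, Module.End.mul_apply, Module.End.mul_apply,
    charOp_xmon, map_smul, partialOp_xmon, lowering_xmon, prod_Iio_rgt, e']
  simp only [map_smul, mulX_xmon, e, smul_smul]
  congr 1
  set a := twist q (lft j) ^ β (lft j)
  set b := ∏ l ∈ Finset.Iio (lft j), twist q l ^ β l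
  push_cast
  field_simp

/-- `σ_j⁻¹ x_{j+1} ∂_j`: the factors cancel as for `E_j`. -/
theorem opF_eq (j : Fin (m + n - 1)) : opF q m n j = raising q (rgt j) * lowering q (lft j) := by
  refine xmon_ext q fun β _ => ?_
  have hlr : lft j ≠ rgt j := by simp [lft, rgt]
  by_cases hb : β (lft j) = 0
  · simp [opF, partialOp_xmon, lowering_xmon, downCoeff, hb]
  obtain ⟨γ, rfl⟩ := exists_add_single hb
  have e : ∏ l ∈ Finset.Iio (lft j), twist q l ^ (γ + Pi.single (lft j) 1 : Fin (m + n) → ℕ) l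
      = ∏ l ∈ Finset.Iio (lft j), twist q l ^ γ l := Finset.prod_congr rfl fun l hl => by
    have : l ≠ lft j := (Finset.mem_Iio.1 hl).ne
    simp [this]
  have e' : ∏ i, (Pi.mulSingle (lft j) (twist q (lft j)) : Fin (m + n) → kˣ)⁻¹ i
        ^ (γ + Pi.single (rgt j) 1 : Fin (m + n) → ℕ) i
      = (twist q (lft j) ^ γ (lft j))⁻¹ := by
    rw [Finset.prod_eq_single (lft j)] <;> simp +contextual [hlr]
  rw [opF, sigmaOp_eq, ← map_inv, Module.End.mul_apply, Module.End.mul_apply, Module.End.mul_apply,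
    partialOp_xmon, lowering_xmon, map_smul, map_smul, map_smul,
    add_tsub_cancel_right, mulX_xmon,
    raising_xmon]
  simp only [map_smul, charOp_xmon, e, e', smul_smul, prod_Iio_rgt, raising_xmon]
  congr 1
  set a := twist q (lft j) ^ γ (lft j)
  set b := ∏ l ∈ Finset.Iio (lft j), twist q l ^ γ l
  push_cast
  field_simp

theorem charOp_raising (c : Fin (m + n) → kˣ) (i : Fin (m + n)) :
    (charOp q c : Module.End k (Grassmann q m n)) * raising q i
      = (c i : k) • (raising q i * (charOp q c : Module.End k (Grassmann q m n))) := by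
  refine xmon_ext q fun β _ => ?_
  have e : ∏ l, c l ^ (β + Pi.single i 1 : Fin (m + n) → ℕ) l = c i * ∏ l, c l ^ β l := by
    simp only [Pi.add_apply, pow_add, Finset.prod_mul_distrib]
    rw [mul_comm, Finset.prod_eq_single (s := Finset.univ) (a := i)] <;> simp +contextual
  simp only [Module.End.mul_apply, LinearMap.smul_apply, charOp_xmon, raising_xmon, map_smul, e,
    smul_smul, Units.val_mul]
  congr 1
  ring

theorem charOp_lowering (c : Fin (m + n) → kˣ) (i : Fin (m + n)) :
    (charOp q c : Module.End k (Grassmann q m n)) * lowering q i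
      = (((c i)⁻¹ : kˣ) : k) • (lowering q i * (charOp q c : Module.End k (Grassmann q m n))) := by
  refine xmon_ext q fun β _ => ?_
  by_cases hb : β i = 0
  · simp [lowering_xmon, charOp_xmon, downCoeff, hb]
  obtain ⟨γ, rfl⟩ := exists_add_single hb
  have e : ∏ l, c l ^ (γ + Pi.single i 1 : Fin (m + n) → ℕ) l = c i * ∏ l, c l ^ γ l := by
    simp only [Pi.add_apply, pow_add, Finset.prod_mul_distrib]
    rw [mul_comm, Finset.prod_eq_single (s := Finset.univ) (a := i)] <;> simp +contextual
  simp only [Module.End.mul_apply, LinearMap.smul_apply, charOp_xmon, lowering_xmon, map_smul, e,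
    smul_smul, Units.val_mul, add_tsub_cancel_right]
  congr 1
  have := (c i).ne_zero
  rw [Units.val_inv_eq_inv_val]
  field_simp

end SiteRelations

/-! ### Twisted Leibniz rules -/

section Multiplicativity
variable {m n : ℕ} {k : Type*} [Field k] (q : kˣ)

theorem xmon_ext₂ {V : Type*} [AddCommGroup V] [Module k V]
    {f g : Grassmann q m n →ₗ[k] Grassmann q m n →ₗ[k] V}
    (h : ∀ β γ, IsExpo β → IsExpo γ → f (xmon q β) (xmon q γ) = g (xmon q β) (xmon q γ)) :
    f = g := xmon_ext q fun β hβ => xmon_ext q fun γ hγ => h β γ hβ hγ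

theorem charOp_mul (c : Fin (m + n) → kˣ) (a b : Grassmann q m n) :
    (charOp q c : Module.End k (Grassmann q m n)) (a * b)
      = (charOp q c : Module.End k (Grassmann q m n)) a
        * (charOp q c : Module.End k (Grassmann q m n)) b := by
  have : (LinearMap.mul k (Grassmann q m n)).compr₂ (charOp q c).1
      = (LinearMap.mul k (Grassmann q m n)).compl₁₂ (charOp q c).1 (charOp q c).1 := by
    refine xmon_ext₂ q fun β γ _ _ => ?_
    change (charOp q c).1 (xmon q β * xmon q γ)
      = (charOp q c).1 (xmon q β) * (charOp q c).1 (xmon q γ)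
    simp only [charOp_xmon, xmon_mul, map_smul, smul_mul_smul_comm, smul_smul, Pi.add_apply,
      pow_add, Finset.prod_mul_distrib, Units.val_mul]
    congr 1
    ring
  exact congrArg (fun f => f a b) this

theorem charOp_one (c : Fin (m + n) → kˣ) :
    (charOp q c : Module.End k (Grassmann q m n)) 1 = 1 := by
  rw [← xmon_zero, charOp_xmon]; simp

/-- The character that is `f` before the index `i`, `a` at `i`, and constantly `g` after `i`. -/
def stepChar (f : Fin (m + n) → kˣ) (a g : kˣ) (i : Fin (m + n)) : Fin (m + n) → kˣ :=
  fun l => if l < i then f l else if l = i then a else g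

theorem prod_stepChar (f : Fin (m + n) → kˣ) (a g : kˣ) (i : Fin (m + n))
    (β : Fin (m + n) → ℕ) : ∏ l, stepChar f a g i l ^ β l
      = (∏ l ∈ Finset.Iio i, f l ^ β l) * a ^ β i * ∏ l ∈ Finset.Ioi i, g ^ β l := by
  have hu : (Finset.univ : Finset (Fin (m + n))) = Finset.Iio i ∪ insert i (Finset.Ioi i) := by
    ext l; simpa using lt_or_ge l i
  have hd : Disjoint (Finset.Iio i) (insert i (Finset.Ioi i)) := by
    rw [Finset.disjoint_left]; intro l h h'
    rcases Finset.mem_insert.1 h' with rfl | h'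
    · exact lt_irrefl _ (Finset.mem_Iio.1 h)
    · exact lt_asymm (Finset.mem_Iio.1 h) (Finset.mem_Ioi.1 h')
  rw [hu, Finset.prod_union hd, Finset.prod_insert (by simp), ← mul_assoc]
  congr 1
  · congr 1
    · exact Finset.prod_congr rfl fun l hl => by simp [stepChar, Finset.mem_Iio.1 hl]
    · simp [stepChar]
  · refine Finset.prod_congr rfl fun l hl => ?_
    have := Finset.mem_Ioi.1 hl
    simp [stepChar, this.not_gt, this.ne']

theorem siteBinom_zero_left (i : Fin (m + n)) (c : ℕ) : siteBinom q i 0 c = 1 := by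
  simp [siteBinom, qBinom_zero_right]

theorem siteBinom_zero_right (i : Fin (m + n)) (b : ℕ) : siteBinom q i b 0 = 1 := by
  simp [siteBinom, qBinom_self]

theorem prod_siteBinom (i : Fin (m + n)) (β γ : Fin (m + n) → ℕ) :
    (∏ l, siteBinom q l (β l) (γ l) : k) = siteBinom q i (β i) (γ i)
      * ∏ l ∈ Finset.univ.erase i, siteBinom q l (β l) (γ l) :=
  (Finset.mul_prod_erase _ _ (Finset.mem_univ i)).symm

theorem prod_erase_siteBinom_add_left (i : Fin (m + n)) (β γ : Fin (m + n) → ℕ) :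
    (∏ l ∈ Finset.univ.erase i, siteBinom q l ((β + Pi.single i 1 : Fin (m + n) → ℕ) l) (γ l) : k)
      = ∏ l ∈ Finset.univ.erase i, siteBinom q l (β l) (γ l) :=
  Finset.prod_congr rfl fun l hl => by simp [(Finset.mem_erase.1 hl).1]

theorem prod_erase_siteBinom_add_right (i : Fin (m + n)) (β γ : Fin (m + n) → ℕ) :
    (∏ l ∈ Finset.univ.erase i, siteBinom q l (β l) ((γ + Pi.single i 1 : Fin (m + n) → ℕ) l) : k)
      = ∏ l ∈ Finset.univ.erase i, siteBinom q l (β l) (γ l) :=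
  Finset.prod_congr rfl fun l hl => by simp [(Finset.mem_erase.1 hl).1]

/-- `[a+1] [a+b+1, a+1] = [a+b+1] [a+b, a]`. -/
theorem qNum_mul_qBinom_succ_left (a b : ℕ) :
    qNum q (a + b + 1) * qBinom q (a + b) a = qNum q (a + 1) * qBinom q (a + 1 + b) (a + 1) := by
  have h1 := qBinom_assoc q 1 a b
  rw [qBinom_one_right, qBinom_one_right, add_comm 1 a] at h1
  rw [mul_comm (qNum q (a + b + 1)), ← h1]

/-- `[b+1] [a+b+1, a] = [a+b+1] [a+b, a]`. -/
theorem qNum_mul_qBinom_succ_right (a b : ℕ) :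
    qNum q (a + b + 1) * qBinom q (a + b) a = qNum q (b + 1) * qBinom q (a + (b + 1)) a := by
  have h1 := qBinom_assoc q a b 1
  have e : ∀ c, qBinom q (c + 1) c = qNum q (c + 1) := fun c => by
    induction c with
    | zero => simp [qBinom, qNum]
    | succ c ih =>
      rw [qBinom, qBinom_self, ih, qNum_add q (c + 1) 1, qNum_one]
      simp
  rw [e, e] at h1
  rw [mul_comm, h1]

/-- `X_i` as a skew derivation that acts on the left factor. At an odd index `X_i(x^β x^γ)` vanishes
unless `β_i = γ_i = 0`, and the value `a` of the character there is arbitrary. -/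
theorem raising_mul_left (i : Fin (m + n)) (a : kˣ) (ha : i.1 < m → a = 1)
    (x y : Grassmann q m n) : raising q i (x * y) = raising q i x
      * (charOp q (stepChar (fun l => (twist q l)⁻¹) a 1 i) : Module.End k (Grassmann q m n)) y := by
  have : (LinearMap.mul k (Grassmann q m n)).compr₂ (raising q i)
      = (LinearMap.mul k (Grassmann q m n)).compl₁₂ (raising q i)
        (charOp q (stepChar (fun l => (twist q l)⁻¹) a 1 i)).1 := by
    refine xmon_ext₂ q fun β γ hβ hγ => ?_
    change raising q i (xmon q β * xmon q γ) = raising q i (xmon q β) * (charOp q _).1 (xmon q γ)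
    rw [charOp_xmon, xmon_mul, map_smul, raising_xmon, raising_xmon, smul_mul_smul_comm, xmon_mul,
      smul_smul, smul_smul, add_right_comm, bichar_add_left, bichar_single_left, prod_stepChar,
      prod_siteBinom q i,
      prod_siteBinom q i, prod_erase_siteBinom_add_left, Pi.add_apply, Pi.add_apply,
      Pi.single_eq_same]
    by_cases hz : i.1 < m ∨ (β i = 0 ∧ γ i = 0)
    · congr 1
      simp only [inv_pow, Finset.prod_inv_distrib]
      set w := ∏ l ∈ Finset.Iio i, twist q l ^ γ l
      have hs : upCoeff q i (β i + γ i) * siteBinom q i (β i) (γ i) * 1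
          = upCoeff q i (β i) * siteBinom q i (β i + 1) (γ i) * ((a ^ γ i : kˣ) : k) := by
        rcases hz with h | ⟨h1, h2⟩
        · simp [upCoeff, siteBinom, h, ha h, qNum_mul_qBinom_succ_left]
        · by_cases h : i.1 < m
          · simp [upCoeff, siteBinom, h, ha h, h1, h2, qNum_one, qBinom_self]
          · simp [upCoeff, siteBinom, h, h1, h2]
      push_cast at hs ⊢
      simp only [one_pow, Finset.prod_const_one]
      field_simp
      linear_combination (∏ l ∈ Finset.univ.erase i, siteBinom q l (β l) (γ l)) * hs
    · rw [not_or] at hz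
      rw [xmon_eq_zero' q i hz.1 (by simp; omega), smul_zero, smul_zero]
  exact congrArg (fun f => f x y) this

/-- `X_i` as a skew derivation that acts on the right factor. -/
theorem raising_mul_right (i : Fin (m + n)) (a : kˣ) (ha : i.1 < m → a = 1)
    (x y : Grassmann q m n) : raising q i (x * y)
      = (charOp q (stepChar 1 a (twist q i)⁻¹ i) : Module.End k (Grassmann q m n)) x
        * raising q i y := by
  have : (LinearMap.mul k (Grassmann q m n)).compr₂ (raising q i)
      = (LinearMap.mul k (Grassmann q m n)).compl₁₂
        (charOp q (stepChar 1 a (twist q i)⁻¹ i)).1 (raising q i) := by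
    refine xmon_ext₂ q fun β γ hβ hγ => ?_
    change raising q i (xmon q β * xmon q γ) = (charOp q _).1 (xmon q β) * raising q i (xmon q γ)
    rw [charOp_xmon, xmon_mul, map_smul, raising_xmon, raising_xmon, smul_mul_smul_comm, xmon_mul,
      smul_smul, smul_smul, ← add_assoc, bichar_add_right, bichar_single_right, prod_stepChar,
      prod_siteBinom q i,
      prod_siteBinom q i, prod_erase_siteBinom_add_right, Pi.add_apply, Pi.add_apply,
      Pi.single_eq_same]
    by_cases hz : i.1 < m ∨ (β i = 0 ∧ γ i = 0)
    · congr 1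
      simp only [inv_pow, Finset.prod_inv_distrib, Pi.one_apply, one_pow, Finset.prod_const_one]
      set w := ∏ l ∈ Finset.Ioi i, twist q i ^ β l
      have hs : upCoeff q i (β i + γ i) * siteBinom q i (β i) (γ i) * 1
          = upCoeff q i (γ i) * siteBinom q i (β i) (γ i + 1) * ((a ^ β i : kˣ) : k) := by
        rcases hz with h | ⟨h1, h2⟩
        · simp [upCoeff, siteBinom, h, ha h, qNum_mul_qBinom_succ_right]
        · by_cases h : i.1 < m
          · simp [upCoeff, siteBinom, h, ha h, h1, h2, qNum_one, qBinom_self, qBinom_zero_right]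
          · simp [upCoeff, siteBinom, h, h1, h2]
      push_cast at hs ⊢
      field_simp
      linear_combination (∏ l ∈ Finset.univ.erase i, siteBinom q l (β l) (γ l)) * hs
    · rw [not_or] at hz
      rw [xmon_eq_zero' q i hz.1 (by simp; omega), smul_zero, smul_zero]
  exact congrArg (fun f => f x y) this

/-- The `q`-Pascal rule in its two forms. -/
theorem qBinom_pascal {t t' : kˣ} (h : t = q⁻¹ ∧ t' = q ∨ t = q ∧ t' = q⁻¹) (b c : ℕ) :
    qBinom q (b + 1 + (c + 1)) (b + 1) = qBinom q (b + (c + 1)) b * ((t ^ (c + 1) : kˣ) : k)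
      + qBinom q (b + 1 + c) (b + 1) * ((t' ^ (b + 1) : kˣ) : k) := by
  have h1 : qBinom q (b + 1 + (c + 1)) (b + 1)
      = ((q ^ (-((c + 1 : ℕ) : ℤ)) : kˣ) : k) * qBinom q (b + (c + 1)) b
        + ((q ^ ((b + 1 : ℕ) : ℤ) : kˣ) : k) * qBinom q (b + 1 + c) (b + 1) := by
    rw [show b + 1 + (c + 1) = (b + 1 + c) + 1 by ring, qBinom]
    rw [show b + 1 + c = b + (c + 1) by ring]
    congr 5
    push_cast
    ring
  have h2 := (qNum_mul_qBinom_succ_left q b c).symm.trans (qNum_mul_qBinom_succ_right q b c)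
  have h3 := qNum_mul q (b + 1)
  have h4 := qNum_mul q (c + 1)
  simp only [zpow_neg, zpow_natCast] at h1 h3 h4
  rcases h with ⟨rfl, rfl⟩ | ⟨rfl, rfl⟩
  · rw [h1, inv_pow]
    ring
  · rw [h1, inv_pow]
    linear_combination ((t : k) - ((t⁻¹ : kˣ) : k)) * h2 - qBinom t (b + 1 + c) (b + 1) * h3
      + qBinom t (b + (c + 1)) b * h4

/-- The skew Leibniz rule of `D_i`. At an even index it is the `q`-Pascal rule, with either choice
of the sign of the exponents. At an odd index only `β_i + γ_i = 1` and the vanishing for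
`β_i = γ_i = 1` matter, which leaves one of the values `t`, `t'` free. -/
theorem lowering_mul (i : Fin (m + n)) (t t' : kˣ)
    (ht : i.1 < m → t = q⁻¹ ∧ t' = q ∨ t = q ∧ t' = q⁻¹) (ht' : ¬ i.1 < m → t = -t')
    (x y : Grassmann q m n) : lowering q i (x * y)
      = lowering q i x * (charOp q (stepChar (twist q) t 1 i) : Module.End k (Grassmann q m n)) y
        + (charOp q (stepChar 1 t' (twist q i) i) : Module.End k (Grassmann q m n)) x
          * lowering q i y := by
  have : (LinearMap.mul k (Grassmann q m n)).compr₂ (lowering q i)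
      = (LinearMap.mul k (Grassmann q m n)).compl₁₂ (lowering q i)
          (charOp q (stepChar (twist q) t 1 i)).1
        + (LinearMap.mul k (Grassmann q m n)).compl₁₂
          (charOp q (stepChar 1 t' (twist q i) i)).1 (lowering q i) := by
    refine xmon_ext₂ q fun β γ hβ hγ => ?_
    change lowering q i (xmon q β * xmon q γ) = lowering q i (xmon q β) * (charOp q _).1 (xmon q γ)
      + (charOp q _).1 (xmon q β) * lowering q i (xmon q γ)
    rw [charOp_xmon, charOp_xmon, xmon_mul, map_smul, lowering_xmon, lowering_xmon, lowering_xmon,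
      smul_mul_smul_comm, smul_mul_smul_comm, prod_stepChar, prod_stepChar, Pi.add_apply]
    simp only [Pi.one_apply, one_pow, Finset.prod_const_one, mul_one, one_mul]
    by_cases hb : β i = 0 <;> by_cases hc : γ i = 0
    · simp [hb, hc, downCoeff]
    · obtain ⟨γ, rfl⟩ := exists_add_single hc
      rw [hb, ← add_assoc, add_tsub_cancel_right, add_tsub_cancel_right, xmon_mul,
        xmon_mul, bichar_add_right,
        bichar_single_right, prod_siteBinom q i β (γ + Pi.single i 1), prod_siteBinom q i β γ, hb,
        prod_erase_siteBinom_add_right, siteBinom_zero_left, siteBinom_zero_left]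
      simp [downCoeff, smul_smul]
      split_ifs <;> ring_nf
    · obtain ⟨β, rfl⟩ := exists_add_single hb
      rw [hc, add_right_comm, add_tsub_cancel_right, add_tsub_cancel_right, xmon_mul,
        xmon_mul, bichar_add_left,
        bichar_single_left, prod_siteBinom q i, prod_siteBinom q i, hc,
        prod_erase_siteBinom_add_left, siteBinom_zero_right, siteBinom_zero_right]
      simp [downCoeff, smul_smul]
      split_ifs <;> ring_nf
    · obtain ⟨β, rfl⟩ := exists_add_single hb
      obtain ⟨γ, rfl⟩ := exists_add_single hc
      have e1 := bichar_add_left q β (Pi.single i 1) (γ + Pi.single i 1)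
      have e2 := bichar_add_right q (β + Pi.single i 1) γ (Pi.single i 1)
      rw [bichar_single_left] at e1
      rw [bichar_single_right] at e2
      rw [← add_assoc, add_tsub_cancel_right, add_tsub_cancel_right, add_tsub_cancel_right, xmon_mul,
        xmon_mul, add_right_comm β, ← add_assoc, smul_smul, smul_smul, smul_smul, ← add_smul]
      by_cases hz : i.1 < m ∨ (β i = 0 ∧ γ i = 0)
      · congr 1
        rw [prod_siteBinom q i, prod_siteBinom q i, prod_siteBinom q i,
          prod_erase_siteBinom_add_left, prod_erase_siteBinom_add_left,
          prod_erase_siteBinom_add_right]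
        have hs : (siteBinom q i (β i + 1) (γ i + 1) * downCoeff k i (β i + 1 + (γ i + 1)) : k)
            = downCoeff k i (β i + 1) * siteBinom q i (β i) (γ i + 1) * ((t ^ (γ i + 1) : kˣ) : k)
              + downCoeff k i (γ i + 1) * siteBinom q i (β i + 1) (γ i)
                * ((t' ^ (β i + 1) : kˣ) : k) := by
          rcases lt_or_ge i.1 m with h | h
          · simpa [siteBinom, downCoeff, h] using qBinom_pascal q (ht h) (β i) (γ i)
          · obtain ⟨h1, h2⟩ := hz.resolve_left h.not_gt
            simp [siteBinom, downCoeff, h.not_gt, h1, h2, ht' h.not_gt]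
        have e1' := congrArg (Units.val (α := k)) e1
        have e2' := congrArg (Units.val (α := k)) e2
        simp only [Pi.add_apply _ _ i, Pi.single_eq_same, Units.val_mul] at hs e1' e2' ⊢
        set R : k := ∏ l ∈ Finset.univ.erase i, siteBinom q l (β l) (γ l)
        linear_combination ((bichar q (β + Pi.single i 1) (γ + Pi.single i 1) : kˣ) : k) * R * hs
          + downCoeff k i (β i + 1) * ((t ^ (γ i + 1) : kˣ) : k) * siteBinom q i (β i) (γ i + 1)
            * R * e1'
          + downCoeff k i (γ i + 1) * ((t' ^ (β i + 1) : kˣ) : k) * siteBinom q i (β i + 1) (γ i)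
            * R * e2'
      · rw [not_or] at hz
        rw [xmon_eq_zero' q i hz.1 (by simp; omega), smul_zero, smul_zero]
  exact congrArg (fun f => f x y) this

end Multiplicativity

/-! ### The operators of the generators satisfy the relations -/

section ActionOfGenerators
variable {m n : ℕ} {k : Type*} [Field k] (q : kˣ)

/-- The character by which the parity automorphism acts. -/
def parityChar (m n : ℕ) : Fin (m + n) → kˣ := fun i => if i.1 < m then 1 else -1

/-- The operators by which the generators act on `Ω_q(m|n)`. -/
noncomputable def opGen (s : Series) : Gen m n s → Module.End k (Grassmann q m n)
  | .E j => opE q m n j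
  | .F j => opF q m n j
  | .K t => charOp q (cartanChar q s t)
  | .Kinv t => charOp q (cartanChar q s t)⁻¹
  | .sig => charOp q (parityChar m n)

theorem wordK_opGen (s : Series) (j : Fin (m + n - 1)) :
    wordK s (opGen q s) j = charOp q (cartanChar q .sl j) := by
  cases s
  · simp only [wordK, opGen, cartanChar, map_mul, map_inv, Units.val_mul]
  · rfl

theorem wordKinv_opGen (s : Series) (j : Fin (m + n - 1)) :
    wordKinv s (opGen q s) j = charOp q (cartanChar q .sl j)⁻¹ := by
  cases s
  · simp only [wordKinv, opGen, cartanChar, map_mul, map_inv, mul_inv, inv_inv, Units.val_mul]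
  · rfl

theorem sigma_pow_opGen (s : Series) (j : Fin (m + n - 1)) :
    opGen (m := m) (n := n) q s .sig ^ par j = charOp q (parityChar m n ^ par j) := by
  simp only [opGen, map_pow, Units.val_pow_eq_pow_val]

theorem lft_lt_rgt (j : Fin (m + n - 1)) : lft j < rgt j := by simp [Fin.lt_def, lft, rgt]

theorem trichotomy_lft_rgt (j : Fin (m + n - 1)) (l : Fin (m + n)) :
    l < lft j ∨ l = lft j ∨ l = rgt j ∨ rgt j < l := by
  simp only [Fin.lt_def, Fin.ext_iff, lft, rgt]; omega

theorem twist_even {i : Fin (m + n)} (h : i.1 < m) : twist q i = q := if_pos h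

theorem twist_odd {i : Fin (m + n)} (h : ¬ i.1 < m) : twist q i = -q := if_neg h

theorem qSgn_even {i : Fin (m + n)} (h : i.1 < m) : qSgn q i = q := by simp [qSgn, sgn, h]

theorem qSgn_odd {i : Fin (m + n)} (h : ¬ i.1 < m) : qSgn q i = q⁻¹ := by simp [qSgn, sgn, h]

/-- The parity changes only from `m` to `m + 1`, so that `τ^(p(j))` changes sign right after `j`. -/
theorem parityChar_pow_par (j : Fin (m + n - 1)) (l : Fin (m + n)) :
    (parityChar m n l : kˣ) ^ par j = if l < rgt j then 1 else (-1) ^ par j := by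
  by_cases h : IsOdd j
  · have : l < rgt j ↔ l.1 < m := by simp only [IsOdd] at h; simp only [Fin.lt_def, rgt]; omega
    simp [par, h, parityChar, this]
  · simp [par, h]

/-- `E_j (xy) = E_j(x) 𝒦_j(y) + τ^(p(j))(x) E_j(y)`. -/
theorem opE_mul (j : Fin (m + n - 1)) (x y : Grassmann q m n) :
    opE q m n j (x * y)
      = opE q m n j x * (charOp q (cartanChar q .sl j) : Module.End k (Grassmann q m n)) y
        + (charOp q (parityChar m n ^ par j) : Module.End k (Grassmann q m n)) x * opE q m n j y := by
  have hlr := lft_lt_rgt j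
  -- the characters of the rules for `D_{j+1}` and `X_j` multiply to those in the coproduct
  have e1 : stepChar (fun l => (twist q l)⁻¹) (qSgn q (lft j) * (twist q (lft j))⁻¹) 1 (lft j)
      * stepChar (twist q) (qSgn q (rgt j))⁻¹ 1 (rgt j) = cartanChar q .sl j := by
    funext l
    rcases trichotomy_lft_rgt j l with h | rfl | rfl | h
    · simp [stepChar, cartanChar, h, h.trans hlr, h.ne, (h.trans hlr).ne]
    · simp [stepChar, cartanChar, hlr, hlr.ne]
    · simp [stepChar, cartanChar, hlr.not_gt, hlr.ne']
    · simp [stepChar, cartanChar, h.not_gt, (hlr.trans h).not_gt, h.ne', (hlr.trans h).ne']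
  have e2 : stepChar 1 1 (twist q (lft j))⁻¹ (lft j)
      * stepChar 1 (twist q (rgt j)) (twist q (rgt j)) (rgt j) = parityChar m n ^ par j := by
    funext l
    rw [Pi.pow_apply, parityChar_pow_par, Pi.mul_apply, twist_rgt]
    rcases trichotomy_lft_rgt j l with h | rfl | rfl | h
    · simp [stepChar, h, h.trans hlr]
    · simp [stepChar, hlr]
    · simp [stepChar, hlr.not_gt, hlr.ne']
    · simp [stepChar, h.not_gt, (hlr.trans h).not_gt, h.ne', (hlr.trans h).ne']
  rw [opE_eq, Module.End.mul_apply, lowering_mul q (rgt j) (qSgn q (rgt j))⁻¹ (twist q (rgt j))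
    (fun h => Or.inl ⟨by rw [qSgn_even q h], twist_even q h⟩)
    (fun h => by rw [qSgn_odd q h, twist_odd q h, inv_inv, neg_neg]), map_add,
    raising_mul_left q (lft j) (qSgn q (lft j) * (twist q (lft j))⁻¹)
      (fun h => by rw [qSgn_even q h, twist_even q h, mul_inv_cancel]),
    raising_mul_right q (lft j) 1 fun _ => rfl, ← Module.End.mul_apply,
    ← Module.End.mul_apply (charOp q _).1, ← Module.End.mul_apply (charOp q _).1, ← Units.val_mul,
    ← Units.val_mul, ← map_mul, ← map_mul, e1, e2]
  rfl

/-- `F_j (xy) = F_j(x) y + τ^(p(j)) 𝒦_j⁻¹(x) F_j(y)`. -/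
theorem opF_mul (j : Fin (m + n - 1)) (x y : Grassmann q m n) :
    opF q m n j (x * y)
      = opF q m n j x * y
        + (charOp q (parityChar m n ^ par j * (cartanChar q .sl j)⁻¹) :
            Module.End k (Grassmann q m n)) x * opF q m n j y := by
  have hlr := lft_lt_rgt j
  have e1 : stepChar (fun l => (twist q l)⁻¹) 1 1 (rgt j)
      * stepChar (twist q) (twist q (lft j)) 1 (lft j) = 1 := by
    funext l
    rcases trichotomy_lft_rgt j l with h | rfl | rfl | h
    · simp [stepChar, h, h.trans hlr]
    · simp [stepChar, hlr]
    · simp [stepChar, hlr.not_gt, hlr.ne']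
    · simp [stepChar, h.not_gt, (hlr.trans h).not_gt, h.ne', (hlr.trans h).ne']
  have e2 : stepChar 1 (qSgn q (rgt j) * (twist q (rgt j))⁻¹) (twist q (rgt j))⁻¹ (rgt j)
      * stepChar 1 (qSgn q (lft j))⁻¹ (twist q (lft j)) (lft j)
      = parityChar m n ^ par j * (cartanChar q .sl j)⁻¹ := by
    funext l
    have hp : ((-1 : kˣ) ^ par j)⁻¹ = (-1) ^ par j := by rw [← inv_pow, inv_neg_one]
    rw [Pi.mul_apply, Pi.mul_apply, Pi.pow_apply, parityChar_pow_par, twist_rgt, mul_inv, hp]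
    rcases trichotomy_lft_rgt j l with h | rfl | rfl | h
    · simp [stepChar, cartanChar, h, h.trans hlr, h.ne, (h.trans hlr).ne]
    · simp [stepChar, cartanChar, hlr, hlr.ne]
    · simp [stepChar, cartanChar, hlr.not_gt, hlr.ne', mul_comm, mul_left_comm]
    · simp [stepChar, cartanChar, h.not_gt, (hlr.trans h).not_gt, h.ne', (hlr.trans h).ne']
  rw [opF_eq, Module.End.mul_apply, lowering_mul q (lft j) (twist q (lft j)) (qSgn q (lft j))⁻¹
    (fun h => Or.inr ⟨twist_even q h, by rw [qSgn_even q h]⟩)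
    (fun h => by rw [qSgn_odd q h, twist_odd q h, inv_inv]), map_add,
    raising_mul_left q (rgt j) 1 (fun _ => rfl),
    raising_mul_right q (rgt j) (qSgn q (rgt j) * (twist q (rgt j))⁻¹)
      (fun h => by rw [qSgn_even q h, twist_even q h, mul_inv_cancel]), ← Module.End.mul_apply,
    ← Module.End.mul_apply (charOp q _).1, ← Module.End.mul_apply (charOp q _).1, ← Units.val_mul,
    ← Units.val_mul, ← map_mul, ← map_mul, e1, e2, map_one]
  rfl

theorem lowering_one (i : Fin (m + n)) : lowering q i 1 = 0 := by
  rw [← xmon_zero, lowering_xmon]; simp [downCoeff]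

theorem opE_one (j : Fin (m + n - 1)) : opE q m n j 1 = 0 := by
  rw [opE_eq, Module.End.mul_apply, lowering_one, map_zero]

theorem opF_one (j : Fin (m + n - 1)) : opF q m n j 1 = 0 := by
  rw [opF_eq, Module.End.mul_apply, lowering_one, map_zero]

/-- `X_i D_i` is the `q`-analogue of the number operator. -/
theorem raising_lowering_xmon (i : Fin (m + n)) {β : Fin (m + n) → ℕ} (hβ : IsExpo β) :
    (raising q i * lowering q i) (xmon q β) = qNum q (β i) • xmon q β := by
  by_cases hb : β i = 0
  · simp [lowering_xmon, downCoeff, hb, qNum_zero]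
  by_cases h : i.1 < m
  · obtain ⟨γ, rfl⟩ := exists_add_single hb
    simp [lowering_xmon, raising_xmon, downCoeff, upCoeff, h]
  · have h1 := (IsExpo.eq_zero_or_one hβ h).resolve_left hb
    obtain ⟨γ, rfl⟩ := exists_add_single hb
    simp at h1
    simp [lowering_xmon, raising_xmon, downCoeff, upCoeff, h, h1, qNum_one]

theorem lowering_raising_xmon (i : Fin (m + n)) {β : Fin (m + n) → ℕ} (hβ : IsExpo β) :
    (lowering q i * raising q i) (xmon q β)
      = (if i.1 < m then qNum q (β i + 1) else qNum q (1 - β i)) • xmon q β := by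
  by_cases h : i.1 < m
  · simp [lowering_xmon, raising_xmon, downCoeff, upCoeff, h]
  · rcases IsExpo.eq_zero_or_one hβ h with h1 | h1 <;>
      simp [lowering_xmon, raising_xmon, downCoeff, upCoeff, h, h1, qNum_one, qNum_zero]

theorem qNum_eq (hq : (q : k) ^ 2 ≠ 1) (b : ℕ) :
    qNum q b = ((q : k) ^ b - ((q : k) ^ b)⁻¹) / ((q : k) - (q : k)⁻¹) := by
  have h : (q : k) - (q : k)⁻¹ ≠ 0 := fun h => hq (by
    field_simp at h
    linear_combination h)
  rw [eq_div_iff h]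
  simpa using qNum_mul q b

/-- The relation between `E_j` and `F_j`. Both sides are diagonal, and on `x^β` the relation is an
identity in `q`, `q^(β_j)` and `q^(β_{j+1})`. -/
theorem opE_opF (hq : (q : k) ^ 2 ≠ 1) (j : Fin (m + n - 1)) :
    opE q m n j * opF q m n j - (-1 : k) ^ (par j * par j) • (opF q m n j * opE q m n j)
      = (((q ^ sgn (lft j) : kˣ) : k) - ((q ^ (-sgn (lft j)) : kˣ) : k))⁻¹
          • ((charOp q (cartanChar q .sl j)).1 - (charOp q (cartanChar q .sl j)⁻¹).1) := by
  have O := oscillators (m := m) (n := n) q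
  have hne := (lft_lt_rgt j).ne
  have c1 : opE q m n j * opF q m n j = (raising q (lft j) * lowering q (lft j))
      * (lowering q (rgt j) * raising q (rgt j)) := by
    rw [opE_eq, opF_eq, mul_assoc, ← mul_assoc (lowering q (rgt j)), mul_assoc (raising q (lft j))]
    congr 1
    exact ((O.DD _ _).mul_right (O.XD _ _ hne.symm).symm).symm.eq
  have c2 : opF q m n j * opE q m n j = (lowering q (lft j) * raising q (lft j))
      * (raising q (rgt j) * lowering q (rgt j)) := by
    rw [opE_eq, opF_eq, mul_assoc, ← mul_assoc (lowering q (lft j)), ← mul_assoc,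
      ((O.XD _ _ hne.symm).mul_right (O.XX (rgt j) (lft j))).eq, mul_assoc]
  have hE : ∀ β : Fin (m + n) → ℕ, ∏ i, cartanChar q .sl j i ^ β i
      = qSgn q (lft j) ^ β (lft j) * (qSgn q (rgt j) ^ β (rgt j))⁻¹ := fun β => by
    rw [Finset.prod_eq_mul (lft j) (rgt j) hne]
    · simp [cartanChar, hne, hne.symm]
    · intro l _ hl
      simp [cartanChar, hl.1, hl.2]
    · simp
    · simp
  refine xmon_ext q fun β hβ => ?_
  have h : (q : k) - (q : k)⁻¹ ≠ 0 := fun h => hq (by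
    field_simp at h
    linear_combination h)
  rw [LinearMap.sub_apply, LinearMap.smul_apply, LinearMap.smul_apply, LinearMap.sub_apply, c1, c2,
    Module.End.mul_apply, Module.End.mul_apply (lowering q (lft j) * _), lowering_raising_xmon q _ hβ,
    raising_lowering_xmon q _ hβ, map_smul, map_smul, lowering_raising_xmon q _ hβ,
    raising_lowering_xmon q _ hβ, charOp_xmon, charOp_xmon]
  simp only [Pi.inv_apply, inv_pow, Finset.prod_inv_distrib, hE, smul_smul, ← sub_smul]
  congr 1
  have hl : (lft j).1 = j.1 := rfl
  have hr : (rgt j).1 = j.1 + 1 := rfl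
  rcases lt_trichotomy (j.1 + 1) m with hj | hj | hj
  · have h1 : j.1 < m := by omega
    simp [hl, hr, h1, hj, sgn, qSgn, par, IsOdd, hj.ne, qNum_eq q hq]
    field_simp
    ring
  · have h1 : j.1 < m := by omega
    have h2 : ¬ (rgt j).1 < m := by omega
    rcases IsExpo.eq_zero_or_one hβ h2 with h3 | h3
    · simp [hl, hr, hj, h1, h3, sgn, qSgn, par, IsOdd, qNum_eq q hq]
      field_simp
    · simp [hl, hr, hj, h1, h3, sgn, qSgn, par, IsOdd, qNum_eq q hq]
      field_simp
      ring
  · have h1 : ¬ (lft j).1 < m := by omega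
    have h2 : ¬ (rgt j).1 < m := by omega
    rcases IsExpo.eq_zero_or_one hβ h1 with h1' | h1' <;>
      rcases IsExpo.eq_zero_or_one hβ h2 with h3 | h3 <;>
      simp [h1, h2, h3, h1', hj.ne', sgn, qSgn, par, IsOdd, qNum_zero, qNum_one] <;>
      field_simp
    ring

/-- The operators of the generators satisfy the defining relations of `𝒰_q`. -/
theorem relations_opGen (hq : (q : k) ^ 2 ≠ 1) (s : Series) :
    Relations q s (opGen (m := m) (n := n) q s) := by
  have O := oscillators (m := m) (n := n) q
  have hcomm : ∀ c d : Fin (m + n) → kˣ, (charOp q c).1 * (charOp q d).1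
      = (charOp q d).1 * (charOp q c).1 := fun c d => by
    rw [← Units.val_mul, ← map_mul, mul_comm, map_mul, Units.val_mul]
  have hE : ∀ (c : Fin (m + n) → kˣ) j, (charOp q c).1 * opE q m n j
      = ((c (lft j) * (c (rgt j))⁻¹ : kˣ) : k) • (opE q m n j * (charOp q c).1) := fun c j => by
    rw [opE_eq, ← mul_assoc, charOp_raising, smul_mul_assoc, mul_assoc, charOp_lowering,
      mul_smul_comm, smul_smul, Units.val_mul, mul_assoc]
  have hF : ∀ (c : Fin (m + n) → kˣ) j, (charOp q c).1 * opF q m n j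
      = ((c (rgt j) * (c (lft j))⁻¹ : kˣ) : k) • (opF q m n j * (charOp q c).1) := fun c j => by
    rw [opF_eq, ← mul_assoc, charOp_raising, smul_mul_assoc, mul_assoc, charOp_lowering,
      mul_smul_comm, smul_smul, Units.val_mul, mul_assoc]
  have hgl : ∀ (i : Fin (m + n)) (j : Fin (m + n - 1)),
      cartanChar q .gl i (lft j) * (cartanChar q .gl i (rgt j))⁻¹ = q ^ pairEps i j := by
    intro i j
    have hne := (lft_lt_rgt j).ne
    by_cases h1 : i = lft j
    · subst h1; simp [cartanChar, pairEps, qSgn, hne, hne.symm]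
    · by_cases h2 : i = rgt j
      · subst h2; simp [cartanChar, pairEps, qSgn, hne, hne.symm]
      · simp [cartanChar, pairEps, h1, h2, Ne.symm h1, Ne.symm h2]
  have hw : ∀ (t : CartanIdx m n s) (j : Fin (m + n - 1)),
      cartanChar q s t (lft j) * (cartanChar q s t (rgt j))⁻¹ = q ^ cartanWeight s t j := by
    intro t j
    cases s
    · exact hgl t j
    · rw [cartanWeight, pairRoot, zpow_sub, ← hgl, ← hgl]
      simp only [cartanChar, Pi.mul_apply, Pi.inv_apply, mul_inv, inv_inv]
      exact mul_mul_mul_comm _ _ _ _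
  have hw' : ∀ (t : CartanIdx m n s) (j : Fin (m + n - 1)),
      cartanChar q s t (rgt j) * (cartanChar q s t (lft j))⁻¹ = q ^ (-cartanWeight s t j) := by
    intro t j
    rw [zpow_neg, ← hw, mul_inv, inv_inv, mul_comm]
  have hp1 : (parityChar m n * parityChar m n : Fin (m + n) → kˣ) = 1 := by
    funext i; simp only [parityChar, Pi.mul_apply, Pi.one_apply]; split_ifs <;> simp
  have hpp : (charOp q (parityChar m n)).1 * (charOp q (parityChar m n)).1 = 1 := by
    rw [← Units.val_mul, ← map_mul, hp1, map_one, Units.val_one]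
  have hp : ∀ j : Fin (m + n - 1), (parityChar m n (lft j) * (parityChar m n (rgt j))⁻¹ : kˣ)
      = (-1) ^ par j := by
    intro j
    have hl : (lft j).1 = j.1 := rfl
    have hr : (rgt j).1 = j.1 + 1 := rfl
    rcases lt_trichotomy (j.1 + 1) m with hj | hj | hj
    · have h1 : j.1 < m := by omega
      simp [parityChar, hl, hr, hj, h1, par, IsOdd, hj.ne]
    · have h1 : j.1 < m := by omega
      simp [parityChar, hl, hr, hj, h1, par, IsOdd]
    · have h1 : ¬ j.1 < m := by omega
      have h2 : ¬ j.1 + 1 < m := by omega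
      simp [parityChar, hl, hr, h2, h1, par, IsOdd, hj.ne']
  have hp' : ∀ j : Fin (m + n - 1), (parityChar m n (rgt j) * (parityChar m n (lft j))⁻¹ : kˣ)
      = (-1) ^ par j := by
    intro j
    rw [← inv_inj, mul_inv, inv_inv, mul_comm, hp, ← inv_pow, inv_neg_one]
  refine ⟨fun t u => hcomm _ _, fun t => ?_, fun t => ?_, fun t j => ?_, fun t j => ?_,
    fun i j => ?_, ?_, ?_, hpp, fun j => ?_, fun j => ?_, fun t => ?_⟩
  · simp only [opGen]
    rw [← Units.val_mul, ← map_mul, mul_inv_cancel, map_one, Units.val_one]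
  · simp only [opGen]
    rw [← Units.val_mul, ← map_mul, inv_mul_cancel, map_one, Units.val_one]
  · simp only [opGen]
    rw [hE, hw]
  · simp only [opGen]
    rw [hF, hw']
  · rw [wordK_opGen, wordKinv_opGen]
    simp only [opGen]
    split_ifs with hij
    · subst hij
      exact opE_opF q hq i
    · have hp : par i * par j = 0 := by
        have : i.1 ≠ j.1 := fun h => hij (Fin.ext h)
        by_cases hi : i.1 + 1 = m
        · have hj : ¬ j.1 + 1 = m := by omega
          simp [par, IsOdd, hj]
        · simp [par, IsOdd, hi]
      have h1 : lft i ≠ lft j := fun h => hij (Fin.ext (by simpa [lft] using h))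
      have h2 : rgt i ≠ rgt j := fun h => hij (Fin.ext (by simpa [rgt] using congrArg Fin.val h))
      rw [hp, pow_zero, one_smul, opE_eq, opF_eq, sub_eq_zero]
      exact (((O.XX _ _).mul_right (O.XD _ _ h1)).mul_left
        ((O.XD _ _ h2.symm).symm.mul_right (O.DD _ _))).eq
  · simp only [opGen, opE_eq]
    exact O.nilRelations
  · simp only [opGen, opF_eq, fun j => (O.XD _ _ (lft_lt_rgt (m := m) (n := n) j).ne').eq]
    exact O.symm.nilRelations
  · simp only [opGen]
    rw [hE, smul_mul_assoc, mul_assoc, hpp, mul_one, hp]; simp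
  · simp only [opGen]
    rw [hF, smul_mul_assoc, mul_assoc, hpp, mul_one, hp']; simp
  · simp only [opGen]
    rw [hcomm, mul_assoc, hpp, mul_one]

end ActionOfGenerators

/-! ### Module algebras and uniqueness, checked on the generators -/

section ModuleAlgebras
variable {m n : ℕ} {k : Type*} [Field k] {q : kˣ} {s : Series}

/-- The values on the generators determine whether the action makes `A` a module algebra. -/
theorem isModuleAlgebra_of_gen {H A : Type*} [Ring H] [Bialgebra k H] [Ring A] [Algebra k A]
    (ρ : H →ₐ[k] Module.End k A) (S : Set H) (hS : Algebra.adjoin k S = ⊤)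
    (hmul : ∀ h ∈ S, ∀ a b, ρ h (a * b) = LinearMap.mul' k A
      (TensorProduct.homTensorHomMap (RingHom.id k) A A A A
        (TensorProduct.map ρ.toLinearMap ρ.toLinearMap (Coalgebra.comul (R := k) h)) (a ⊗ₜ b)))
    (hone : ∀ h ∈ S, ρ h 1 = Coalgebra.counit (R := k) h • 1) : IsModuleAlgebra ρ := by
  -- the action of `H ⊗ H` on `A ⊗ A`
  let ρ₂ : H ⊗[k] H →ₐ[k] Module.End k (A ⊗[k] A) :=
    Module.endTensorEndAlgHom.comp (Algebra.TensorProduct.map ρ ρ)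
  have hρ₂ : ∀ z, TensorProduct.homTensorHomMap (RingHom.id k) A A A A
      (TensorProduct.map ρ.toLinearMap ρ.toLinearMap z) = ρ₂ z := fun _ => rfl
  simp only [hρ₂] at hmul
  have hmul' : ∀ h, ρ h ∘ₗ LinearMap.mul' k A
      = LinearMap.mul' k A ∘ₗ ρ₂ (Bialgebra.comulAlgHom k H h) := fun h => by
    have hh : h ∈ Algebra.adjoin k S := hS ▸ Algebra.mem_top
    induction hh using Algebra.adjoin_induction with
    | mem x hx => exact TensorProduct.ext' fun a b => hmul x hx a b
    | algebraMap r =>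
      rw [AlgHom.commutes, AlgHom.commutes, AlgHom.commutes]
      ext; simp [Module.algebraMap_end_apply]
    | add x y _ _ hx hy => rw [map_add, map_add, map_add, LinearMap.add_comp,
      LinearMap.comp_add, hx, hy]
    | mul x y _ _ hx hy =>
      rw [map_mul, map_mul, map_mul, Module.End.mul_eq_comp, Module.End.mul_eq_comp,
        LinearMap.comp_assoc, hy, ← LinearMap.comp_assoc, hx, LinearMap.comp_assoc]
  refine ⟨fun h a b => ?_, fun h => ?_⟩
  · rw [hρ₂]
    exact congrArg (fun f => f (a ⊗ₜ b)) (hmul' h)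
  · have hh : h ∈ Algebra.adjoin k S := hS ▸ Algebra.mem_top
    induction hh using Algebra.adjoin_induction with
    | mem x hx => exact hone x hx
    | algebraMap r =>
      rw [AlgHom.commutes, Bialgebra.counit_algebraMap]
      simp [Module.algebraMap_end_apply]
    | add x y _ _ hx hy => rw [map_add, LinearMap.add_apply, hx, hy, map_add, add_smul]
    | mul x y _ _ hx hy =>
      rw [map_mul, Module.End.mul_apply, hy, map_smul, hx, smul_smul, Bialgebra.counit_mul, mul_comm]

section Intertwining
variable {H W V : Type*} [Ring H] [Algebra k H] [AddCommGroup W] [Module k W] [AddCommGroup V]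
  [Module k V] {e : Gen m n s → H} {ι : W → V} {ρ : H →ₐ[k] Module.End k W}
  {T : Gen m n s → Module.End k V}

theorem intertwines_wordK (hρ : ∀ g w, ι (ρ (e g) w) = T g (ι w)) (j : Fin (m + n - 1)) (w : W) :
    ι (ρ (wordK s e j) w) = wordK s T j (ι w) := by
  cases s with
  | gl =>
    rw [wordK, wordK, map_mul, Module.End.mul_apply, Module.End.mul_apply, hρ, hρ]
  | sl => exact hρ _ w

theorem intertwines_wordKinv (hρ : ∀ g w, ι (ρ (e g) w) = T g (ι w)) (j : Fin (m + n - 1)) (w : W) :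
    ι (ρ (wordKinv s e j) w) = wordKinv s T j (ι w) := by
  cases s with
  | gl =>
    rw [wordKinv, wordKinv, map_mul, Module.End.mul_apply, Module.End.mul_apply, hρ, hρ]
  | sl => exact hρ _ w

theorem intertwines_pow (hρ : ∀ g w, ι (ρ (e g) w) = T g (ι w)) (g : Gen m n s) (N : ℕ) (w : W) :
    ι ((ρ (e g) ^ N) w) = (T g ^ N) (ι w) := by
  induction N generalizing w with
  | zero => rfl
  | succ N ih => rw [pow_succ, pow_succ, Module.End.mul_apply, Module.End.mul_apply, ih, hρ]

end Intertwining

/-- An algebra `W` that maps injectively and compatibly with the action to `Ω_q(m|n)`, on which the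
generators act by `opGen`, is a module algebra. -/
theorem isModuleAlgebra_of_opGen {H W : Type*} [Ring H] [Bialgebra k H] [Ring W] [Algebra k W]
    (e : Gen m n s → H) (he : Algebra.adjoin k (Set.range e) = ⊤)
    (hΔ : ∀ g, Coalgebra.comul (R := k) (e g) = deltaFam e g)
    (hε : ∀ g, Coalgebra.counit (R := k) (e g) = epsFam g)
    (ι : W →ₐ[k] Grassmann q m n) (hι : Function.Injective ι) (ρ : H →ₐ[k] Module.End k W)
    (hρ : ∀ g w, ι (ρ (e g) w) = opGen q s g (ι w)) : IsModuleAlgebra ρ := by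
  have hK : ∀ j w, ι (ρ (wordK s e j) w) = (charOp q (cartanChar q .sl j)).1 (ι w) :=
    fun j w => by rw [intertwines_wordK hρ, wordK_opGen]
  have hK' : ∀ j w, ι (ρ (wordKinv s e j) w) = (charOp q (cartanChar q .sl j)⁻¹).1 (ι w) :=
    fun j w => by rw [intertwines_wordKinv hρ, wordKinv_opGen]
  have hσ : ∀ (j : Fin (m + n - 1)) w, ι (ρ (e .sig ^ par j) w)
      = (charOp q (parityChar m n ^ par j)).1 (ι w) := fun j w => by
    rw [← sigma_pow_opGen q s, map_pow, intertwines_pow hρ]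
  refine isModuleAlgebra_of_gen ρ (Set.range e) he ?_ ?_
  · rintro _ ⟨g, rfl⟩ a b
    apply hι
    rw [hρ, map_mul, hΔ]
    cases g with
    | E j =>
      simp only [deltaFam, map_add, LinearMap.add_apply, TensorProduct.map_tmul,
        AlgHom.toLinearMap_apply, TensorProduct.homTensorHomMap_apply, TensorProduct.map_tmul,
        LinearMap.mul'_apply, map_mul, hρ, hK, hσ]
      exact opE_mul q j _ _
    | F j =>
      simp only [deltaFam, map_add, LinearMap.add_apply, TensorProduct.map_tmul,
        AlgHom.toLinearMap_apply, TensorProduct.homTensorHomMap_apply, TensorProduct.map_tmul,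
        LinearMap.mul'_apply, map_mul, Module.End.mul_apply, map_one, Module.End.one_apply, hρ]
      rw [hσ, hK', opGen, opF_mul, map_mul, Units.val_mul, Module.End.mul_apply]
    | K t =>
      simp only [deltaFam, TensorProduct.map_tmul, AlgHom.toLinearMap_apply,
        TensorProduct.homTensorHomMap_apply, LinearMap.mul'_apply, map_mul, hρ]
      rw [opGen, charOp_mul]
    | Kinv t =>
      simp only [deltaFam, TensorProduct.map_tmul, AlgHom.toLinearMap_apply,
        TensorProduct.homTensorHomMap_apply, LinearMap.mul'_apply, map_mul, hρ]
      rw [opGen, charOp_mul]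
    | sig =>
      simp only [deltaFam, TensorProduct.map_tmul, AlgHom.toLinearMap_apply,
        TensorProduct.homTensorHomMap_apply, LinearMap.mul'_apply, map_mul, hρ]
      rw [opGen, charOp_mul]
  · rintro _ ⟨g, rfl⟩
    apply hι
    rw [hρ, hε, map_smul, map_one]
    cases g with
    | E j => rw [epsFam, zero_smul]; exact opE_one q j
    | F j => rw [epsFam, zero_smul]; exact opF_one q j
    | K t => rw [epsFam, one_smul]; exact charOp_one q _
    | Kinv t => rw [epsFam, one_smul]; exact charOp_one q _
    | sig => rw [epsFam, one_smul]; exact charOp_one q _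

/-- Acting by `opGen` is acting by the quantum differential operators. -/
theorem actsByQDO_of_opGen {H W : Type*} [Ring H] [Algebra k H] [Ring W] [Algebra k W]
    {e : Gen m n s → H} {ι : W →ₐ[k] Grassmann q m n} {ρ : H →ₐ[k] Module.End k W}
    (hρ : ∀ g w, ι (ρ (e g) w) = opGen q s g (ι w)) : ActsByQDO q e ι ρ where
  E j w := hρ (.E j) w
  F j w := hρ (.F j) w
  K t w := by rw [opCartan_eq]; exact hρ (.K t) w
  calK j w := by rw [opCalK_eq, ← wordK_opGen q s, intertwines_wordK hρ]
  sig w := by rw [parityOp_eq]; exact hρ .sig w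

/-- An action through the quantum differential operators is unique: the operators of the `K`
determine those of their inverses. -/
theorem ActsByQDO.unique {H W : Type*} [Ring H] [Algebra k H] [Ring W] [Algebra k W]
    {e : Gen m n s → H} (he : Algebra.adjoin k (Set.range e) = ⊤) (R : Relations q s e)
    {ι : W →ₐ[k] Grassmann q m n} (hι : Function.Injective ι) {ρ ρ' : H →ₐ[k] Module.End k W}
    (h : ActsByQDO q e ι ρ) (h' : ActsByQDO q e ι ρ') : ρ = ρ' := by
  have hK : ∀ t, ρ (e (.K t)) = ρ' (e (.K t)) := fun t =>
    LinearMap.ext fun w => hι ((h.K t w).trans (h'.K t w).symm)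
  refine AlgHom.ext_of_adjoin_eq_top he ?_
  rintro _ ⟨g, rfl⟩
  cases g with
  | E j => exact LinearMap.ext fun w => hι ((h.E j w).trans (h'.E j w).symm)
  | F j => exact LinearMap.ext fun w => hι ((h.F j w).trans (h'.F j w).symm)
  | K t => exact hK t
  | Kinv t =>
    refine left_inv_eq_right_inv (a := ρ (e (.K t))) ?_ ?_
    · rw [← map_mul, R.Kinv_K, map_one]
    · rw [hK, ← map_mul, R.K_Kinv, map_one]
  | sig => exact LinearMap.ext fun w => hι ((h.sig w).trans (h'.sig w).symm)

end ModuleAlgebras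

/-! ### The restricted Grassmann superalgebra -/

section RestrictedAction
variable {m n : ℕ} {k : Type*} [Field k] {q : kˣ} {s : Series}
open MonomialAlgebra

theorem Uq.comul_gen (g : Gen m n s) :
    Coalgebra.comul (R := k) (Uq.gen m n q s g) = deltaFam (Uq.gen m n q s) g :=
  Uq.lift_gen (Uq.relations_gen s).delta g

theorem Uq.counit_gen (g : Gen m n s) :
    Coalgebra.counit (R := k) (Uq.gen m n q s g) = epsFam g :=
  Uq.lift_gen relations_epsFam g

theorem ResUq.comul_gen [Fact (2 < qChar q)] (g : Gen m n s) :
    Coalgebra.comul (R := k) (ResUq.gen m n q s g) = deltaFam (ResUq.gen m n q s) g :=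
  ResUq.lift_gen (ResUq.relations_gen s).delta
    (ResRelations.delta (ResUq.relations_gen s) (ResUq.resRelations_gen s)) g

theorem ResUq.counit_gen [Fact (2 < qChar q)] (g : Gen m n s) :
    Coalgebra.counit (R := k) (ResUq.gen m n q s g) = epsFam g :=
  ResUq.lift_gen relations_epsFam resRelations_epsFam g

/-- The restricted case falls under the hypothesis of the generic one. -/
theorem sq_ne_one_of_qChar [CharZero k] (h : 2 < qChar q) : (q : k) ^ 2 ≠ 1 := by
  intro hq
  -- if `q = ±1`, then `[ℓ] = ±ℓ` does not vanish
  have h1 := qNum_qChar q (by omega)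
  have : ∀ i : ℕ, ((q ^ ((qChar q : ℤ) - 1 - 2 * (i : ℤ)) : kˣ) : k)
      = ((q ^ ((qChar q : ℤ) - 1) : kˣ) : k) := fun i => by
    have hq' : q ^ (2 : ℤ) = 1 := by ext; simpa using hq
    rw [zpow_sub, zpow_mul, hq', one_zpow, inv_one, mul_one]
  simp only [qNum, this, Finset.sum_const, Finset.card_range, nsmul_eq_mul, mul_eq_zero,
    Units.ne_zero, or_false, Nat.cast_eq_zero] at h1
  omega

theorem pow_two_mul_qChar [CharZero k] (h : 2 < qChar q) : q ^ (2 * qChar q) = 1 := by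
  have h1 := qNum_mul q (qChar q)
  rw [qNum_qChar q (by omega), zero_mul] at h1
  have h2 : q ^ (qChar q : ℤ) = q ^ (-(qChar q : ℤ)) := Units.ext (sub_eq_zero.1 h1.symm)
  rw [zpow_neg, ← mul_eq_one_iff_eq_inv, zpow_natCast, ← pow_add] at h2
  rwa [two_mul]

theorem lowering_pow_xmon (i : Fin (m + n)) (N : ℕ) :
    ∀ β : Fin (m + n) → ℕ, β i < N → (lowering q i ^ N) (xmon q β) = 0 := by
  induction N with
  | zero => intro β h; omega
  | succ N ih =>
    intro β h
    rw [pow_succ, Module.End.mul_apply, lowering_xmon, map_smul]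
    by_cases hb : β i = 0
    · simp [downCoeff, hb]
    · rw [ih _ (by simp; omega), smul_zero]

variable [hl : Fact (2 < qChar q)]

variable (q) in
/-- Odd exponents need no bound, as the monomials in which one exceeds `1` vanish. -/
theorem xmon_mem {β : Fin (m + n) → ℕ} (h : ∀ i, i.1 < m → β i < qChar q) :
    xmon q β ∈ ResGrassmann q m n := by
  by_cases hβ : IsExpo β
  · rw [xmon, if_pos hβ]
    exact Submodule.subset_span ⟨_, fun i => h _ (by simp), rfl⟩
  · rw [xmon_eq_zero q hβ]; exact zero_mem _

/-- Properties of the elements of `Ω_q(m|n, 1)` that are linear need checking only on the monomials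
with exponents less than `ℓ`. -/
theorem resGrassmann_induction {P : Grassmann q m n → Prop}
    (hx : ∀ β, IsExpo β → (∀ i, β i < qChar q) → P (xmon q β)) (h0 : P 0)
    (hadd : ∀ x y, P x → P y → P (x + y)) (hsmul : ∀ (r : k) x, P x → P (r • x))
    {w : Grassmann q m n} (hw : w ∈ ResGrassmann q m n) : P w := by
  have := hl.out
  refine Submodule.span_induction (p := fun x _ => P x) ?_ h0 (fun x y _ _ => hadd x y)
    (fun r x _ => hsmul r x) hw
  rintro _ ⟨x, hx', rfl⟩
  rw [← xmon_expo]
  refine hx _ (isExpo_expo x) fun i => ?_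
  by_cases hi : i.1 < m
  · have := hx' ⟨i, hi⟩
    have e : expo x i = x.1 ⟨i, hi⟩ := Fin.append_left x.1 (ind x.2) ⟨i, hi⟩
    omega
  · rcases IsExpo.eq_zero_or_one (isExpo_expo x) hi with h | h <;> omega

theorem preserves_of_xmon {T : Module.End k (Grassmann q m n)}
    (hT : ∀ β, IsExpo β → (∀ i, β i < qChar q) → T (xmon q β) ∈ ResGrassmann q m n)
    {w : Grassmann q m n} (hw : w ∈ ResGrassmann q m n) : T w ∈ ResGrassmann q m n :=
  resGrassmann_induction (P := fun w => T w ∈ ResGrassmann q m n) hT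
    (by rw [map_zero]; exact zero_mem _) (fun x y h1 h2 => by rw [map_add]; exact add_mem h1 h2)
    (fun r x h => by rw [map_smul]; exact (ResGrassmann q m n).smul_mem h r) hw

theorem raising_mem (i : Fin (m + n)) {w : Grassmann q m n} (hw : w ∈ ResGrassmann q m n) :
    raising q i w ∈ ResGrassmann q m n := by
  refine preserves_of_xmon (fun β hβ h => ?_) hw
  rw [raising_xmon]
  by_cases hi : i.1 < m ∧ β i + 1 = qChar q
  · -- the coefficient is `[ℓ] = 0`
    have := hl.out
    rw [upCoeff, if_pos hi.1, hi.2, qNum_qChar q (by omega), zero_smul]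
    exact zero_mem _
  · refine (ResGrassmann q m n).smul_mem (xmon_mem q fun l hlm => ?_) _
    have := h l
    by_cases hli : l = i
    · subst hli; simp; omega
    · simpa [hli] using this

theorem lowering_mem (i : Fin (m + n)) {w : Grassmann q m n} (hw : w ∈ ResGrassmann q m n) :
    lowering q i w ∈ ResGrassmann q m n := by
  refine preserves_of_xmon (fun β hβ h => ?_) hw
  rw [lowering_xmon]
  refine (ResGrassmann q m n).smul_mem (xmon_mem q fun l hlm => ?_) _
  have := h l
  simp only [Pi.sub_apply]
  omega

theorem charOp_mem (c : Fin (m + n) → kˣ) {w : Grassmann q m n} (hw : w ∈ ResGrassmann q m n) :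
    (charOp q c).1 w ∈ ResGrassmann q m n := by
  refine preserves_of_xmon (fun β hβ h => ?_) hw
  rw [charOp_xmon]
  exact (ResGrassmann q m n).smul_mem (xmon_mem q fun l _ => h l) _

theorem opGen_mem (g : Gen m n s) {w : Grassmann q m n} (hw : w ∈ ResGrassmann q m n) :
    opGen q s g w ∈ ResGrassmann q m n := by
  cases g with
  | E j => rw [opGen, opE_eq, Module.End.mul_apply]; exact raising_mem _ (lowering_mem _ hw)
  | F j => rw [opGen, opF_eq, Module.End.mul_apply]; exact raising_mem _ (lowering_mem _ hw)
  | K t => rw [opGen]; exact charOp_mem _ hw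
  | Kinv t => rw [opGen]; exact charOp_mem _ hw
  | sig => rw [opGen]; exact charOp_mem _ hw

theorem lowering_pow_eq_zero (i : Fin (m + n)) {w : Grassmann q m n}
    (hw : w ∈ ResGrassmann q m n) : (lowering q i ^ qChar q) w = 0 :=
  resGrassmann_induction (P := fun w => (lowering q i ^ qChar q) w = 0)
    (fun β _ h => lowering_pow_xmon i _ β (h i)) (map_zero _)
    (fun x y h1 h2 => by rw [map_add, h1, h2, add_zero])
    (fun r x h => by rw [map_smul, h, smul_zero]) hw

theorem opE_pow_eq_zero (j : Fin (m + n - 1)) {w : Grassmann q m n}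
    (hw : w ∈ ResGrassmann q m n) : (opE q m n j ^ qChar q) w = 0 := by
  have O := oscillators (m := m) (n := n) q
  rw [opE_eq, (O.XD _ _ (lft_lt_rgt j).ne).mul_pow, Module.End.mul_apply, lowering_pow_eq_zero _ hw,
    map_zero]

theorem opF_pow_eq_zero (j : Fin (m + n - 1)) {w : Grassmann q m n}
    (hw : w ∈ ResGrassmann q m n) : (opF q m n j ^ qChar q) w = 0 := by
  have O := oscillators (m := m) (n := n) q
  rw [opF_eq, (O.XD _ _ (lft_lt_rgt j).ne').mul_pow, Module.End.mul_apply, lowering_pow_eq_zero _ hw,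
    map_zero]

theorem cartanChar_pow [CharZero k] (t : CartanIdx m n s) :
    cartanChar q s t ^ (2 * qChar q) = 1 := by
  have h : ∀ i : Fin (m + n), qSgn q i ^ (2 * qChar q) = 1 := fun i => by
    have h := pow_two_mul_qChar hl.out
    rcases sgn_cases i with hi | hi <;> simp [qSgn, hi, h]
  have h' : ∀ i : Fin (m + n),
      (Pi.mulSingle i (qSgn q i) : Fin (m + n) → kˣ) ^ (2 * qChar q) = 1 := fun i => by
    rw [← Pi.mulSingle_pow, h, Pi.mulSingle_one]
  cases s
  · exact h' t
  · rw [cartanChar, mul_pow, inv_pow, h', h', inv_one, mul_one]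

/-- The action of `𝒰_q` on `Ω_q(m|n, 1)`. -/
noncomputable def resAction (ρ : Uq m n q s →ₐ[k] Module.End k (Grassmann q m n))
    (hρ : ∀ g, ρ (Uq.gen m n q s g) = opGen q s g) :
    Uq m n q s →ₐ[k] Module.End k (ResGrassmann q m n) :=
  have h : ∀ x, ∀ w ∈ ResGrassmann q m n, ρ x w ∈ ResGrassmann q m n := fun x => by
    have hx : x ∈ Algebra.adjoin k (Set.range (Uq.gen m n q s)) := by
      rw [Uq.adjoin_gen]; exact Algebra.mem_top
    induction hx using Algebra.adjoin_induction with
    | mem x hx => obtain ⟨g, rfl⟩ := hx; intro w hw; rw [hρ]; exact opGen_mem g hw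
    | algebraMap r =>
      intro w hw
      rw [AlgHom.commutes, Module.algebraMap_end_apply]
      exact (ResGrassmann q m n).smul_mem hw r
    | add x y _ _ hx hy =>
      intro w hw; rw [map_add, LinearMap.add_apply]; exact add_mem (hx w hw) (hy w hw)
    | mul x y _ _ hx hy => intro w hw; rw [map_mul]; exact hx _ (hy w hw)
  AlgHom.ofLinearMap
    { toFun := fun x => (ρ x).restrict (p := Subalgebra.toSubmodule (ResGrassmann q m n))
        (q := Subalgebra.toSubmodule (ResGrassmann q m n)) (h x)
      map_add' := fun x y => LinearMap.ext fun w => Subtype.ext (by simp)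
      map_smul' := fun r x => LinearMap.ext fun w => Subtype.ext (by simp) }
    (LinearMap.ext fun w => Subtype.ext (by change ρ 1 w.1 = w.1; rw [map_one]; rfl))
    (fun x y => LinearMap.ext fun w => Subtype.ext (by
      change ρ (x * y) w.1 = ρ x (ρ y w.1); rw [map_mul]; rfl))

theorem resAction_apply (ρ : Uq m n q s →ₐ[k] Module.End k (Grassmann q m n))
    (hρ : ∀ g, ρ (Uq.gen m n q s g) = opGen q s g) (x : Uq m n q s) (w : ResGrassmann q m n) :
    (ResGrassmann q m n).val (resAction ρ hρ x w) = ρ x ((ResGrassmann q m n).val w) := rfl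

end RestrictedAction

end QGrassmann

theorem theorem27 {k : Type*} [Field k] [IsAlgClosed k] [CharZero k] (q : kˣ) (m n : ℕ) :
    ((q : k) ^ 2 ≠ 1 → ∀ s : QGrassmann.Series,
      ∃! ρ : QGrassmann.Uq m n q s →ₐ[k] Module.End k (QGrassmann.Grassmann q m n),
        QGrassmann.ActsByQDO q (QGrassmann.Uq.gen m n q s)
          (AlgHom.id k (QGrassmann.Grassmann q m n)) ρ
        ∧ QGrassmann.IsModuleAlgebra ρ)
    ∧ (∀ [Fact (2 < QGrassmann.qChar q)], ∀ s : QGrassmann.Series,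
      ∃! ρ : QGrassmann.ResUq m n q s →ₐ[k] Module.End k (QGrassmann.ResGrassmann q m n),
        QGrassmann.ActsByQDO q (QGrassmann.ResUq.gen m n q s)
          (QGrassmann.ResGrassmann q m n).val ρ
        ∧ QGrassmann.IsModuleAlgebra ρ) := by
  open QGrassmann in
  constructor
  · intro hq s
    let ρ := Uq.lift (relations_opGen (m := m) (n := n) q hq s)
    have hρ : ∀ g w, AlgHom.id k (Grassmann q m n) (ρ (Uq.gen m n q s g) w)
        = opGen q s g (AlgHom.id k (Grassmann q m n) w) := fun g w =>
      congrArg (fun f => f w) (Uq.lift_gen (relations_opGen q hq s) g)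
    exact ⟨ρ, ⟨actsByQDO_of_opGen hρ, isModuleAlgebra_of_opGen _ Uq.adjoin_gen Uq.comul_gen
      Uq.counit_gen _ Function.injective_id ρ hρ⟩, fun ρ' h' =>
        h'.1.unique Uq.adjoin_gen (Uq.relations_gen s) Function.injective_id
          (actsByQDO_of_opGen hρ)⟩
  · intro hl s
    have hq := sq_ne_one_of_qChar hl.out
    -- the action of `𝒰_q` restricts, and the restriction factors through `u_q`
    let ρ₀ := resAction (Uq.lift (relations_opGen (m := m) (n := n) q hq s)) (Uq.lift_gen _)
    have hι : Function.Injective (ResGrassmann q m n).val := Subtype.val_injective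
    have hρ₀ : ∀ g w, (ResGrassmann q m n).val (ρ₀ (Uq.gen m n q s g) w)
        = opGen q s g ((ResGrassmann q m n).val w) := fun g w => by
      rw [resAction_apply, Uq.lift_gen]
    have hpow := intertwines_pow hρ₀
    have R := (Uq.relations_gen s).map ρ₀
    have R' : ResRelations q fun g => ρ₀ (Uq.gen m n q s g) :=
      { E := fun j _ => LinearMap.ext fun w => hι <|
          (hpow (.E j) _ w).trans ((opE_pow_eq_zero j w.2).trans (map_zero _).symm)
        F := fun j _ => LinearMap.ext fun w => hι <|
          (hpow (.F j) _ w).trans ((opF_pow_eq_zero j w.2).trans (map_zero _).symm)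
        odd_E := fun j h => by rw [sq]; exact R.nil_E.odd j h
        odd_F := fun j h => by rw [sq]; exact R.nil_F.odd j h
        K := fun t => LinearMap.ext fun w => hι <| by
          rw [hpow, opGen, ← Units.val_pow_eq_pow_val, ← map_pow, cartanChar_pow, map_one,
            Units.val_one, Module.End.one_apply, Module.End.one_apply] }
    let ρ := ResUq.lift R R'
    have hρ : ∀ g w, (ResGrassmann q m n).val (ρ (ResUq.gen m n q s g) w)
        = opGen q s g ((ResGrassmann q m n).val w) := fun g w => by
      rw [← hρ₀, ResUq.lift_gen R R' g]
    have h1 : Algebra.adjoin k (Set.range (ResUq.gen m n q s)) = ⊤ := ResUq.adjoin_gen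
    have h2 := isModuleAlgebra_of_opGen (ResUq.gen m n q s) h1 ResUq.comul_gen
      ResUq.counit_gen (ResGrassmann q m n).val hι ρ hρ
    exact ⟨ρ, ⟨actsByQDO_of_opGen hρ, h2⟩, fun ρ' h' =>
        h'.1.unique h1 (ResUq.relations_gen s) hι (actsByQDO_of_opGen hρ)⟩
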